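/- **Setting.** Let $\mathcal S,\mathcal I,\mathcal J$ be finite index sets of messages, encoders (channel inputs) and decoders (channel outputs). Let $\mathcal A\subset\mathcal S\times\mathcal I$ be an arbitrary access structure, where $(s,i)\in\mathcal A$ means that encoder $i$ has access to message $s$, and for each $j\in\mathcal J$ let $\mathcal D(j)\subset\mathcal S$ be the set of messages to be reproduced by decoder $j$. Let $\mathcal X_i$ ($i\in\mathcal I$) be finite alphabets, and let $\mathcal Y^n_j$ ($j\in\mathcal J$, $n\in\mathbb N$) be arbitrary measurable spaces. A general channel is an arbitrary sequence of conditional distributions $\mu_{Y^n_{\mathcal J}|X^n_{\mathcal I}}$ on $\prod_j\mathcal Y^n_j$ given $x_{\mathcal I}\in\prod_i\mathcal X_i^n$; no stationarity or memorylessness is assumed. Put $\mathcal I(s)=\{i:(s,i)\in\mathcal A\}$ and $\mathcal S(i)=\{s:(s,i)\in\mathcal A\}$; for $\mathcal I'\subset\mathcal I$ put $\mathcal S(\mathcal I')=\{s:\mathcal I(s)=\mathcal I'\}$; let $\mathfrak I=\{\mathcal I'\subset\mathcal I:\mathcal S(\mathcal I')\ne\emptyset\}$ and $\mathcal S^{\circ}(\mathcal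 I')=\bigcup_{\mathcal I''\in\mathfrak I,\ \mathcal I''\supsetneq\mathcal I'}\mathcal S(\mathcal I'')$. For a family $(v_s)_{s\in\mathcal S}$ and $\mathcal T\subset\mathcal S$ write $v_{\mathcal T}=(v_s)_{s\in\mathcal T}$. **Operational region.** A rate vector $(R_s)_{s\in\mathcal S}$ with all $R_s\ge 0$ is *achievable* if for every $n$ there are finite non-empty message sets $\mathcal M^{(n)}_s$, (possibly stochastic) encoders $\Phi^{(n)}_i:\prod_{s\in\mathcal S(i)}\mathcal M^{(n)}_s\to\mathcal X_i^n$ and (possibly stochastic) decoders $\Psi^{(n)}_j:\mathcal Y^n_j\to\prod_{s\in\mathcal D(j)}\mathcal M^{(n)}_s$, using mutually independent randomness, such that $\liminf_{n\to\infty}\frac1n\log_2|\mathcal M^{(n)}_s|\ge R_s$ for all $s$ and, for independent messages $M^{(n)}_s$ uniform on $\mathcal M^{(n)}_s$ and reproductions $\widehat M^{(n)}_{j,s}$ of $M^{(n)}_s$ by decoder $j$, $$\lim_{n\to\infty}\mathrm P\bigl(\widehat M^{(n)}_{j,s}\neq M^{(n)}_s\text{ for some }j\in\mathcal J,\ s\in\mathcal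 D(j)\bigr)=0 .$$ $\mathcal R_{\mathrm{OP}}\subset\mathbb R^{\mathcal S}$ is the closure of the set of achievable rate vectors. **Spectral entropies.** For pairs $(U_n,V_n)$ of random variables with $U_n$ discrete, let $h_n=\frac1n\log_2\frac1{\mu_{U_n|V_n}(U_n|V_n)}$ and set $\overline H(\boldsymbol U|\boldsymbol V)=\inf\{\theta\in\mathbb R:\lim_n\mathrm P(h_n>\theta)=0\}$ and $\underline H(\boldsymbol U|\boldsymbol V)=\sup\{\theta\in\mathbb R:\lim_n\mathrm P(h_n<\theta)=0\}$ in $[-\infty,\infty]$. **Spectral region.** $\mathcal R_{\mathrm{IT}}$ is the set of all $(R_s)_{s\in\mathcal S}\in\mathbb R^{\mathcal S}$ for which there exist real numbers $(r_s)_{s\in\mathcal S}$ and, for every $n$, random variables $Z^n_s$ ($s\in\mathcal S$) with countable alphabets and joint law $$p_{Z^n_{\mathcal S}}(z_{\mathcal S})=\prod_{\mathcal I'\in\mathfrak I}p_{Z^n_{\mathcal S(\mathcal I')}|Z^n_{\mathcal S^{\circ}(\mathcal I')}}\bigl(z_{\mathcal S(\mathcal I')}\,|\,z_{\mathcal S^{\circ}(\mathcal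 I')}\bigr),$$ and conditional distributions $\mu_{X^n_i|Z^n_{\mathcal S(i)}}$ ($i\in\mathcal I$), such that, when $(Z^n_{\mathcal S},X^n_{\mathcal I},Y^n_{\mathcal J})$ has joint law $\mu_{Y^n_{\mathcal J}|X^n_{\mathcal I}}\bigl[\prod_{i}\mu_{X^n_i|Z^n_{\mathcal S(i)}}\bigr]p_{Z^n_{\mathcal S}}$, $$R_s\ge0\quad(s\in\mathcal S),$$ $$\sum_{s\in\mathcal S'}(R_s+r_s)\le\underline H(\boldsymbol Z_{\mathcal S'}|\boldsymbol Z_{\mathcal S^{\circ}(\mathcal I')})\quad(\mathcal I'\in\mathfrak I,\ \emptyset\ne\mathcal S'\subset\mathcal S(\mathcal I')),$$ $$\sum_{s\in\mathcal D'}r_s\ge\overline H(\boldsymbol Z_{\mathcal D'}|\boldsymbol Y_j,\boldsymbol Z_{\mathcal D(j)\setminus\mathcal D'})\quad(j\in\mathcal J,\ \emptyset\ne\mathcal D'\subset\mathcal D(j)).$$ **Theorem.** $\mathcal R_{\mathrm{OP}}=\mathcal R_{\mathrm{IT}}$. -/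

import Mathlib

open MeasureTheory ProbabilityTheory Filter Topology

noncomputable section

namespace MultiChannel

universe u v

/-! ### Message access structures -/

section Access

variable {S I : Type*} [Fintype S] [Fintype I] [DecidableEq S] [DecidableEq I]

/-- `I(s)`: the encoders that have access to message `s`. -/
def encodersOf (A : Finset (S × I)) (s : S) : Finset I :=
  Finset.univ.filter fun i => (s, i) ∈ A

/-- `S(i)`: the messages to which encoder `i` has access. -/
def messagesAt (A : Finset (S × I)) (i : I) : Finset S :=
  Finset.univ.filter fun s => (s, i) ∈ A

/-- `S(I')`: the messages `s` whose set of encoders `I(s)` is exactly `I'`. -/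
def privateMessages (A : Finset (S × I)) (I' : Finset I) : Finset S :=
  Finset.univ.filter fun s => encodersOf A s = I'

/-- The family of all `I' ⊆ I` with `S(I') ≠ ∅`. -/
def accessFamily (A : Finset (S × I)) : Finset (Finset I) :=
  Finset.univ.filter fun I' => (privateMessages A I').Nonempty

/-- `S°(I')`: the union of all `S(I'')` over the members `I''` of the family with `I' ⊊ I''`. -/
def publicMessages (A : Finset (S × I)) (I' : Finset I) : Finset S :=
  ((accessFamily A).filter fun I'' => I' ⊂ I'').biUnion (privateMessages A)

end Access

/-! ### Information spectrum quantities -/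

section Spectrum

variable {Ω : ℕ → Type*} [∀ n, MeasurableSpace (Ω n)]

/-- Limit superior in probability, as an extended real number. -/
def pLimsup (μ : ∀ n, Measure (Ω n)) (U : ∀ n, Ω n → ℝ) : EReal :=
  sInf ((fun θ : ℝ => (θ : EReal)) ''
    {θ : ℝ | Tendsto (fun n => μ n {ω | θ < U n ω}) atTop (𝓝 0)})

/-- Limit inferior in probability, as an extended real number. -/
def pLiminf (μ : ∀ n, Measure (Ω n)) (U : ∀ n, Ω n → ℝ) : EReal :=
  sSup ((fun θ : ℝ => (θ : EReal)) ''
    {θ : ℝ | Tendsto (fun n => μ n {ω | U n ω < θ}) atTop (𝓝 0)})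

variable {α β : ℕ → Type*} [∀ n, MeasurableSpace (α n)] [∀ n, StandardBorelSpace (α n)]
  [∀ n, Nonempty (α n)] [∀ n, MeasurableSpace (β n)]

/-- The normalized conditional self-information `(1/n) log₂ (1 / μ_{Uₙ|Vₙ}(Uₙ|Vₙ))`
of a discrete random variable `Uₙ` given an arbitrary random variable `Vₙ`. -/
def condInfo (μ : ∀ n, Measure (Ω n)) [∀ n, IsFiniteMeasure (μ n)]
    (U : ∀ n, Ω n → α n) (V : ∀ n, Ω n → β n) (n : ℕ) (ω : Ω n) : ℝ :=
  (1 / (n : ℝ)) *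
    Real.logb 2 (1 / (condDistrib (U n) (V n) (μ n) (V n ω)).real {U n ω})

/-- Spectral conditional sup-entropy rate. -/
def supEntropy (μ : ∀ n, Measure (Ω n)) [∀ n, IsFiniteMeasure (μ n)]
    (U : ∀ n, Ω n → α n) (V : ∀ n, Ω n → β n) : EReal :=
  pLimsup μ (condInfo μ U V)

/-- Spectral conditional inf-entropy rate. -/
def infEntropy (μ : ∀ n, Measure (Ω n)) [∀ n, IsFiniteMeasure (μ n)]
    (U : ∀ n, Ω n → α n) (V : ∀ n, Ω n → β n) : EReal :=
  pLiminf μ (condInfo μ U V)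

end Spectrum

/-! ### The channel, codes and the operational capacity region -/

section Region

variable {S I J : Type*} [Fintype S] [Fintype I] [Fintype J] [DecidableEq S] [DecidableEq I]

/-- A general channel: for each block length `n` a conditional distribution of the outputs
`Y^n_j` given the inputs `X^n_i ∈ (X i)^n`. There is no relation between different `n`. -/
abbrev Channel (X : I → Type u) (Y : ℕ → J → Type v) [∀ n j, MeasurableSpace (Y n j)] :=
  ∀ n, (∀ i, Fin n → X i) → ProbabilityMeasure (∀ j, Y n j)

/-- A (possibly stochastic) code of block length `n`. Message `s` takes values in a set of
`size s` elements, encoder `i` maps the messages in `S(i)` to a random channel input,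
and decoder `j` maps its channel output to a random reproduction of the messages in `D j`. -/
structure Code (A : Finset (S × I)) (D : J → Finset S) (X : I → Type u) (Y : ℕ → J → Type v)
    [∀ n j, MeasurableSpace (Y n j)] (n : ℕ) where
  size : S → ℕ
  size_pos : ∀ s, 0 < size s
  enc : ∀ i, (∀ s : messagesAt A i, Fin (size s)) → PMF (Fin n → X i)
  dec : ∀ j, Kernel (Y n j) (∀ s : D j, Fin (size s))
  dec_markov : ∀ j, IsMarkovKernel (dec j)

/-- The probability that some decoder reproduces one of its messages incorrectly, when the
messages are independent and uniform, and the encoders and the decoders use independent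
randomness. -/
def Code.errorProb {A : Finset (S × I)} {D : J → Finset S} {X : I → Type u}
    {Y : ℕ → J → Type v} [∀ i, Fintype (X i)] [∀ n j, MeasurableSpace (Y n j)] {n : ℕ}
    (C : Code A D X Y n) (W : Channel X Y) : ENNReal :=
  ∑ m : (∀ s, Fin (C.size s)), (∏ s, (C.size s : ENNReal)⁻¹) *
    ∑ x : (∀ i, Fin n → X i), (∏ i, C.enc i ((messagesAt A i).restrict m) (x i)) *
      ∫⁻ y, Measure.pi (fun j => C.dec j (y j))
        {mhat | ∃ j, ∃ s : D j, mhat j s ≠ m s} ∂(W n x : Measure (∀ j, Y n j))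

/-- Achievability of a vector of (nonnegative) rates. -/
def IsAchievable {X : I → Type u} {Y : ℕ → J → Type v} [∀ i, Fintype (X i)]
    [∀ n j, MeasurableSpace (Y n j)] (A : Finset (S × I)) (D : J → Finset S)
    (W : Channel X Y) (R : S → ℝ) : Prop :=
  (∀ s, 0 ≤ R s) ∧
  ∃ C : ∀ n, Code A D X Y n,
    (∀ s, (R s : EReal) ≤
      liminf (fun n : ℕ => ((Real.logb 2 ((C n).size s) / (n : ℝ) : ℝ) : EReal)) atTop) ∧
    Tendsto (fun n => (C n).errorProb W) atTop (𝓝 0)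

/-- The capacity region: the closure of the set of achievable rate vectors. -/
def ROP {X : I → Type u} {Y : ℕ → J → Type v} [∀ i, Fintype (X i)]
    [∀ n j, MeasurableSpace (Y n j)] (A : Finset (S × I)) (D : J → Finset S)
    (W : Channel X Y) : Set (S → ℝ) :=
  closure {R | IsAchievable A D W R}

/-! ### The region given by spectral entropies -/

/-- Auxiliary general sources `Z_s` with countable alphabets, whose joint law factorizes along
the access structure, together with the conditional laws of the channel inputs `X^n_i` given
the sources `Z^n_s`, `s ∈ S(i)`. -/
structure AuxSources (A : Finset (S × I)) (X : I → Type u) where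
  /-- The alphabet of `Z^n_s`. -/
  Alph : ℕ → S → Type
  countable : ∀ n s, Countable (Alph n s)
  nonempty : ∀ n s, Nonempty (Alph n s)
  /-- The joint law of `Z^n_s`, `s ∈ S`. -/
  law : ∀ n, PMF (∀ s, Alph n s)
  /-- `p(z)` is the product over `I'` of `p(z_{S(I')} | z_{S°(I')})`, where a conditional
  probability is the quotient of the two marginal probabilities. -/
  factorizes : ∀ n z, law n z = ∏ I' ∈ accessFamily A,
    (law n).map (privateMessages A I' ∪ publicMessages A I').restrict
        ((privateMessages A I' ∪ publicMessages A I').restrict z) /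
      (law n).map (publicMessages A I').restrict ((publicMessages A I').restrict z)
  /-- The conditional law of `X^n_i` given `Z^n_s`, `s ∈ S(i)`. -/
  input : ∀ n i, (∀ s : messagesAt A i, Alph n s) → PMF (Fin n → X i)

namespace AuxSources

variable {A : Finset (S × I)} {X : I → Type u} (Z : AuxSources A X)

instance (n : ℕ) (s : S) : Countable (Z.Alph n s) := Z.countable n s

instance (n : ℕ) (s : S) : Nonempty (Z.Alph n s) := Z.nonempty n s

instance (n : ℕ) (s : S) : MeasurableSpace (Z.Alph n s) := ⊤

instance (n : ℕ) (s : S) : DiscreteMeasurableSpace (Z.Alph n s) := ⟨fun _ => trivial⟩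

variable {Y : ℕ → J → Type v} [∀ i, Fintype (X i)] [∀ n j, MeasurableSpace (Y n j)]

/-- The joint law of the sources and the channel outputs: the sum over all source values `z`
and all channel inputs `x` of `p(z) ∏ᵢ p(xᵢ | z_{S(i)}) · (δ_z ⊗ W(· | x))`. -/
def joint (W : Channel X Y) (n : ℕ) : Measure ((∀ s, Z.Alph n s) × (∀ j, Y n j)) :=
  Measure.sum fun z : (∀ s, Z.Alph n s) => Measure.sum fun x : (∀ i, Fin n → X i) =>
    (Z.law n z * ∏ i, Z.input n i ((messagesAt A i).restrict z) (x i)) •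
      (Measure.dirac z).prod (W n x : Measure (∀ j, Y n j))

instance (W : Channel X Y) (n : ℕ) : IsProbabilityMeasure (Z.joint W n) := by
  constructor
  have h1 : ∀ z : (∀ s, Z.Alph n s),
      (∑ x : (∀ i, Fin n → X i), ∏ i, Z.input n i ((messagesAt A i).restrict z) (x i)) = 1 := by
    intro z
    classical
    rw [← Fintype.prod_sum (fun i (a : Fin n → X i) =>
      Z.input n i ((messagesAt A i).restrict z) a)]
    refine Finset.prod_eq_one fun i _ => ?_
    rw [← tsum_fintype (L := .unconditional _)]
    exact PMF.tsum_coe _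
  simp only [joint, Measure.sum_apply _ MeasurableSet.univ, Measure.smul_apply, measure_univ,
    smul_eq_mul, mul_one, tsum_fintype, ← Finset.mul_sum, h1]
  exact PMF.tsum_coe _

end AuxSources

/-- The rate vectors for which there are auxiliary sources and numbers `r s` with
`∑_{s ∈ S'} (R s + r s) ≤ H̲(Z_{S'} | Z_{S°(I')})` and
`∑_{s ∈ D'} r s ≥ H̄(Z_{D'} | Y_j, Z_{D(j) ∖ D'})`. -/
def RIT {X : I → Type u} {Y : ℕ → J → Type v} [∀ i, Fintype (X i)]
    [∀ n j, MeasurableSpace (Y n j)] (A : Finset (S × I)) (D : J → Finset S)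
    (W : Channel X Y) : Set (S → ℝ) :=
  {R | (∀ s, 0 ≤ R s) ∧ ∃ (Z : AuxSources A X) (r : S → ℝ),
    (∀ I' ∈ accessFamily A, ∀ S' ⊆ privateMessages A I', S'.Nonempty →
      ((∑ s ∈ S', (R s + r s) : ℝ) : EReal) ≤
        infEntropy (Z.joint W) (fun _ ω => S'.restrict ω.1)
          (fun _ ω => (publicMessages A I').restrict ω.1)) ∧
    (∀ j, ∀ D' ⊆ D j, D'.Nonempty →
      supEntropy (Z.joint W) (fun _ ω => D'.restrict ω.1)
          (fun _ ω => (ω.2 j, (D j \ D').restrict ω.1)) ≤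
        ((∑ s ∈ D', r s : ℝ) : EReal))}

end Region

end MultiChannel

end

open MeasureTheory ProbabilityTheory Filter Topology

set_option linter.unusedSectionVars false

noncomputable section

/-! Converse. Take the messages of a reliable code as the sources and put `r = 0`. They are
independent and uniform, so their self-information given other messages is the deterministic sum of
the code rates, which gives the inf-entropy constraints. Reliable decoding makes the sup-entropies
vanish: the probability that the posterior of the true messages lies below a threshold is at most
the error probability plus that threshold (`joint_condDistrib_lt_le`). A diagonal argument shows
that the achievable set is already closed.

Achievability. Hash each demanded source by a random function into `C s * L s` bins, with `C s`
about `2 ^ (n * r s)` and `L s` about `2 ^ (n * R s)`. The second index is the message, the first a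
constant fixed in advance. In the ideal experiment the sources are drawn from their law and the bin
indices are computed from them. A decoder searching the bins for values of high posterior
probability then succeeds as in Slepian-Wolf coding, because the sums of `r` dominate the
sup-entropies. In the actual code the indices are uniform and the sources are generated from them by
fixed functions, block by block from larger to smaller encoder sets. Each encoder can reproduce the
part it needs, since whatever a source depends on is known to every encoder of that source
(`sourceOf_congr`).

The two experiments must be compared. By the factorization of the source law, the density of the
actual law with respect to the ideal one is a product over blocks of `1/N`, with `N` the normalized
mass of a bin. Under the ideal law the mean of `1/N` is at most one for any hash functions
(`sum_idealLaw_mul_ratio_le_one`). Averaged over the hash functions, the mean of `N` is at most one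
plus a small term, because the sums of `R + r` stay below the inf-entropies
(`lintegral_idealLaw_mul_binMass_le`). As `N + 1/N` exceeds `2` unless `N = 1`, this forces `N` to
be close to one (`lintegral_idealLaw_mul_one_sub_ratio_le`), hence the error probabilities to be
close (`lintegral_seedLaw_le`). Averaging then fixes hash functions, generating functions and
constants (`exists_code`). The slack in all inequalities is bought by a small loss of rate
(`exists_bin_sizes`). -/

namespace MultiChannel

/-! ### Codes at a single block length, and closedness of the achievable set. -/

section Achievability

variable {S I J : Type*} [Fintype S] [Fintype I] [Fintype J] [DecidableEq S] [DecidableEq I]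
  {X : I → Type*} {Y : ℕ → J → Type*} [∀ i, Fintype (X i)] [∀ n j, MeasurableSpace (Y n j)]

/-- A code of block length `n` whose rates are at least `R s - ε` and whose error probability
is at most `ε`. -/
def HasGoodCode (A : Finset (S × I)) (D : J → Finset S) (W : Channel X Y) (R : S → ℝ) (n : ℕ)
    (ε : ℝ) : Prop :=
  ∃ C : Code A D X Y n, (∀ s, R s - ε ≤ Real.logb 2 (C.size s) / (n : ℝ)) ∧
    C.errorProb W ≤ ENNReal.ofReal ε

lemma HasGoodCode.mono {A : Finset (S × I)} {D : J → Finset S} {W : Channel X Y} {R R' : S → ℝ}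
    {n : ℕ} {ε ε' : ℝ} (h : HasGoodCode A D W R n ε) (hR : ∀ s, R' s - ε' ≤ R s - ε)
    (hε : ε ≤ ε') : HasGoodCode A D W R' n ε' := by
  obtain ⟨C, h1, h2⟩ := h
  exact ⟨C, fun s => (hR s).trans (h1 s), h2.trans (ENNReal.ofReal_le_ofReal hε)⟩

lemma Code.nonempty_input {A : Finset (S × I)} {D : J → Finset S} {n : ℕ} (hn : n ≠ 0)
    (C : Code A D X Y n) (i : I) : Nonempty (X i) := by
  obtain ⟨x, -⟩ := (C.enc i fun s => ⟨0, C.size_pos s⟩).support_nonempty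
  exact ⟨x ⟨0, Nat.pos_of_ne_zero hn⟩⟩

/-- Filler for the finitely many block lengths at which no good code is at hand. -/
lemma nonempty_code (A : Finset (S × I)) (D : J → Finset S) [∀ i, Nonempty (X i)] (n : ℕ) :
    Nonempty (Code A D X Y n) :=
  ⟨{ size := fun _ => 1
     size_pos := fun _ => one_pos
     enc := fun i _ => PMF.pure fun _ => Classical.arbitrary (X i)
     dec := fun _ => Kernel.const _ (Measure.dirac fun _ => 0)
     dec_markov := fun _ => inferInstance }⟩

/-- At index `n` use the smallest tolerance `1 / (k + 1)` with `k ≤ n` that works there. This merges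
the codes found for each fixed tolerance into one sequence whose tolerance tends to zero. -/
lemma exists_diagonal {P : ℕ → ℝ → Prop} (h : ∀ ε > 0, ∀ᶠ n in atTop, P n ε) :
    ∃ e : ℕ → ℝ, (∀ᶠ n in atTop, P n (e n)) ∧ ∀ ε > 0, ∀ᶠ n in atTop, e n ≤ ε := by
  classical
  set k : ℕ → ℕ := fun n => Nat.findGreatest (fun k => P n (1 / ((k : ℝ) + 1))) n with hk
  refine ⟨fun n => 1 / ((k n : ℝ) + 1), ?_, fun ε hε => ?_⟩
  · filter_upwards [h (1 / ((0 : ℕ) + 1)) (by norm_num)] with n hn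
    exact Nat.findGreatest_spec (P := fun k => P n (1 / ((k : ℝ) + 1))) (Nat.zero_le n) hn
  · obtain ⟨K, hK⟩ := exists_nat_one_div_lt hε
    filter_upwards [h (1 / ((K : ℝ) + 1)) (by positivity), eventually_ge_atTop K] with n hn hKn
    have : K ≤ k n := Nat.le_findGreatest hKn hn
    refine le_trans ?_ hK.le
    have h' : (K : ℝ) ≤ k n := by exact_mod_cast this
    gcongr

lemma IsAchievable.hasGoodCode {A : Finset (S × I)} {D : J → Finset S} {W : Channel X Y}
    {R : S → ℝ} (h : IsAchievable A D W R) {ε : ℝ} (hε : 0 < ε) :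
    ∀ᶠ n in atTop, HasGoodCode A D W R n ε := by
  obtain ⟨-, C, hC, herr⟩ := h
  have h1 : ∀ᶠ n in atTop, ∀ s, R s - ε ≤ Real.logb 2 ((C n).size s) / (n : ℝ) := by
    rw [eventually_all]
    intro s
    have h2 : ((R s - ε : ℝ) : EReal) <
        liminf (fun n : ℕ => ((Real.logb 2 ((C n).size s) / (n : ℝ) : ℝ) : EReal)) atTop :=
      lt_of_lt_of_le (by exact_mod_cast sub_lt_self _ hε) (hC s)
    filter_upwards [eventually_lt_of_lt_liminf h2] with n hn
    exact_mod_cast hn.le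
  have h3 : ∀ᶠ n in atTop, (C n).errorProb W ≤ ENNReal.ofReal ε :=
    herr.eventually_le_const (by simpa using hε)
  filter_upwards [h1, h3] with n a b
  exact ⟨C n, a, b⟩

lemma isAchievable_of_hasGoodCode {A : Finset (S × I)} {D : J → Finset S} {W : Channel X Y}
    {R : S → ℝ} (hR : ∀ s, 0 ≤ R s)
    (h : ∀ ε > 0, ∀ᶠ n in atTop, HasGoodCode A D W R n ε) : IsAchievable A D W R := by
  classical
  obtain ⟨e, he, he0⟩ := exists_diagonal h
  -- An encoder of positive block length outputs at least one letter, so the filler codes exist.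
  have hX : ∀ i, Nonempty (X i) := by
    obtain ⟨n, ⟨C, -⟩, hn⟩ := ((h 1 one_pos).and (eventually_ne_atTop 0)).exists
    exact C.nonempty_input hn
  set C : ∀ n, Code A D X Y n := fun n =>
    if h : HasGoodCode A D W R n (e n) then h.choose else (nonempty_code A D n).some with hCdef
  have hC : ∀ᶠ n in atTop, (∀ s, R s - e n ≤ Real.logb 2 ((C n).size s) / (n : ℝ)) ∧
      (C n).errorProb W ≤ ENNReal.ofReal (e n) := by
    filter_upwards [he] with n hn
    have : C n = hn.choose := dif_pos hn
    rw [this]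
    exact hn.choose_spec
  refine ⟨hR, C, fun s => ?_, ?_⟩
  · refine le_of_forall_lt fun a ha => ?_
    obtain ⟨c, hac, hc⟩ := EReal.lt_iff_exists_real_btwn.1 ha
    have hc' : c < R s := by exact_mod_cast hc
    refine hac.trans_le (le_liminf_of_le (by isBoundedDefault) ?_)
    filter_upwards [hC, he0 (R s - c) (by linarith)] with n hn hn'
    have := hn.1 s
    exact_mod_cast (show c ≤ Real.logb 2 ((C n).size s) / (n : ℝ) by linarith)
  · refine ENNReal.tendsto_nhds_zero.2 fun δ hδ => ?_
    obtain ⟨x, hx0, hx⟩ : ∃ x : ℝ, 0 < x ∧ ENNReal.ofReal x ≤ δ := by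
      rcases eq_or_ne δ ⊤ with rfl | hδ'
      · exact ⟨1, one_pos, le_top⟩
      · exact ⟨δ.toReal, ENNReal.toReal_pos hδ.ne' hδ', ENNReal.ofReal_toReal_le⟩
    filter_upwards [hC, he0 x hx0] with n hn hn'
    exact hn.2.trans ((ENNReal.ofReal_le_ofReal hn').trans hx)

/-- Codes for an achievable vector within `ε / 2` also serve the limit point at tolerance `ε`; the
closure therefore adds nothing. -/
lemma isAchievable_of_mem_ROP {A : Finset (S × I)} {D : J → Finset S} {W : Channel X Y}
    {R : S → ℝ} (h : R ∈ ROP A D W) : IsAchievable A D W R := by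
  refine isAchievable_of_hasGoodCode (fun s => ?_) fun ε hε => ?_
  · have hcl : IsClosed {R : S → ℝ | 0 ≤ R s} := isClosed_le continuous_const (continuous_apply s)
    exact closure_minimal (fun R hR => hR.1 s) hcl h
  · obtain ⟨R', hR', hd⟩ := Metric.mem_closure_iff.1 h (ε / 2) (half_pos hε)
    filter_upwards [IsAchievable.hasGoodCode hR' (half_pos hε)] with n hn
    refine hn.mono (fun s => ?_) (by linarith)
    have := (dist_le_pi_dist R R' s).trans_lt hd
    rw [Real.dist_eq, abs_lt] at this
    linarith [this.2]

end Achievability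

/-! ### Finite products, marginals and the partition of messages into blocks. -/

section FiniteProducts

variable {S : Type*} [Fintype S] [DecidableEq S]

/-- Split the coordinates into `T` and its complement: the factors outside `T` sum out to one. -/
lemma sum_prod_mul_restrict {κ : S → Type*} [∀ s, Fintype (κ s)] (T : Finset S)
    (a : ∀ s, κ s → ENNReal) (ha : ∀ s ∉ T, ∑ k, a s k = 1)
    (h : (∀ s : T, κ s) → ENNReal) :
    ∑ k : (∀ s, κ s), (∏ s, a s (k s)) * h (T.restrict k) =
      ∑ v : (∀ s : T, κ s), (∏ s : T, a s (v s)) * h v := by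
  rw [← (Equiv.piEquivPiSubtypeProd (· ∈ T) κ).symm.sum_comp, Fintype.sum_prod_type]
  refine Finset.sum_congr rfl fun v _ => ?_
  have h1 : ∀ w : (∀ s : {s // s ∉ T}, κ s),
      T.restrict ((Equiv.piEquivPiSubtypeProd (· ∈ T) κ).symm (v, w)) = v := by
    intro w
    ext s
    simp [Equiv.piEquivPiSubtypeProd]
  have h2 : ∀ w : (∀ s : {s // s ∉ T}, κ s),
      ∏ s, a s ((Equiv.piEquivPiSubtypeProd (· ∈ T) κ).symm (v, w) s) =
        (∏ s : T, a s (v s)) * ∏ s : {s // s ∉ T}, a s (w s) := by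
    intro w
    rw [← Fintype.prod_subtype_mul_prod_subtype (· ∈ T)]
    congr 1
    · refine Finset.prod_congr (by ext; simp) fun s _ => ?_
      simp [Equiv.piEquivPiSubtypeProd]
    · refine Finset.prod_congr rfl fun s _ => ?_
      simp [Equiv.piEquivPiSubtypeProd, s.2]
  simp only [h1, h2]
  have h3 : ∑ w : (∀ s : {s // s ∉ T}, κ s), ∏ s : {s // s ∉ T}, a s (w s) = 1 := by
    rw [← Fintype.prod_sum (fun (s : {s // s ∉ T}) (k : κ s) => a s k)]
    exact Finset.prod_eq_one fun s _ => ha s s.2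
  rw [← Finset.sum_mul, ← Finset.mul_sum, h3, mul_one]

/-- The marginal probability of the coordinates of `z` in `T`. -/
def marg {Alph : S → Type*} (p : PMF (∀ s, Alph s)) (T : Finset S) (z : ∀ s, Alph s) : ENNReal :=
  p.map T.restrict (T.restrict z)

lemma marg_eq_tsum {Alph : S → Type*} (p : PMF (∀ s, Alph s)) (T : Finset S) (z : ∀ s, Alph s) :
    open Classical in
    marg p T z = ∑' z', if T.restrict z = T.restrict z' then p z' else 0 := by
  rw [marg, PMF.map_apply]
  exact tsum_congr fun z' => by congr

lemma marg_le_one {Alph : S → Type*} (p : PMF (∀ s, Alph s)) (T : Finset S) (z : ∀ s, Alph s) :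
    marg p T z ≤ 1 := PMF.coe_le_one _ _

lemma apply_le_marg {Alph : S → Type*} (p : PMF (∀ s, Alph s)) (T : Finset S) (z : ∀ s, Alph s) :
    p z ≤ marg p T z := by
  classical
  rw [marg_eq_tsum]
  refine le_trans ?_ (ENNReal.le_tsum z)
  simp

lemma prod_accessFamily {I : Type*} [Fintype I] [DecidableEq I] {M : Type*} [CommMonoid M]
    (A : Finset (S × I)) (f : S → M) :
    ∏ I' ∈ accessFamily A, ∏ s ∈ privateMessages A I', f s = ∏ s, f s := by
  refine Finset.prod_fiberwise_of_maps_to (fun s _ => ?_) f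
  simp only [accessFamily, Finset.mem_filter, Finset.mem_univ, true_and]
  exact ⟨s, by simp [privateMessages]⟩

lemma disjoint_private_public {I : Type*} [Fintype I] [DecidableEq I]
    (A : Finset (S × I)) (I' : Finset I) :
    Disjoint (privateMessages A I') (publicMessages A I') := by
  rw [Finset.disjoint_left]
  intro s hs hs'
  simp only [privateMessages, publicMessages, Finset.mem_filter, Finset.mem_univ, true_and,
    Finset.mem_biUnion] at hs hs'
  obtain ⟨I'', ⟨-, h⟩, h'⟩ := hs'
  exact h.ne (hs.symm.trans h')

end FiniteProducts

/-! ### Conditional self-information and limits in probability. -/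

section Spectrum

variable {Ω : ℕ → Type*} [∀ n, MeasurableSpace (Ω n)]
  {α β : ℕ → Type*} [∀ n, MeasurableSpace (α n)] [∀ n, StandardBorelSpace (α n)]
  [∀ n, Nonempty (α n)] [∀ n, MeasurableSpace (β n)]
  (μ : ∀ n, Measure (Ω n)) [∀ n, IsFiniteMeasure (μ n)]
  (U : ∀ n, Ω n → α n) (V : ∀ n, Ω n → β n) {n : ℕ} {ω : Ω n} {θ : ℝ}

lemma condInfo_nonneg : 0 ≤ condInfo μ U V n ω := by
  refine mul_nonneg (by positivity) ?_
  rcases eq_or_lt_of_le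
    (measureReal_nonneg : 0 ≤ (condDistrib (U n) (V n) (μ n) (V n ω)).real {U n ω}) with h | h
  · rw [← h]; simp
  · exact Real.logb_nonneg one_lt_two ((one_le_div h).2 measureReal_le_one)

lemma measure_lt_of_lt_condInfo (hn : n ≠ 0) (h : θ < condInfo μ U V n ω) :
    condDistrib (U n) (V n) (μ n) (V n ω) {U n ω} < ENNReal.ofReal (2 ^ (-(n * θ))) := by
  rw [ENNReal.lt_ofReal_iff_toReal_lt (measure_ne_top _ _), ← measureReal_def]
  have hn' : (0 : ℝ) < n := by positivity
  rcases eq_or_lt_of_le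
    (measureReal_nonneg : 0 ≤ (condDistrib (U n) (V n) (μ n) (V n ω)).real {U n ω}) with h0 | h0
  · rw [← h0]; positivity
  · rw [condInfo, one_div_mul_eq_div, lt_div_iff₀ hn', one_div, Real.logb_inv, lt_neg,
      mul_comm, Real.logb_lt_iff_lt_rpow one_lt_two h0] at h
    exact h

/-- Nonvanishing is essential here: the logarithm of `1 / 0` is `0` by convention, so a value of
conditional probability zero has self-information `0` and not `∞`. -/
lemma lt_condInfo_of_measure_lt (hn : n ≠ 0)
    (h0 : condDistrib (U n) (V n) (μ n) (V n ω) {U n ω} ≠ 0)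
    (h : condDistrib (U n) (V n) (μ n) (V n ω) {U n ω} < ENNReal.ofReal (2 ^ (-(n * θ)))) :
    θ < condInfo μ U V n ω := by
  rw [ENNReal.lt_ofReal_iff_toReal_lt (measure_ne_top _ _), ← measureReal_def] at h
  have hn' : (0 : ℝ) < n := by positivity
  have h0 : 0 < (condDistrib (U n) (V n) (μ n) (V n ω)).real {U n ω} :=
    ENNReal.toReal_pos h0 (measure_ne_top _ _)
  rw [condInfo, one_div_mul_eq_div, lt_div_iff₀ hn', one_div, Real.logb_inv, lt_neg,
      mul_comm, Real.logb_lt_iff_lt_rpow one_lt_two h0]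
  exact h

lemma condInfo_lt_of_lt_measure (hn : n ≠ 0)
    (h : ENNReal.ofReal (2 ^ (-(n * θ))) < condDistrib (U n) (V n) (μ n) (V n ω) {U n ω}) :
    condInfo μ U V n ω < θ := by
  rw [ENNReal.ofReal_lt_iff_lt_toReal (by positivity) (measure_ne_top _ _),
    ← measureReal_def] at h
  have hn' : (0 : ℝ) < n := by positivity
  have h0 : 0 < (condDistrib (U n) (V n) (μ n) (V n ω)).real {U n ω} :=
    lt_trans (by positivity) h
  rw [condInfo, one_div_mul_eq_div, div_lt_iff₀ hn', one_div, Real.logb_inv, neg_lt,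
      mul_comm, Real.lt_logb_iff_rpow_lt one_lt_two h0]
  exact h

lemma tendsto_of_lt_infEntropy {c : ℝ} (h : (c : EReal) ≤ infEntropy μ U V) (hθ : θ < c) :
    Tendsto (fun n => μ n {ω | condInfo μ U V n ω < θ}) atTop (𝓝 0) := by
  have h1 : (θ : EReal) < infEntropy μ U V := lt_of_lt_of_le (by exact_mod_cast hθ) h
  obtain ⟨_, ⟨θ', h', rfl⟩, hlt⟩ := lt_sSup_iff.1 h1
  have hlt : θ < θ' := EReal.coe_lt_coe_iff.1 hlt
  exact tendsto_of_tendsto_of_tendsto_of_le_of_le tendsto_const_nhds h' (fun _ => zero_le)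
    fun n => measure_mono fun ω (hω : _ < _) => lt_trans hω hlt

lemma tendsto_of_supEntropy_lt {c : ℝ} (h : supEntropy μ U V ≤ (c : EReal)) (hθ : c < θ) :
    Tendsto (fun n => μ n {ω | θ < condInfo μ U V n ω}) atTop (𝓝 0) := by
  have h1 : supEntropy μ U V < (θ : EReal) := lt_of_le_of_lt h (by exact_mod_cast hθ)
  obtain ⟨_, ⟨θ', h', rfl⟩, hlt⟩ := sInf_lt_iff.1 h1
  have hlt : θ' < θ := EReal.coe_lt_coe_iff.1 hlt
  exact tendsto_of_tendsto_of_tendsto_of_le_of_le tendsto_const_nhds h' (fun _ => zero_le)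
    fun n => measure_mono fun ω (hω : _ < _) => lt_trans hlt hω

/-- Self-information of a discrete variable is nonnegative, so no negative threshold qualifies. This
is what makes `r s` nonnegative for every demanded message. -/
lemma supEntropy_nonneg [∀ n, IsProbabilityMeasure (μ n)] : 0 ≤ supEntropy μ U V := by
  refine le_sInf ?_
  rintro _ ⟨θ, hθ, rfl⟩
  by_contra hlt
  have hlt : θ < 0 := EReal.coe_lt_coe_iff.1 (not_le.1 hlt)
  have : ∀ n, μ n {ω | θ < condInfo μ U V n ω} = 1 := fun n => by
    rw [show {ω | θ < condInfo μ U V n ω} = Set.univ from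
      Set.eq_univ_of_forall fun ω => hlt.trans_le (condInfo_nonneg μ U V), measure_univ]
  rw [Set.mem_ofPred_eq] at hθ
  simp only [this] at hθ
  exact one_ne_zero (tendsto_nhds_unique tendsto_const_nhds hθ)

end Spectrum

/-! ### Disintegration along a discrete variable. -/

section CondDistrib

variable {Ω α β : Type*} [MeasurableSpace Ω] [MeasurableSpace α] [StandardBorelSpace α]
  [Nonempty α] [MeasurableSpace β] {μ : Measure Ω} [IsFiniteMeasure μ] {U : Ω → α} {V : Ω → β}

lemma lintegral_eq_lintegral_tsum_condDistrib [Countable α] (hU : Measurable U)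
    (hV : Measurable V) {f : β × α → ENNReal} (hf : Measurable f) :
    ∫⁻ ω, f (V ω, U ω) ∂μ = ∫⁻ v, ∑' u, f (v, u) * condDistrib U V μ v {u} ∂(μ.map V) := by
  rw [← lintegral_map (f := f) (g := fun ω => (V ω, U ω)) hf (by fun_prop),
    ← compProd_map_condDistrib hU.aemeasurable, Measure.lintegral_compProd hf]
  simp only [lintegral_countable']

lemma measurable_condDistrib_singleton [Countable α] :
    Measurable fun q : β × α => condDistrib U V μ q.1 {q.2} :=
  measurable_from_prod_countable_left fun u =>
    Kernel.measurable_coe _ (measurableSet_singleton u)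

/-- Disintegration writes this probability as a sum of conditional probabilities over the values
where they vanish. It disposes of the points at which the self-information takes its conventional
value `0`. -/
lemma measure_condDistrib_eq_zero [Countable α] (hU : Measurable U) (hV : Measurable V) :
    μ {ω | condDistrib U V μ (V ω) {U ω} = 0} = 0 := by
  have hm : MeasurableSet {q : β × α | condDistrib U V μ q.1 {q.2} = 0} :=
    measurable_condDistrib_singleton (measurableSet_singleton 0)
  have h := lintegral_eq_lintegral_tsum_condDistrib (μ := μ) hU hV
    (f := Set.indicator {q : β × α | condDistrib U V μ q.1 {q.2} = 0} 1)
    (measurable_one.indicator hm)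
  have h2 : ∀ ω, Set.indicator {q : β × α | condDistrib U V μ q.1 {q.2} = 0}
      (1 : β × α → ENNReal) (V ω, U ω) =
      Set.indicator {ω | condDistrib U V μ (V ω) {U ω} = 0} 1 ω := fun ω => rfl
  simp only [h2] at h
  rw [← lintegral_indicator_one
    (show MeasurableSet {ω | condDistrib U V μ (V ω) {U ω} = 0} from hm.preimage (hV.prodMk hU)), h]
  have h3 : ∀ v u, Set.indicator {q : β × α | condDistrib U V μ q.1 {q.2} = 0}
      (1 : β × α → ENNReal) (v, u) * condDistrib U V μ v {u} = 0 := by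
    intro v u
    by_cases hq : condDistrib U V μ v {u} = 0 <;> simp [hq]
  simp [h3]

end CondDistrib

/-! ### Joint law of sources and channel outputs. -/

section Joint

variable {S I J : Type*} [Fintype S] [Fintype I] [Fintype J] [DecidableEq S] [DecidableEq I]
  {X : I → Type*} {Y : ℕ → J → Type*} [∀ i, Fintype (X i)] [∀ n j, MeasurableSpace (Y n j)]
  {A : Finset (S × I)} (Z : AuxSources A X) (W : Channel X Y) (n : ℕ)

/-- The conditional law of the channel outputs given the sources. -/
def AuxSources.output (z : ∀ s, Z.Alph n s) : Measure (∀ j, Y n j) :=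
  ∑ x : (∀ i, Fin n → X i), (∏ i, Z.input n i ((messagesAt A i).restrict z) (x i)) •
    (W n x : Measure (∀ j, Y n j))

lemma sum_prod_pmf {κ : I → Type*} [∀ i, Fintype (κ i)] (a : ∀ i, PMF (κ i)) :
    ∑ x : (∀ i, κ i), ∏ i, a i (x i) = 1 := by
  rw [← Fintype.prod_sum (fun i (k : κ i) => a i k)]
  refine Finset.prod_eq_one fun i _ => ?_
  rw [← tsum_fintype (L := .unconditional _)]
  exact PMF.tsum_coe _

instance (z : ∀ s, Z.Alph n s) : IsProbabilityMeasure (Z.output W n z) := by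
  constructor
  rw [AuxSources.output, Measure.finsetSum_apply]
  simp only [Measure.smul_apply, measure_univ, smul_eq_mul, mul_one]
  exact sum_prod_pmf _

lemma AuxSources.lintegral_output (z : ∀ s, Z.Alph n s) (f : (∀ j, Y n j) → ENNReal) :
    ∫⁻ y, f y ∂Z.output W n z = ∑ x : (∀ i, Fin n → X i),
      (∏ i, Z.input n i ((messagesAt A i).restrict z) (x i)) * ∫⁻ y, f y ∂(W n x : Measure _) := by
  rw [AuxSources.output, lintegral_finsetSum_measure]
  exact Finset.sum_congr rfl fun x _ => by rw [lintegral_smul_measure, smul_eq_mul]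

lemma AuxSources.lintegral_joint {f : (∀ s, Z.Alph n s) × (∀ j, Y n j) → ENNReal}
    (hf : Measurable f) :
    ∫⁻ ω, f ω ∂Z.joint W n = ∑' z, Z.law n z * ∫⁻ y, f (z, y) ∂Z.output W n z := by
  have hz : ∀ z, Measurable fun y => f (z, y) := fun z => hf.comp measurable_prodMk_left
  rw [AuxSources.joint, lintegral_sum_measure]
  refine tsum_congr fun z => ?_
  rw [lintegral_sum_measure, tsum_fintype, Z.lintegral_output, Finset.mul_sum]
  refine Finset.sum_congr rfl fun x _ => ?_
  rw [lintegral_smul_measure, Measure.dirac_prod, lintegral_map hf measurable_prodMk_left,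
    smul_eq_mul, mul_assoc]

lemma AuxSources.joint_apply {B : Set ((∀ s, Z.Alph n s) × (∀ j, Y n j))}
    (hB : MeasurableSet B) :
    Z.joint W n B = ∑' z, Z.law n z * Z.output W n z {y | (z, y) ∈ B} := by
  rw [← lintegral_indicator_one hB, Z.lintegral_joint W n (measurable_one.indicator hB)]
  refine tsum_congr fun z => ?_
  congr 1
  rw [← lintegral_indicator_one
    (show MeasurableSet {y | (z, y) ∈ B} from measurable_prodMk_left hB)]
  rfl

lemma AuxSources.map_fst_joint : (Z.joint W n).map Prod.fst = (Z.law n).toMeasure := by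
  refine Measure.ext_of_singleton fun z => ?_
  rw [Measure.map_apply measurable_fst (measurableSet_singleton z),
    Z.joint_apply W n (measurable_fst (measurableSet_singleton z)),
    PMF.toMeasure_apply_singleton _ _ (measurableSet_singleton z), tsum_eq_single z]
  · simp
  · intro z' hz'
    simp [hz']

lemma AuxSources.map_restrict_joint (T : Finset S) :
    (Z.joint W n).map (fun ω => T.restrict ω.1) = ((Z.law n).map T.restrict).toMeasure := by
  rw [← PMF.toMeasure_map _ _ (by fun_prop), ← Z.map_fst_joint W n,
    Measure.map_map (by fun_prop) measurable_fst]
  rfl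

lemma AuxSources.condDistrib_restrict (T U : Finset S) (z : ∀ s, Z.Alph n s)
    (hz : marg (Z.law n) U z ≠ 0) :
    condDistrib (fun ω => T.restrict ω.1) (fun ω => U.restrict ω.1) (Z.joint W n)
      (U.restrict z) {T.restrict z} = marg (Z.law n) (T ∪ U) z / marg (Z.law n) U z := by
  have h1 : ∀ T : Finset S, (Z.joint W n).map (fun ω => T.restrict ω.1) {T.restrict z} =
      marg (Z.law n) T z := fun T => by
    rw [Z.map_restrict_joint, PMF.toMeasure_apply_singleton _ _ (measurableSet_singleton _)]
    rfl
  have hm : ∀ T : Finset S, Measurable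
      fun ω : (∀ s, Z.Alph n s) × (∀ j, Y n j) => T.restrict ω.1 := fun T => by fun_prop
  rw [condDistrib_apply_of_ne_zero (hm T) _ (by rwa [h1]), h1, ENNReal.div_eq_inv_mul, ← h1 (T ∪ U),
    Measure.map_apply ((hm U).prodMk (hm T))
      ((measurableSet_singleton _).prod (measurableSet_singleton _)),
    Measure.map_apply (hm _) (measurableSet_singleton _)]
  congr 2
  ext ω
  simp only [Set.mem_preimage, Set.mem_prod, Set.mem_singleton_iff, funext_iff,
    Finset.restrict, Subtype.forall, Finset.mem_union]
  exact ⟨fun h s hs => hs.elim (h.2 s) (h.1 s), fun h => ⟨fun s hs => h s (.inr hs),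
    fun s hs => h s (.inl hs)⟩⟩

end Joint

/-! ### Converse: the messages of a code as sources. -/

section Converse

variable {S I J : Type*} [Fintype S] [Fintype I] [Fintype J] [DecidableEq S] [DecidableEq I]
  {X : I → Type*} {Y : ℕ → J → Type*} [∀ i, Fintype (X i)] [∀ n j, MeasurableSpace (Y n j)]
  {A : Finset (S × I)} {D : J → Finset S}

lemma sum_uniform (L : ℕ) (hL : 0 < L) : ∑ _k : Fin L, (L : ENNReal)⁻¹ = 1 := by
  rw [Finset.sum_const, Finset.card_univ, Fintype.card_fin, nsmul_eq_mul]
  exact ENNReal.mul_inv_cancel (by exact_mod_cast hL.ne') (ENNReal.natCast_ne_top L)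

/-- The uniform law of independent messages. -/
def uniformLaw (L : S → ℕ) (hL : ∀ s, 0 < L s) : PMF (∀ s, Fin (L s)) :=
  PMF.ofFintype (fun _ => ∏ s, (L s : ENNReal)⁻¹) <| by
    rw [← Fintype.prod_sum (fun s (_ : Fin (L s)) => (L s : ENNReal)⁻¹)]
    exact Finset.prod_eq_one fun s _ => sum_uniform (L s) (hL s)

lemma marg_uniformLaw (L : S → ℕ) (hL : ∀ s, 0 < L s) (T : Finset S) (z : ∀ s, Fin (L s)) :
    marg (uniformLaw L hL) T z = ∏ s ∈ T, (L s : ENNReal)⁻¹ := by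
  classical
  rw [marg_eq_tsum, tsum_fintype]
  have := sum_prod_mul_restrict T (fun s (_ : Fin (L s)) => (L s : ENNReal)⁻¹)
    (fun s _ => sum_uniform (L s) (hL s)) (fun v => if T.restrict z = v then 1 else 0)
  simp only [mul_ite, mul_one, mul_zero, Finset.sum_ite_eq, Finset.mem_univ, if_true] at this
  rw [Finset.prod_coe_sort T (fun s => (L s : ENNReal)⁻¹)] at this
  refine (Finset.sum_congr rfl fun x _ => ?_).trans this
  rw [uniformLaw, PMF.ofFintype_apply]
  congr

lemma prod_inv_ne_zero (L : S → ℕ) (T : Finset S) : ∏ s ∈ T, (L s : ENNReal)⁻¹ ≠ 0 :=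
  Finset.prod_ne_zero_iff.2 fun _ _ => ENNReal.inv_ne_zero.2 (ENNReal.natCast_ne_top _)

lemma prod_inv_ne_top (L : S → ℕ) (hL : ∀ s, 0 < L s) (T : Finset S) :
    ∏ s ∈ T, (L s : ENNReal)⁻¹ ≠ ⊤ :=
  ENNReal.prod_ne_top fun s _ => ENNReal.inv_ne_top.2 (by exact_mod_cast (hL s).ne')

lemma prod_union_div (L : S → ℕ) (hL : ∀ s, 0 < L s) {P U : Finset S} (h : Disjoint P U) :
    (∏ s ∈ P ∪ U, (L s : ENNReal)⁻¹) / ∏ s ∈ U, (L s : ENNReal)⁻¹ =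
      ∏ s ∈ P, (L s : ENNReal)⁻¹ := by
  rw [Finset.prod_union h]
  exact ENNReal.mul_div_cancel_right (prod_inv_ne_zero L U) (prod_inv_ne_top L hL U)

/-- The auxiliary sources consisting of the messages of a sequence of codes. -/
def Code.toAux (C : ∀ n, Code A D X Y n) : AuxSources A X where
  Alph n s := Fin ((C n).size s)
  countable _ _ := inferInstance
  nonempty n s := ⟨⟨0, (C n).size_pos s⟩⟩
  law n := uniformLaw (C n).size (C n).size_pos
  factorizes n z := by
    have h : ∀ T : Finset S,
        (uniformLaw (C n).size (C n).size_pos).map T.restrict (T.restrict z) =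
          ∏ s ∈ T, ((C n).size s : ENNReal)⁻¹ := fun T => marg_uniformLaw _ _ T z
    simp only [h]
    rw [Finset.prod_congr rfl fun I' _ => prod_union_div (C n).size (C n).size_pos
      (disjoint_private_public A I'), prod_accessFamily A fun s => ((C n).size s : ENNReal)⁻¹]
    rfl
  input n i := (C n).enc i

variable (C : ∀ n, Code A D X Y n) (W : Channel X Y) (n : ℕ)

lemma measurable_kernel_apply {α β : Type*} [MeasurableSpace α] [MeasurableSpace β]
    [Finite β] [MeasurableSingletonClass β] (κ : Kernel α β) (B : Set β) :
    Measurable fun a => κ a B :=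
  Kernel.measurable_coe κ (Set.toFinite B).measurableSet

lemma measurable_dec_apply (j : J) {V : Type*} [Countable V] [MeasurableSpace V]
    [MeasurableSingletonClass V] (B : V → Set (∀ s : D j, Fin ((C n).size s))) :
    Measurable fun ω : V × (∀ j, Y n j) => (C n).dec j (ω.2 j) (B ω.1) :=
  measurable_from_prod_countable_right fun z =>
    show Measurable ((fun y => (C n).dec j y (B z)) ∘ fun y : (∀ j, Y n j) => y j) from
      (measurable_kernel_apply _ _).comp (measurable_pi_apply j)

lemma lintegral_dec_le_errorProb (j : J) :
    ∫⁻ ω, (C n).dec j (ω.2 j) {m | ∃ s : D j, m s ≠ ω.1 s} ∂(Code.toAux C).joint W n ≤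
      (C n).errorProb W := by
  have := fun j => (C n).dec_markov j
  rw [AuxSources.lintegral_joint _ _ _
    (measurable_dec_apply C n j fun z : (∀ s, (Code.toAux C).Alph n s) =>
      {m | ∃ s : D j, m s ≠ z s}), Code.errorProb]
  change (∑' z : (∀ s, Fin ((C n).size s)), _) ≤ _
  rw [tsum_fintype]
  refine Finset.sum_le_sum fun z _ => ?_
  refine mul_le_mul le_rfl ?_ zero_le zero_le
  refine ((Code.toAux C).lintegral_output W n z _).trans_le ?_
  refine Finset.sum_le_sum fun x _ => ?_
  refine mul_le_mul le_rfl (lintegral_mono fun y => ?_) zero_le zero_le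
  dsimp only
  rw [← (measurePreserving_eval (fun j => (C n).dec j (y j)) j).measure_preimage
    (Set.toFinite _).measurableSet.nullMeasurableSet]
  exact measure_mono fun m ⟨s, hs⟩ => ⟨j, s, hs⟩

/-- A Verdú-Han type bound: where the posterior is below `τ`, even a randomized guess of the true
components is right with total probability at most `τ`; otherwise the decoder errs. Knowing the
remaining demanded messages does not matter, since the decoder may ignore them. -/
lemma joint_condDistrib_lt_le (j : J) {D' : Finset S} (hD' : D' ⊆ D j) (τ : ENNReal) :
    (Code.toAux C).joint W n {ω | condDistrib (fun ω => D'.restrict ω.1)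
      (fun ω => (ω.2 j, (D j \ D').restrict ω.1)) ((Code.toAux C).joint W n)
      (ω.2 j, (D j \ D').restrict ω.1) {D'.restrict ω.1} < τ} ≤
      (C n).errorProb W + τ := by
  have hMark := fun j => (C n).dec_markov j
  set Z := Code.toAux C with hZ
  set μ := Z.joint W n with hμ
  set U : (∀ s, Z.Alph n s) × (∀ j, Y n j) → ∀ s : D', Z.Alph n s :=
    fun ω => D'.restrict ω.1 with hU
  set V : (∀ s, Z.Alph n s) × (∀ j, Y n j) → Y n j × (∀ s : ↥(D j \ D'), Z.Alph n s) :=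
    fun ω => (ω.2 j, (D j \ D').restrict ω.1) with hV
  have hUm : Measurable U := by fun_prop
  have hVm : Measurable V := by fun_prop
  set q := condDistrib U V μ with hq
  set G : Set ((Y n j × (∀ s : ↥(D j \ D'), Z.Alph n s)) × (∀ s : D', Z.Alph n s)) :=
    {p | q p.1 {p.2} < τ} with hG
  have hGm : MeasurableSet G := measurable_condDistrib_singleton measurableSet_Iio
  -- The probability that the decoder's guess has the components `p.2` on `D'`.
  set g : ((Y n j × (∀ s : ↥(D j \ D'), Z.Alph n s)) × (∀ s : D', Z.Alph n s)) → ENNReal :=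
    fun p => (C n).dec j p.1.1 {m | ∀ s : D', m ⟨s, hD' s.2⟩ = p.2 s} with hg
  have hgm : Measurable g := by
    refine measurable_from_prod_countable_left fun u => ?_
    exact (measurable_kernel_apply ((C n).dec j)
      {m | ∀ s : D', m ⟨s, hD' s.2⟩ = u s}).comp measurable_fst
  have hsum : ∀ v, ∑' u, g (v, u) ≤ 1 := by
    intro v
    refine (measure_iUnion (μ := (C n).dec j v.1)
      (f := fun u : (∀ s : D', Z.Alph n s) => {m | ∀ s : D', m ⟨s, hD' s.2⟩ = u s}) ?_
      fun u => (Set.toFinite _).measurableSet).symm.trans_le prob_le_one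
    intro u u' huu'
    refine Set.disjoint_left.2 fun m hm hm' => huu' (funext fun s => ?_)
    exact (hm s).symm.trans (hm' s)
  -- On `G` the posterior is below `τ`, and the guessing probabilities sum to at most one over `u`.
  have hbound : ∫⁻ ω, G.indicator g (V ω, U ω) ∂μ ≤ τ := by
    rw [lintegral_eq_lintegral_tsum_condDistrib hUm hVm (hgm.indicator hGm)]
    have : ∀ v, ∑' u, G.indicator g (v, u) * q v {u} ≤ τ := by
      intro v
      calc ∑' u, G.indicator g (v, u) * q v {u} ≤ ∑' u, g (v, u) * τ := by
            refine ENNReal.tsum_le_tsum fun u => ?_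
            by_cases hu : (v, u) ∈ G
            · rw [Set.indicator_of_mem hu]
              exact mul_le_mul le_rfl (le_of_lt hu) zero_le zero_le
            · simp [Set.indicator_of_notMem hu]
        _ = (∑' u, g (v, u)) * τ := ENNReal.tsum_mul_right
        _ ≤ 1 * τ := mul_le_mul (hsum v) le_rfl zero_le zero_le
        _ = τ := one_mul τ
    refine (lintegral_mono this).trans ?_
    rw [lintegral_const, Measure.map_apply hVm MeasurableSet.univ, Set.preimage_univ,
      measure_univ, mul_one]
  -- Every decoder outcome either contains an error or has the true components on `D'`.
  have hpt : ∀ ω, ((fun ω => (V ω, U ω)) ⁻¹' G).indicator (fun _ => (1 : ENNReal)) ω ≤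
      (C n).dec j (ω.2 j) {m | ∃ s : D j, m s ≠ ω.1 s} + G.indicator g (V ω, U ω) := by
    intro ω
    by_cases hω : (V ω, U ω) ∈ G
    · rw [Set.indicator_of_mem (show ω ∈ (fun ω => (V ω, U ω)) ⁻¹' G from hω),
        Set.indicator_of_mem hω, ← measure_univ (μ := (C n).dec j (ω.2 j))]
      refine (measure_mono ?_).trans (measure_union_le _ _)
      intro m _
      by_cases hm : ∃ s : D j, m s ≠ ω.1 s
      · exact Or.inl hm
      · push Not at hm
        exact Or.inr fun s => hm ⟨s, hD' s.2⟩
    · rw [Set.indicator_of_notMem (show ω ∉ (fun ω => (V ω, U ω)) ⁻¹' G from hω)]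
      exact zero_le
  have hpre : MeasurableSet ((fun ω => (V ω, U ω)) ⁻¹' G) := hGm.preimage (hVm.prodMk hUm)
  calc μ ((fun ω => (V ω, U ω)) ⁻¹' G)
      = ∫⁻ ω, ((fun ω => (V ω, U ω)) ⁻¹' G).indicator 1 ω ∂μ := (lintegral_indicator_one hpre).symm
    _ ≤ ∫⁻ ω, ((C n).dec j (ω.2 j) {m | ∃ s : D j, m s ≠ ω.1 s} +
          G.indicator g (V ω, U ω)) ∂μ := lintegral_mono hpt
    _ = ∫⁻ ω, (C n).dec j (ω.2 j) {m | ∃ s : D j, m s ≠ ω.1 s} ∂μ +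
          ∫⁻ ω, G.indicator g (V ω, U ω) ∂μ :=
        lintegral_add_right _ ((hgm.indicator hGm).comp (hVm.prodMk hUm))
    _ ≤ (C n).errorProb W + τ := add_le_add (lintegral_dec_le_errorProb C W n j) hbound

lemma tendsto_ofReal_two_rpow_neg {θ : ℝ} (hθ : 0 < θ) :
    Tendsto (fun n : ℕ => ENNReal.ofReal (2 ^ (-(n * θ)))) atTop (𝓝 0) := by
  rw [← ENNReal.ofReal_zero]
  refine ENNReal.tendsto_ofReal ?_
  have : (fun n : ℕ => (2 : ℝ) ^ (-(n * θ))) = fun n : ℕ => ((2 : ℝ) ^ (-θ)) ^ n := by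
    ext n
    rw [← Real.rpow_natCast, ← Real.rpow_mul (by norm_num)]
    congr 1
    ring
  rw [this]
  exact tendsto_pow_atTop_nhds_zero_of_lt_one (by positivity)
    (Real.rpow_lt_one_of_one_lt_of_neg one_lt_two (by linarith))

lemma supEntropy_toAux_le_zero (herr : Tendsto (fun n => (C n).errorProb W) atTop (𝓝 0))
    (j : J) {D' : Finset S} (hD' : D' ⊆ D j) :
    supEntropy ((Code.toAux C).joint W) (fun _ ω => D'.restrict ω.1)
      (fun _ ω => (ω.2 j, (D j \ D').restrict ω.1)) ≤ 0 := by
  refine EReal.le_of_forall_lt_iff_le.1 fun θ hθ => sInf_le ⟨θ, ?_, rfl⟩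
  have hθ : 0 < θ := by exact_mod_cast hθ
  have hlim : Tendsto (fun n : ℕ => (C n).errorProb W + ENNReal.ofReal (2 ^ (-(n * θ)))) atTop
      (𝓝 0) := by simpa using herr.add (tendsto_ofReal_two_rpow_neg hθ)
  refine tendsto_of_tendsto_of_tendsto_of_le_of_le' tendsto_const_nhds hlim
    (Eventually.of_forall fun _ => zero_le) ?_
  filter_upwards [eventually_ne_atTop 0] with n hn
  refine (measure_mono fun ω hω => ?_).trans (joint_condDistrib_lt_le C W n j hD' _)
  exact measure_lt_of_lt_condInfo ((Code.toAux C).joint W) (fun _ ω => D'.restrict ω.1)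
    (fun _ ω => (ω.2 j, (D j \ D').restrict ω.1)) hn hω

lemma condInfo_toAux {T U : Finset S} (hTU : Disjoint T U)
    (ω : (∀ s, (Code.toAux C).Alph n s) × (∀ j, Y n j)) :
    condInfo ((Code.toAux C).joint W) (fun _ ω => T.restrict ω.1) (fun _ ω => U.restrict ω.1) n ω =
      ∑ s ∈ T, Real.logb 2 ((C n).size s) / n := by
  have hm : ∀ T, marg ((Code.toAux C).law n) T ω.1 = ∏ s ∈ T, ((C n).size s : ENNReal)⁻¹ :=
    fun T => marg_uniformLaw _ (C n).size_pos T ω.1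
  have h := (Code.toAux C).condDistrib_restrict W n T U ω.1
    (by rw [hm]; exact prod_inv_ne_zero _ _)
  rw [hm, hm, prod_union_div _ (C n).size_pos hTU] at h
  rw [condInfo, measureReal_def, h, ENNReal.toReal_prod]
  simp only [ENNReal.toReal_inv, ENNReal.toReal_natCast, Finset.prod_inv_distrib, one_div, inv_inv]
  rw [Real.logb_prod _ _ fun s _ => by exact_mod_cast ((C n).size_pos s).ne', Finset.mul_sum]
  exact Finset.sum_congr rfl fun s _ => by rw [div_eq_inv_mul]

/-- By `condInfo_toAux` the self-information is the constant sum of the code rates, so the event in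
the definition of the inf-entropy is eventually empty. -/
lemma le_infEntropy_toAux {R : S → ℝ}
    (hR : ∀ s, (R s : EReal) ≤
      liminf (fun n : ℕ => ((Real.logb 2 ((C n).size s) / (n : ℝ) : ℝ) : EReal)) atTop)
    {T U : Finset S} (hTU : Disjoint T U) (hT : T.Nonempty) :
    ((∑ s ∈ T, R s : ℝ) : EReal) ≤ infEntropy ((Code.toAux C).joint W)
      (fun _ ω => T.restrict ω.1) (fun _ ω => U.restrict ω.1) := by
  refine EReal.ge_of_forall_gt_iff_ge.1 fun θ hθ => le_sSup ⟨θ, ?_, rfl⟩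
  have hθ : θ < ∑ s ∈ T, R s := by exact_mod_cast hθ
  have hc : (0 : ℝ) < T.card := by exact_mod_cast hT.card_pos
  -- The slack is shared equally among the members of `T`.
  set ε := ((∑ s ∈ T, R s) - θ) / T.card with hε
  have hε0 : 0 < ε := div_pos (by linarith) hc
  have h1 : ∀ᶠ n in atTop, ∀ s, R s - ε < Real.logb 2 ((C n).size s) / (n : ℝ) := by
    rw [eventually_all]
    intro s
    have h2 : ((R s - ε : ℝ) : EReal) <
        liminf (fun n : ℕ => ((Real.logb 2 ((C n).size s) / (n : ℝ) : ℝ) : EReal)) atTop :=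
      lt_of_lt_of_le (by exact_mod_cast sub_lt_self _ hε0) (hR s)
    filter_upwards [eventually_lt_of_lt_liminf h2] with n hn
    exact_mod_cast hn
  refine tendsto_const_nhds.congr' ?_
  filter_upwards [h1] with n hn
  symm
  rw [show {ω | condInfo ((Code.toAux C).joint W) (fun _ ω => T.restrict ω.1)
    (fun _ ω => U.restrict ω.1) n ω < θ} = ∅ from ?_, measure_empty]
  refine Set.eq_empty_of_forall_notMem fun ω (hω : _ < θ) => ?_
  rw [condInfo_toAux C W n hTU] at hω
  have h3 : ∑ s ∈ T, (R s - ε) ≤ ∑ s ∈ T, Real.logb 2 ((C n).size s) / (n : ℝ) :=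
    Finset.sum_le_sum fun s _ => (hn s).le
  rw [Finset.sum_sub_distrib, Finset.sum_const, nsmul_eq_mul, hε, mul_div_cancel₀ _ hc.ne'] at h3
  linarith

lemma mem_RIT_of_isAchievable {W : Channel X Y} {R : S → ℝ} (h : IsAchievable A D W R) :
    R ∈ RIT A D W := by
  obtain ⟨hR0, C, hR, herr⟩ := h
  refine ⟨hR0, Code.toAux C, 0, fun I' _ S' hS' hne => ?_, fun j D' hD' _ => ?_⟩
  · simp only [Pi.zero_apply, add_zero]
    exact le_infEntropy_toAux C W hR
      (Finset.disjoint_of_subset_left hS' (disjoint_private_public A I')) hne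
  · simpa using supEntropy_toAux_le_zero C W herr j hD'

end Converse

/-! ### Random binning: the ideal law and the inverse bin mass. -/

section Extraction

variable {S : Type*} [Fintype S] [DecidableEq S] {Alph κ : S → Type*}
  [∀ s, Fintype (κ s)] [∀ s, Nonempty (κ s)] [∀ s, DecidableEq (κ s)]

/-- The number of bins, divided by the probability of the bin `k` under the
hash function `b` for the messages in `Dem`; no binning takes place for the other messages. -/
def binWeight (Dem : Finset S) (s : S) (b : Alph s → κ s) (k : κ s) (a : Alph s) : ENNReal :=
  if s ∈ Dem then if b a = k then (Fintype.card (κ s) : ENNReal) else 0 else 1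

variable (p : PMF (∀ s, Alph s)) (Dem : Finset S) (b : ∀ s, Alph s → κ s)

lemma card_ne_zero (s : S) : (Fintype.card (κ s) : ENNReal) ≠ 0 := by
  exact_mod_cast Fintype.card_ne_zero

lemma card_inv_mul (s : S) :
    (Fintype.card (κ s) : ENNReal)⁻¹ * (Fintype.card (κ s) : ENNReal) = 1 :=
  ENNReal.inv_mul_cancel (card_ne_zero s) (ENNReal.natCast_ne_top _)

lemma sum_card_inv (s : S) : ∑ _k : κ s, (Fintype.card (κ s) : ENNReal)⁻¹ = 1 := by
  rw [Finset.sum_const, Finset.card_univ, nsmul_eq_mul, mul_comm]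
  exact card_inv_mul s

lemma sum_card_inv_mul_binWeight (s : S) (b : Alph s → κ s) (a : Alph s) :
    ∑ k, (Fintype.card (κ s) : ENNReal)⁻¹ * binWeight Dem s b k a = 1 := by
  unfold binWeight
  split_ifs with h
  · simp only [mul_ite, mul_zero, card_inv_mul, Finset.sum_ite_eq, Finset.mem_univ, if_true]
  · simp only [mul_one, sum_card_inv]

/-- The joint law of the bin indices and the sources. -/
def idealLaw (k : ∀ s, κ s) (z : ∀ s, Alph s) : ENNReal :=
  p z * ∏ s, ((Fintype.card (κ s) : ENNReal)⁻¹ * binWeight Dem s (b s) (k s) (z s))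

lemma sum_idealLaw (z : ∀ s, Alph s) : ∑ k, idealLaw p Dem b k z = p z := by
  unfold idealLaw
  rw [← Finset.mul_sum, ← Fintype.prod_sum
    (fun s k => (Fintype.card (κ s) : ENNReal)⁻¹ * binWeight Dem s (b s) k (z s)),
    Finset.prod_eq_one fun s _ => sum_card_inv_mul_binWeight Dem s (b s) (z s), mul_one]

open Classical in
/-- The total weight, in the bin `v`, of the source values that agree with `z` on `U`. -/
def binMass (P U : Finset S) (v : ∀ s : P, κ s) (z : ∀ s, Alph s) : ENNReal :=
  ∑' z', if U.restrict z = U.restrict z' then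
    p z' * ∏ s : P, binWeight Dem s (b s) (v s) (z' s) else 0

/-- The ratio of the marginal probability and the total weight in a bin, truncated at `1`. -/
def binRatio (P U : Finset S) (k : ∀ s, κ s) (z : ∀ s, Alph s) : ENNReal :=
  min 1 (marg p U z / binMass p Dem b P U (P.restrict k) z)

/-- The denominator depends on `z` only through `f z`. Exchanging the roles of `z` and `z'` in the
double sum therefore leaves the mean of `M / M`, which is at most one. -/
lemma tsum_mul_ratio_le_one {Z Q : Type*} (p : PMF Z) (f : Z → Q) (w : Z → ENNReal) :
    open Classical in
    ∑' z, p z * w z * ((∑' z', if f z = f z' then p z' else 0) /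
      ∑' z', if f z = f z' then p z' * w z' else 0) ≤ 1 := by
  classical
  set M : Z → ENNReal := fun z => ∑' z', if f z = f z' then p z' * w z' else 0 with hM
  have hMeq : ∀ z z', f z = f z' → M z = M z' := fun z z' h => by simp only [hM, h]
  calc ∑' z, p z * w z * ((∑' z', if f z = f z' then p z' else 0) / M z)
      = ∑' z, ∑' z', p z' * (if f z' = f z then p z * w z else 0) / M z' := by
        refine tsum_congr fun z => ?_
        rw [div_eq_mul_inv, mul_comm (∑' _, _), ← mul_assoc, ← ENNReal.tsum_mul_left]
        refine tsum_congr fun z' => ?_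
        by_cases h : f z = f z'
        · rw [if_pos h, if_pos h.symm, hMeq z z' h, div_eq_mul_inv]
          ring
        · rw [if_neg h, if_neg fun h' => h h'.symm]
          simp
    _ = ∑' z', p z' * (M z' / M z') := by
        rw [ENNReal.tsum_comm]
        refine tsum_congr fun z' => ?_
        simp only [div_eq_mul_inv, mul_assoc]
        rw [ENNReal.tsum_mul_left, ENNReal.tsum_mul_right]
    _ ≤ ∑' z', p z' := by
        refine ENNReal.tsum_le_tsum fun z' => ?_
        exact mul_le_of_le_one_right' ENNReal.div_self_le_one
    _ = 1 := p.tsum_coe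

/-- The mean of `1/N` under the ideal law. Bin indices outside `P` sum out, and for each fixed `v`
the bound is `tsum_mul_ratio_le_one`; nothing is required of the hash functions. -/
lemma sum_idealLaw_mul_ratio_le_one (P U : Finset S) :
    ∑ k, ∑' z, idealLaw p Dem b k z *
      (marg p U z / binMass p Dem b P U (P.restrict k) z) ≤ 1 := by
  classical
  have h1 : ∀ z, ∑ k, idealLaw p Dem b k z *
      (marg p U z / binMass p Dem b P U (P.restrict k) z) =
      ∑ v : (∀ s : P, κ s), (∏ s : P, (Fintype.card (κ s) : ENNReal)⁻¹) *
        (p z * (∏ s : P, binWeight Dem s (b s) (v s) (z s)) *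
          (marg p U z / binMass p Dem b P U v z)) := by
    intro z
    have := sum_prod_mul_restrict P
      (fun s k => (Fintype.card (κ s) : ENNReal)⁻¹ * binWeight Dem s (b s) k (z s))
      (fun s _ => sum_card_inv_mul_binWeight Dem s (b s) (z s))
      (fun v => p z * (marg p U z / binMass p Dem b P U v z))
    calc _ = _ := Finset.sum_congr rfl fun k _ => by unfold idealLaw; ring
      _ = _ := this
      _ = _ := Finset.sum_congr rfl fun v _ => by rw [Finset.prod_mul_distrib]; ring
  calc ∑ k, ∑' z, idealLaw p Dem b k z * (marg p U z / binMass p Dem b P U (P.restrict k) z)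
      = ∑' z, ∑ k, idealLaw p Dem b k z *
          (marg p U z / binMass p Dem b P U (P.restrict k) z) :=
        (Summable.tsum_finsetSum fun _ _ => ENNReal.summable).symm
    _ = ∑ v : (∀ s : P, κ s), (∏ s : P, (Fintype.card (κ s) : ENNReal)⁻¹) *
        ∑' z, (p z * (∏ s : P, binWeight Dem s (b s) (v s) (z s)) *
          (marg p U z / binMass p Dem b P U v z)) := by
        simp only [h1]
        rw [Summable.tsum_finsetSum fun _ _ => ENNReal.summable]
        exact Finset.sum_congr rfl fun v _ => ENNReal.tsum_mul_left
    _ ≤ ∑ v : (∀ s : P, κ s), ∏ s : P, (Fintype.card (κ s) : ENNReal)⁻¹ := by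
        refine Finset.sum_le_sum fun v _ => mul_le_of_le_one_right' ?_
        refine le_trans (le_of_eq ?_) (tsum_mul_ratio_le_one p U.restrict
          (fun z => ∏ s : P, binWeight Dem s (b s) (v s) (z s)))
        refine tsum_congr fun z => ?_
        rw [marg_eq_tsum, binMass]
        congr! 2 <;> exact tsum_congr fun z' => by congr
    _ = 1 := by
        rw [← Fintype.prod_sum (fun (s : P) (_ : κ s) => (Fintype.card (κ s) : ENNReal)⁻¹)]
        exact Finset.prod_eq_one fun s _ => sum_card_inv (s : S)

/-- Put `y = x⁻¹`. If `y ≤ 1`, then `(1 - y) ^ 2 ≤ (1 - y) ^ 2 / y = x + y - 2`, and `(1 - y) * η ≤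
η ^ 2 + (1 - y) ^ 2`. The deviation is thus controlled by the means of `x` and `1/x` alone; the term
`2 / η` stays on the left to avoid truncated subtraction in `ENNReal`. -/
lemma one_sub_min_add_le (x η : ℝ) (hx : 0 < x) (hη : 0 < η) :
    (1 - min 1 x⁻¹) + 2 / η ≤ η + (x + x⁻¹) / η := by
  have h1 : x * x⁻¹ = 1 := mul_inv_cancel₀ hx.ne'
  have hx' : 0 < x⁻¹ := inv_pos.2 hx
  set y := x⁻¹ with hy
  have key : (1 - min 1 y) * η + 2 ≤ η * η + (x + y) := by
    rcases le_total 1 y with h | h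
    · rw [min_eq_left h]
      nlinarith [sq_nonneg (x - y), sq_nonneg η]
    · rw [min_eq_right h]
      have hx1 : 1 ≤ x := by nlinarith
      have : (1 - y) ^ 2 ≤ x + y - 2 := by nlinarith [mul_nonneg (sub_nonneg.2 hx1) (sq_nonneg (1 - y))]
      nlinarith [sq_nonneg (1 - y - η)]
  have : (1 - min 1 y) + 2 / η = ((1 - min 1 y) * η + 2) / η := by field_simp
  rw [this, show η + (x + y) / η = (η * η + (x + y)) / η by field_simp]
  gcongr

lemma ennreal_one_sub_min_add_le {N : ENNReal} (hN0 : N ≠ 0) (hN : N ≠ ⊤) {η : ℝ} (hη : 0 < η) :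
    (1 - min 1 N⁻¹) + 2 / ENNReal.ofReal η ≤
      ENNReal.ofReal η + (N + N⁻¹) / ENNReal.ofReal η := by
  lift N to NNReal using hN
  have hN0' : N ≠ 0 := by exact_mod_cast hN0
  have hpos : (0 : ℝ) < N := by exact_mod_cast pos_iff_ne_zero.2 hN0'
  have h := one_sub_min_add_le N η hpos hη
  lift η to NNReal using hη.le
  have hη' : η ≠ 0 := by
    rintro rfl
    simp at hη
  rw [ENNReal.ofReal_coe_nnreal, ← ENNReal.coe_inv hN0']
  have h2 : (1 - min 1 N⁻¹) + 2 / η ≤ η + (N + N⁻¹) / η := by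
    rw [← NNReal.coe_le_coe]
    push_cast [NNReal.coe_sub (min_le_left 1 N⁻¹)]
    exact h
  have := ENNReal.coe_le_coe.2 h2
  push_cast [ENNReal.coe_div hη'] at this
  exact this

end Extraction

/-! ### The mean bin mass over random hash functions. -/

section ExtractionMean

variable {S : Type*} [Fintype S] [DecidableEq S] {Alph κ : S → Type*}
  [∀ s, Countable (Alph s)]
  [∀ s, Fintype (κ s)] [∀ s, Nonempty (κ s)] [∀ s, DecidableEq (κ s)]
  [∀ s, MeasurableSpace (κ s)] [∀ s, MeasurableSingletonClass (κ s)]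

variable (p : PMF (∀ s, Alph s)) (Dem : Finset S)

@[fun_prop]
lemma measurable_binWeight (s : S) (k : κ s) (a : Alph s) :
    Measurable fun b : Alph s → κ s => binWeight Dem s b k a := by
  unfold binWeight
  by_cases h : s ∈ Dem
  · simp only [h, if_true]
    exact Measurable.ite (measurableSet_eq_fun (measurable_pi_apply a) measurable_const)
      measurable_const measurable_const
  · simp only [h, if_false]
    exact measurable_const

/-- The normalized mean over the bins of the product of two bin weights. -/
def pairWeight (P : Finset S) (s : S) (b : Alph s → κ s) (a a' : Alph s) : ENNReal :=
  ∑ k, (Fintype.card (κ s) : ENNReal)⁻¹ * binWeight Dem s b k a *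
    if s ∈ P then binWeight Dem s b k a' else 1

@[fun_prop]
lemma measurable_pairWeight (P : Finset S) (s : S) (a a' : Alph s) :
    Measurable fun b : Alph s → κ s => pairWeight Dem P s b a a' := by
  unfold pairWeight
  by_cases h : s ∈ P
  · simp only [h, if_true]; fun_prop
  · simp only [h, if_false]; fun_prop

lemma pairWeight_of_notMem {P : Finset S} {s : S} (h : s ∉ P) (b : Alph s → κ s)
    (a a' : Alph s) : pairWeight Dem P s b a a' = 1 := by
  unfold pairWeight
  simp only [h, if_false, mul_one]
  exact sum_card_inv_mul_binWeight Dem s b a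

lemma pairWeight_of_notMem_dem {P : Finset S} {s : S} (h : s ∉ Dem) (b : Alph s → κ s)
    (a a' : Alph s) : pairWeight Dem P s b a a' = 1 := by
  unfold pairWeight binWeight
  simp only [h, if_false, mul_one, ite_self]
  exact sum_card_inv s

lemma pairWeight_of_mem {P : Finset S} {s : S} (hP : s ∈ P) (hD : s ∈ Dem) (b : Alph s → κ s)
    (a a' : Alph s) :
    pairWeight Dem P s b a a' = if b a = b a' then (Fintype.card (κ s) : ENNReal) else 0 := by
  unfold pairWeight binWeight
  simp only [hP, hD, if_true]
  simp only [mul_ite, mul_zero, card_inv_mul, ite_mul, zero_mul, one_mul]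
  simp [eq_comm]

variable (ν : ∀ s, Measure (Alph s → κ s)) [∀ s, IsProbabilityMeasure (ν s)]

/-- For distinct symbols the collision probability cancels the weight. Only a true coincidence costs
the number of bins, and for a demanded message outside `B` that number is one. -/
lemma lintegral_pairWeight_le {P B : Finset S} (hB : ∀ s ∈ Dem, s ∉ B → Fintype.card (κ s) = 1)
    (hν : ∀ s, ∀ a a' : Alph s, a ≠ a' →
      ν s {b | b a = b a'} ≤ (Fintype.card (κ s) : ENNReal)⁻¹) (s : S) (a a' : Alph s) :
    open Classical in
    ∫⁻ b, pairWeight Dem P s b a a' ∂ν s ≤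
      if s ∈ P ∩ B ∧ a = a' then (Fintype.card (κ s) : ENNReal) else 1 := by
  classical
  have hcard : (1 : ENNReal) ≤ Fintype.card (κ s) := by
    exact_mod_cast Fintype.card_pos
  by_cases hP : s ∈ P
  swap
  · simp only [pairWeight_of_notMem Dem hP]
    simp [hP]
  by_cases hD : s ∈ Dem
  swap
  · simp only [pairWeight_of_notMem_dem Dem hD]
    split_ifs <;> simp [hcard]
  simp only [pairWeight_of_mem Dem hP hD]
  have hm : MeasurableSet {b : Alph s → κ s | b a = b a'} :=
    measurableSet_eq_fun (measurable_pi_apply a) (measurable_pi_apply a')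
  have h1 : ∫⁻ b, (if b a = b a' then (Fintype.card (κ s) : ENNReal) else 0) ∂ν s =
      Fintype.card (κ s) * ν s {b | b a = b a'} := by
    rw [← lintegral_indicator_const hm]
    exact lintegral_congr fun b => by simp [Set.indicator]
  rw [h1]
  by_cases haa : a = a'
  · by_cases hsB : s ∈ B
    · rw [if_pos ⟨Finset.mem_inter.2 ⟨hP, hsB⟩, haa⟩]
      exact mul_le_of_le_one_right' prob_le_one
    · rw [if_neg (fun h => hsB (Finset.mem_inter.1 h.1).2), hB s hD hsB]
      simpa using prob_le_one
  · rw [if_neg fun h => haa h.2]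
    calc _ ≤ (Fintype.card (κ s) : ENNReal) * (Fintype.card (κ s) : ENNReal)⁻¹ := by
          gcongr
          exact hν s a a' haa
      _ = 1 := by rw [mul_comm]; exact card_inv_mul s

lemma lintegral_pi_prod {Θ : S → Type*} [∀ s, MeasurableSpace (Θ s)] (ν : ∀ s, Measure (Θ s))
    [∀ s, IsProbabilityMeasure (ν s)] (f : ∀ s, Θ s → ENNReal) (hf : ∀ s, Measurable (f s)) :
    ∫⁻ b, ∏ s, f s (b s) ∂Measure.pi ν = ∏ s, ∫⁻ b, f s b ∂ν s := by
  refine (lintegral_prod_eq_prod_lintegral_of_indepFun Finset.univ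
    (fun s (b : ∀ s, Θ s) => f s (b s)) (iIndepFun_pi fun s => (hf s).aemeasurable)
    fun s => (hf s).comp (measurable_pi_apply s)).trans ?_
  exact Finset.prod_congr rfl fun s _ =>
    (measurePreserving_eval ν s).lintegral_comp (hf s)

lemma sum_prod_binWeight (P : Finset S) (b : ∀ s, Alph s → κ s) (z z' : ∀ s, Alph s) :
    ∑ k, (∏ s, ((Fintype.card (κ s) : ENNReal)⁻¹ * binWeight Dem s (b s) (k s) (z s))) *
      ∏ s : P, binWeight Dem s (b s) (P.restrict k s) (z' s) =
    ∏ s, pairWeight Dem P s (b s) (z s) (z' s) := by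
  unfold pairWeight
  rw [Fintype.prod_sum (fun s k => (Fintype.card (κ s) : ENNReal)⁻¹ *
    binWeight Dem s (b s) k (z s) * if s ∈ P then binWeight Dem s (b s) k (z' s) else 1)]
  refine Finset.sum_congr rfl fun k _ => ?_
  rw [Finset.prod_mul_distrib (f := fun s =>
    (Fintype.card (κ s) : ENNReal)⁻¹ * binWeight Dem s (b s) (k s) (z s))]
  congr 1
  simp only [Finset.restrict]
  rw [Finset.prod_coe_sort P (fun s => binWeight Dem s (b s) (k s) (z' s)),
    Finset.prod_ite_mem, Finset.univ_inter]

/-- The hash functions are independent over `s`, so the mean factorizes. The set of components in `P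
∩ B` where `z` and `z'` coincide is one of the sets `S'`, and enlarging to the sum over all of them
makes marginals appear once `z'` is summed out. -/
lemma lintegral_sum_prod_binWeight_le {P B : Finset S}
    (hB : ∀ s ∈ Dem, s ∉ B → Fintype.card (κ s) = 1)
    (hν : ∀ s, ∀ a a' : Alph s, a ≠ a' →
      ν s {b | b a = b a'} ≤ (Fintype.card (κ s) : ENNReal)⁻¹) (z z' : ∀ s, Alph s) :
    open Classical in
    ∫⁻ b, ∏ s, pairWeight Dem P s (b s) (z s) (z' s) ∂Measure.pi ν ≤
      ∑ S' ∈ (P ∩ B).powerset, if S'.restrict z = S'.restrict z' then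
        ∏ s ∈ S', (Fintype.card (κ s) : ENNReal) else 0 := by
  classical
  rw [lintegral_pi_prod ν (fun s b => pairWeight Dem P s b (z s) (z' s)) fun s => by fun_prop]
  calc ∏ s, ∫⁻ b, pairWeight Dem P s b (z s) (z' s) ∂ν s
      ≤ ∏ s, if s ∈ P ∩ B ∧ z s = z' s then (Fintype.card (κ s) : ENNReal) else 1 :=
        Finset.prod_le_prod' fun s _ => lintegral_pairWeight_le Dem ν hB hν s (z s) (z' s)
    _ = ∏ s ∈ (P ∩ B).filter (fun s => z s = z' s), (Fintype.card (κ s) : ENNReal) := by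
        rw [← Finset.prod_filter]
        congr 1
        ext s
        simp
    _ = if ((P ∩ B).filter (fun s => z s = z' s)).restrict z =
          ((P ∩ B).filter (fun s => z s = z' s)).restrict z' then
        ∏ s ∈ (P ∩ B).filter (fun s => z s = z' s), (Fintype.card (κ s) : ENNReal) else 0 := by
        rw [if_pos]
        ext s
        exact (Finset.mem_filter.1 s.2).2
    _ ≤ _ := Finset.single_le_sum
        (f := fun S' : Finset S => if S'.restrict z = S'.restrict z' then
          ∏ s ∈ S', (Fintype.card (κ s) : ENNReal) else 0) (fun _ _ => zero_le)
        (Finset.mem_powerset.2 (Finset.filter_subset _ _))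

@[fun_prop]
lemma measurable_idealLaw (k : ∀ s, κ s) (z : ∀ s, Alph s) :
    Measurable fun b : (∀ s, Alph s → κ s) => idealLaw p Dem b k z := by
  unfold idealLaw
  refine measurable_const.mul (Finset.measurable_prod _ fun s _ => measurable_const.mul ?_)
  exact (measurable_binWeight Dem s (k s) (z s)).comp (measurable_pi_apply s)

@[fun_prop]
lemma measurable_binMass (P U : Finset S) (v : ∀ s : P, κ s) (z : ∀ s, Alph s) :
    Measurable fun b : (∀ s, Alph s → κ s) => binMass p Dem b P U v z := by
  unfold binMass
  refine Measurable.tsum fun z' => ?_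
  by_cases h : U.restrict z = U.restrict z'
  · simp only [h, if_true]
    refine measurable_const.mul (Finset.measurable_prod _ fun s _ => ?_)
    exact (measurable_binWeight Dem (s : S) (v s) (z' s)).comp (measurable_pi_apply (s : S))
  · simp only [h, if_false]
    exact measurable_const

/-- The source values for which all conditional probabilities of the components in `P ∩ B`,
given those in `U`, are small compared to the numbers of bins. -/
def IsSpread (κ : S → Type*) [∀ s, Fintype (κ s)] (P U B : Finset S) (ε : ENNReal)
    (z : ∀ s, Alph s) : Prop :=
  ∀ S' ⊆ P ∩ B, S'.Nonempty →
    marg p (S' ∪ U) z / marg p U z * ∏ s ∈ S', (Fintype.card (κ s) : ENNReal) ≤ ε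

lemma tsum_ite_restrict (T U : Finset S) (z : ∀ s, Alph s) :
    open Classical in
    ∑' z', (if U.restrict z = U.restrict z' then p z' *
      (if T.restrict z = T.restrict z' then 1 else 0) else 0) = marg p (T ∪ U) z := by
  classical
  rw [marg_eq_tsum]
  refine tsum_congr fun z' => ?_
  have : (T ∪ U).restrict z = (T ∪ U).restrict z' ↔
      U.restrict z = U.restrict z' ∧ T.restrict z = T.restrict z' := by
    simp only [funext_iff, Finset.restrict, Subtype.forall, Finset.mem_union]
    exact ⟨fun h => ⟨fun s hs => h s (.inr hs), fun s hs => h s (.inl hs)⟩,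
      fun h s hs => hs.elim (h.2 s) (h.1 s)⟩
  by_cases h1 : U.restrict z = U.restrict z' <;> by_cases h2 : T.restrict z = T.restrict z' <;>
    simp [this, h1, h2]

/-- A second-moment computation for the bin that contains `z`: other source values contribute
according to where they agree with `z`, and spreadness makes every nonempty agreement negligible. -/
lemma lintegral_idealLaw_mul_binMass_le {P U B : Finset S} {ε : ENNReal}
    (hB : ∀ s ∈ Dem, s ∉ B → Fintype.card (κ s) = 1)
    (hν : ∀ s, ∀ a a' : Alph s, a ≠ a' →
      ν s {b | b a = b a'} ≤ (Fintype.card (κ s) : ENNReal)⁻¹) (z : ∀ s, Alph s)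
    (hz : IsSpread p κ P U B ε z) :
    ∫⁻ b, ∑ k, idealLaw p Dem b k z * (binMass p Dem b P U (P.restrict k) z / marg p U z)
      ∂Measure.pi ν ≤ p z * (1 + 2 ^ Fintype.card S * ε) := by
  classical
  have h1 : ∀ b : (∀ s, Alph s → κ s),
      ∑ k, idealLaw p Dem b k z * (binMass p Dem b P U (P.restrict k) z / marg p U z) =
      p z * (marg p U z)⁻¹ * ∑' z', if U.restrict z = U.restrict z' then
        p z' * ∏ s, pairWeight Dem P s (b s) (z s) (z' s) else 0 := by
    intro b
    simp only [← sum_prod_binWeight, idealLaw, binMass, div_eq_mul_inv]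
    have : ∀ k : (∀ s, κ s), ∀ c : ENNReal,
        p z * c * ((∑' z', if U.restrict z = U.restrict z' then
          p z' * ∏ s : P, binWeight Dem s (b s) (P.restrict k s) (z' s) else 0) *
            (marg p U z)⁻¹) = p z * (marg p U z)⁻¹ *
          ∑' z', if U.restrict z = U.restrict z' then
            p z' * (c * ∏ s : P, binWeight Dem s (b s) (P.restrict k s) (z' s)) else 0 := by
      intro k c
      rw [show p z * c * ((∑' z', if U.restrict z = U.restrict z' then
          p z' * ∏ s : P, binWeight Dem s (b s) (P.restrict k s) (z' s) else 0) *
            (marg p U z)⁻¹) = p z * (marg p U z)⁻¹ *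
          (c * ∑' z', if U.restrict z = U.restrict z' then
            p z' * ∏ s : P, binWeight Dem s (b s) (P.restrict k s) (z' s) else 0) by ring,
        ← ENNReal.tsum_mul_left]
      congr 1
      refine tsum_congr fun z' => ?_
      split_ifs
      · ring
      · rw [mul_zero]
    simp only [this]
    rw [← Finset.mul_sum, ← Summable.tsum_finsetSum fun _ _ => ENNReal.summable]
    congr 1
    refine tsum_congr fun z' => ?_
    split_ifs
    · rw [Finset.mul_sum]
    · simp
  simp only [h1]
  have hmeas : ∀ z' : (∀ s, Alph s), Measurable fun b : (∀ s, Alph s → κ s) =>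
      ∏ s, pairWeight Dem P s (b s) (z s) (z' s) := fun z' =>
    Finset.measurable_prod _ fun s _ =>
      (measurable_pairWeight Dem P s (z s) (z' s)).comp (measurable_pi_apply s)
  have hmeas' : ∀ z' : (∀ s, Alph s), Measurable fun b : (∀ s, Alph s → κ s) =>
      if U.restrict z = U.restrict z' then
        p z' * ∏ s, pairWeight Dem P s (b s) (z s) (z' s) else 0 := fun z' => by
    split_ifs
    · exact measurable_const.mul (hmeas z')
    · exact measurable_const
  rw [lintegral_const_mul _ (Measurable.tsum hmeas'),
    lintegral_tsum fun z' => (hmeas' z').aemeasurable, mul_assoc]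
  refine mul_le_mul le_rfl ?_ zero_le zero_le
  calc (marg p U z)⁻¹ * ∑' z', ∫⁻ b, (if U.restrict z = U.restrict z' then
          p z' * ∏ s, pairWeight Dem P s (b s) (z s) (z' s) else 0) ∂Measure.pi ν
      ≤ (marg p U z)⁻¹ * ∑' z', ∑ S' ∈ (P ∩ B).powerset,
          (∏ s ∈ S', (Fintype.card (κ s) : ENNReal)) * (if U.restrict z = U.restrict z' then
            p z' * (if S'.restrict z = S'.restrict z' then 1 else 0) else 0) := by
        refine mul_le_mul le_rfl (ENNReal.tsum_le_tsum fun z' => ?_) zero_le zero_le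
        by_cases h : U.restrict z = U.restrict z'
        · simp only [h, if_true]
          rw [lintegral_const_mul _ (hmeas z')]
          refine (mul_le_mul le_rfl (lintegral_sum_prod_binWeight_le Dem ν hB hν z z')
            zero_le zero_le).trans_eq ?_
          rw [Finset.mul_sum]
          refine Finset.sum_congr rfl fun S' _ => ?_
          split_ifs
          · ring
          · simp
        · simp [h]
    _ = (marg p U z)⁻¹ * ∑ S' ∈ (P ∩ B).powerset,
          (∏ s ∈ S', (Fintype.card (κ s) : ENNReal)) * marg p (S' ∪ U) z := by
        rw [Summable.tsum_finsetSum fun _ _ => ENNReal.summable]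
        congr 1
        refine Finset.sum_congr rfl fun S' _ => ?_
        rw [ENNReal.tsum_mul_left, ← tsum_ite_restrict]
    _ = ∑ S' ∈ (P ∩ B).powerset,
          marg p (S' ∪ U) z / marg p U z * ∏ s ∈ S', (Fintype.card (κ s) : ENNReal) := by
        rw [Finset.mul_sum]
        exact Finset.sum_congr rfl fun S' _ => by rw [div_eq_mul_inv]; ring
    -- The empty agreement set gives the main term `1`; at most `2 ^ Fintype.card S` others give `ε`
    -- each.
    _ ≤ ∑ S' ∈ (P ∩ B).powerset, ((if S' = ∅ then 1 else 0) + ε) := by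
        refine Finset.sum_le_sum fun S' hS' => ?_
        rcases S'.eq_empty_or_nonempty with rfl | hne
        · simp only [Finset.empty_union, Finset.prod_empty, mul_one, if_true]
          exact ENNReal.div_self_le_one.trans le_self_add
        · rw [if_neg hne.ne_empty, zero_add]
          exact hz S' (Finset.mem_powerset.1 hS') hne
    _ ≤ 1 + 2 ^ Fintype.card S * ε := by
        rw [Finset.sum_add_distrib, Finset.sum_ite_eq', Finset.sum_const, Finset.card_powerset,
          nsmul_eq_mul]
        refine add_le_add (by split_ifs <;> simp) ?_
        push_cast
        gcongr
        · norm_num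
        · exact Finset.card_le_univ _

end ExtractionMean

/-! ### Concentration of the bin mass. -/

section ExtractionBound

variable {S : Type*} [Fintype S] [DecidableEq S] {Alph κ : S → Type*}
  [∀ s, Fintype (κ s)] [∀ s, Nonempty (κ s)] [∀ s, DecidableEq (κ s)]

variable (p : PMF (∀ s, Alph s)) (Dem : Finset S)

lemma binWeight_le_card (s : S) (b : Alph s → κ s) (k : κ s) (a : Alph s) :
    binWeight Dem s b k a ≤ Fintype.card (κ s) := by
  have : (1 : ENNReal) ≤ Fintype.card (κ s) := by exact_mod_cast Fintype.card_pos
  unfold binWeight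
  split_ifs <;> simp [this]

lemma binMass_ne_top (b : ∀ s, Alph s → κ s) (P U : Finset S) (v : ∀ s : P, κ s)
    (z : ∀ s, Alph s) : binMass p Dem b P U v z ≠ ⊤ := by
  have h : binMass p Dem b P U v z ≤ ∑' z', p z' * ∏ s : P, (Fintype.card (κ s) : ENNReal) := by
    refine ENNReal.tsum_le_tsum fun z' => ?_
    split_ifs
    · gcongr
      exact binWeight_le_card Dem _ _ _ _
    · exact zero_le
  rw [ENNReal.tsum_mul_right, p.tsum_coe, one_mul] at h
  exact ne_top_of_le_ne_top (ENNReal.prod_ne_top fun s _ => ENNReal.natCast_ne_top _) h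

lemma mul_prod_le_binMass (b : ∀ s, Alph s → κ s) (P U : Finset S) (v : ∀ s : P, κ s)
    (z : ∀ s, Alph s) :
    p z * ∏ s : P, binWeight Dem s (b s) (v s) (z s) ≤ binMass p Dem b P U v z := by
  refine le_trans ?_ (ENNReal.le_tsum z)
  rw [if_pos rfl]

lemma binMass_ne_zero {b : ∀ s, Alph s → κ s} {k : ∀ s, κ s} {z : ∀ s, Alph s}
    (h : idealLaw p Dem b k z ≠ 0) (P U : Finset S) :
    binMass p Dem b P U (P.restrict k) z ≠ 0 := by
  have h1 : p z ≠ 0 := left_ne_zero_of_mul h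
  have h2 := Finset.prod_ne_zero_iff.1 (right_ne_zero_of_mul h)
  refine ne_of_gt (lt_of_lt_of_le (pos_iff_ne_zero.2 ?_)
    (mul_prod_le_binMass p Dem b P U (P.restrict k) z))
  exact mul_ne_zero h1 (Finset.prod_ne_zero_iff.2 fun s _ =>
    right_ne_zero_of_mul (h2 s (Finset.mem_univ _)))

lemma idealLaw_mul_one_sub_ratio_le (b : ∀ s, Alph s → κ s) (k : ∀ s, κ s) (z : ∀ s, Alph s)
    (P U : Finset S) {η : ℝ} (hη : 0 < η) :
    idealLaw p Dem b k z * (1 - binRatio p Dem b P U k z) +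
      idealLaw p Dem b k z * (2 / ENNReal.ofReal η) ≤
    idealLaw p Dem b k z * ENNReal.ofReal η +
      (idealLaw p Dem b k z * (binMass p Dem b P U (P.restrict k) z / marg p U z) +
      idealLaw p Dem b k z * (marg p U z / binMass p Dem b P U (P.restrict k) z)) /
        ENNReal.ofReal η := by
  by_cases h : idealLaw p Dem b k z = 0
  · simp [h]
  have hM := binMass_ne_zero p Dem h P U
  have hM' := binMass_ne_top p Dem b P U (P.restrict k) z
  have hm : marg p U z ≠ 0 := fun h0 => left_ne_zero_of_mul h
    (le_antisymm ((apply_le_marg p U z).trans_eq h0) zero_le)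
  have hm' : marg p U z ≠ ⊤ := ne_top_of_le_ne_top ENNReal.one_ne_top (marg_le_one p U z)
  have key := ennreal_one_sub_min_add_le
    (N := binMass p Dem b P U (P.restrict k) z / marg p U z)
    (ENNReal.div_ne_zero.2 ⟨hM, hm'⟩) (ENNReal.div_ne_top hM' hm) hη
  rw [ENNReal.inv_div (.inl hm') (.inl hm)] at key
  calc _ = idealLaw p Dem b k z * ((1 - binRatio p Dem b P U k z) + 2 / ENNReal.ofReal η) := by
        rw [mul_add]
    _ ≤ idealLaw p Dem b k z * (ENNReal.ofReal η +
        (binMass p Dem b P U (P.restrict k) z / marg p U z +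
        marg p U z / binMass p Dem b P U (P.restrict k) z) / ENNReal.ofReal η) := by
        exact mul_le_mul le_rfl key zero_le zero_le
    _ = _ := by rw [mul_add, ← mul_div_assoc, mul_add]

variable [∀ s, Countable (Alph s)]
  [∀ s, MeasurableSpace (κ s)] [∀ s, MeasurableSingletonClass (κ s)]
  (ν : ∀ s, Measure (Alph s → κ s)) [∀ s, IsProbabilityMeasure (ν s)]

@[fun_prop]
lemma measurable_binRatio (P U : Finset S) (k : ∀ s, κ s) (z : ∀ s, Alph s) :
    Measurable fun b : (∀ s, Alph s → κ s) => binRatio p Dem b P U k z := by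
  unfold binRatio
  fun_prop

/-- Source values that are not spread are charged in full. On the others `one_sub_min_add_le`
applies with `N` the normalized bin mass, and the means of `N` and `1/N` are known to be at most `1`
up to small terms. -/
lemma lintegral_idealLaw_mul_one_sub_ratio_le {P U B : Finset S} {ε : ENNReal}
    (hB : ∀ s ∈ Dem, s ∉ B → Fintype.card (κ s) = 1)
    (hν : ∀ s, ∀ a a' : Alph s, a ≠ a' →
      ν s {b | b a = b a'} ≤ (Fintype.card (κ s) : ENNReal)⁻¹) {η : ℝ} (hη : 0 < η) :
    ∫⁻ b, ∑ k, ∑' z, idealLaw p Dem b k z * (1 - binRatio p Dem b P U k z) ∂Measure.pi ν ≤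
      (∑' z, {z | ¬ IsSpread p κ P U B ε z}.indicator p z) + ENNReal.ofReal η +
        (2 ^ Fintype.card S * ε + ∑' z, {z | ¬ IsSpread p κ P U B ε z}.indicator p z) /
          ENNReal.ofReal η := by
  classical
  set T : Set (∀ s, Alph s) := {z | IsSpread p κ P U B ε z} with hT
  have hTc : {z | ¬ IsSpread p κ P U B ε z} = Tᶜ := rfl
  rw [hTc]
  set δ := ∑' z, Tᶜ.indicator p z with hδ
  set pT := ∑' z, T.indicator p z with hpT
  have hsum : pT + δ = 1 := by
    rw [hpT, hδ, ← ENNReal.tsum_add, ← p.tsum_coe]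
    exact tsum_congr fun z => Set.indicator_self_add_compl_apply T p z
  have hη0 : ENNReal.ofReal η ≠ 0 := by simpa using hη
  set e := ENNReal.ofReal η with he
  have hmeas : ∀ f : (∀ s, κ s) → (∀ s, Alph s) → (∀ s, Alph s → κ s) → ENNReal,
      (∀ k z, Measurable (f k z)) → Measurable fun b => ∑ k, ∑' z, f k z b := fun f hf =>
    Finset.measurable_sum _ fun k _ => Measurable.tsum fun z => hf k z
  -- the part of the sum over `T`
  set F : (∀ s, Alph s → κ s) → ENNReal := fun b =>
    ∑ k, ∑' z, T.indicator (fun z => idealLaw p Dem b k z * (1 - binRatio p Dem b P U k z)) z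
    with hF
  set G : (∀ s, Alph s → κ s) → ENNReal := fun b =>
    ∑ k, ∑' z, T.indicator (fun z => idealLaw p Dem b k z *
      (binMass p Dem b P U (P.restrict k) z / marg p U z)) z with hG
  have hGm : Measurable G := hmeas (fun k z b => T.indicator (fun z => idealLaw p Dem b k z *
      (binMass p Dem b P U (P.restrict k) z / marg p U z)) z) fun k z => by
    by_cases hz : z ∈ T
    · simp only [Set.indicator_of_mem hz, div_eq_mul_inv]; fun_prop
    · simp only [Set.indicator_of_notMem hz]; fun_prop
  have hswap : ∀ (f : (∀ s, Alph s) → ENNReal) (Q : Set (∀ s, Alph s))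
      (b : ∀ s, Alph s → κ s), ∑ k, ∑' z, Q.indicator (fun z => idealLaw p Dem b k z * f z) z =
        ∑' z, Q.indicator (fun z => p z * f z) z := by
    intro f Q b
    rw [← Summable.tsum_finsetSum fun _ _ => ENNReal.summable]
    refine tsum_congr fun z => ?_
    by_cases hz : z ∈ Q
    · simp only [Set.indicator_of_mem hz, ← Finset.sum_mul, sum_idealLaw]
    · simp [Set.indicator_of_notMem hz]
  have hFG : ∀ b, F b + pT * (2 / e) ≤ e + (G b + 1) / e := by
    intro b
    have h1 := hswap (fun _ => 2 / e) T b
    have h2 := hswap (fun _ => e) T b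
    have h3 : pT * (2 / e) = ∑' z, T.indicator (fun z => p z * (2 / e)) z := by
      rw [hpT, ← ENNReal.tsum_mul_right]
      exact tsum_congr fun z => by by_cases hz : z ∈ T <;> simp [hz]
    have h4 : ∑' z, T.indicator (fun z => p z * e) z ≤ e := by
      calc _ ≤ ∑' z, p z * e := ENNReal.tsum_le_tsum fun z => Set.indicator_le_self' (fun _ _ => zero_le) z
        _ = e := by rw [ENNReal.tsum_mul_right, p.tsum_coe, one_mul]
    have h5 : ∑ k, ∑' z, T.indicator (fun z => idealLaw p Dem b k z *
        (marg p U z / binMass p Dem b P U (P.restrict k) z)) z ≤ 1 :=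
      (Finset.sum_le_sum fun k _ => ENNReal.tsum_le_tsum fun z =>
        Set.indicator_le_self' (fun _ _ => zero_le) z).trans
        (sum_idealLaw_mul_ratio_le_one p Dem b P U)
    calc F b + pT * (2 / e)
        = ∑ k, ∑' z, T.indicator (fun z => idealLaw p Dem b k z *
            (1 - binRatio p Dem b P U k z) + idealLaw p Dem b k z * (2 / e)) z := by
          rw [h3, ← h1, hF]
          simp only [← Finset.sum_add_distrib, ← ENNReal.tsum_add]
          refine Finset.sum_congr rfl fun k _ => tsum_congr fun z => ?_
          by_cases hz : z ∈ T <;> simp [hz]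
      _ ≤ ∑ k, ∑' z, T.indicator (fun z => idealLaw p Dem b k z * e +
            (idealLaw p Dem b k z * (binMass p Dem b P U (P.restrict k) z / marg p U z) +
            idealLaw p Dem b k z * (marg p U z / binMass p Dem b P U (P.restrict k) z)) / e) z :=
          Finset.sum_le_sum fun k _ => ENNReal.tsum_le_tsum fun z =>
            Set.indicator_le_indicator (idealLaw_mul_one_sub_ratio_le p Dem b k z P U hη)
      _ = ∑' z, T.indicator (fun z => p z * e) z + (G b +
            ∑ k, ∑' z, T.indicator (fun z => idealLaw p Dem b k z *
              (marg p U z / binMass p Dem b P U (P.restrict k) z)) z) / e := by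
          rw [← h2, hG]
          simp only [div_eq_mul_inv, Finset.sum_mul, ← Finset.sum_add_distrib,
            ← ENNReal.tsum_add, ← ENNReal.tsum_mul_right]
          refine Finset.sum_congr rfl fun k _ => tsum_congr fun z => ?_
          by_cases hz : z ∈ T <;> simp [hz]
      _ ≤ e + (G b + 1) / e := by gcongr
  have hGint : ∫⁻ b, G b ∂Measure.pi ν ≤ pT * (1 + 2 ^ Fintype.card S * ε) := by
    have : ∀ b, G b = ∑' z, T.indicator (fun z => ∑ k, idealLaw p Dem b k z *
      (binMass p Dem b P U (P.restrict k) z / marg p U z)) z := by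
      intro b
      simp only [hG]
      rw [← Summable.tsum_finsetSum fun _ _ => ENNReal.summable]
      refine tsum_congr fun z => ?_
      by_cases hz : z ∈ T <;> simp [hz]
    simp only [this]
    rw [lintegral_tsum, hpT, ← ENNReal.tsum_mul_right]
    · refine ENNReal.tsum_le_tsum fun z => ?_
      by_cases hz : z ∈ T
      · simp only [Set.indicator_of_mem hz]
        exact lintegral_idealLaw_mul_binMass_le p Dem ν hB hν z hz
      · simp [Set.indicator_of_notMem hz]
    · intro z
      by_cases hz : z ∈ T
      · simp only [Set.indicator_of_mem hz, div_eq_mul_inv]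
        fun_prop
      · simp only [Set.indicator_of_notMem hz]
        fun_prop
  have hFint : ∫⁻ b, F b ∂Measure.pi ν ≤ e + (2 ^ Fintype.card S * ε + δ) / e := by
    have h1 : ∫⁻ b, F b ∂Measure.pi ν + pT * (2 / e) ≤
        e + (2 ^ Fintype.card S * ε + δ) / e + pT * (2 / e) := by
      calc ∫⁻ b, F b ∂Measure.pi ν + pT * (2 / e)
          = ∫⁻ b, (F b + pT * (2 / e)) ∂Measure.pi ν := by
            rw [lintegral_add_right _ measurable_const, lintegral_const, measure_univ, mul_one]
        _ ≤ ∫⁻ b, (e + (G b + 1) / e) ∂Measure.pi ν := lintegral_mono hFG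
        _ = e + (∫⁻ b, G b ∂Measure.pi ν + 1) / e := by
            simp only [div_eq_mul_inv]
            rw [lintegral_add_left measurable_const, lintegral_const, measure_univ, mul_one,
              lintegral_mul_const _ (by fun_prop), lintegral_add_right _ measurable_const,
              lintegral_const, measure_univ, mul_one]
        -- The bound `1` on the mean of `1/N` is written as `pT + δ`; cancelling `2 * pT` then
        -- leaves only `δ` besides the `ε` term.
        _ ≤ e + (pT * (1 + 2 ^ Fintype.card S * ε) + (pT + δ)) / e := by
            rw [hsum]
            gcongr
        _ ≤ e + ((2 ^ Fintype.card S * ε + δ) + pT * 2) / e := by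
            have : pT * (2 ^ Fintype.card S * ε) ≤ 2 ^ Fintype.card S * ε :=
              mul_le_of_le_one_left' (hsum ▸ le_self_add)
            refine add_le_add le_rfl (ENNReal.div_le_div_right ?_ _)
            calc pT * (1 + 2 ^ Fintype.card S * ε) + (pT + δ)
                = pT * (2 ^ Fintype.card S * ε) + δ + pT * 2 := by ring
              _ ≤ _ := by gcongr
        _ = _ := by rw [ENNReal.add_div, ← add_assoc, mul_div_assoc]
    refine (ENNReal.add_le_add_iff_right ?_).1 h1
    refine ENNReal.mul_ne_top ?_ (ENNReal.div_ne_top (by simp) hη0)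
    exact ne_top_of_le_ne_top ENNReal.one_ne_top (hsum ▸ le_self_add)
  calc _ ≤ ∫⁻ b, (δ + F b) ∂Measure.pi ν := by
        refine lintegral_mono fun b => ?_
        have h1 := hswap (fun _ => 1) Tᶜ b
        simp only [mul_one] at h1
        rw [show δ = ∑' z, Tᶜ.indicator (fun z => p z) z from hδ, ← h1, hF]
        simp only [← Finset.sum_add_distrib, ← ENNReal.tsum_add]
        refine Finset.sum_le_sum fun k _ => ENNReal.tsum_le_tsum fun z => ?_
        by_cases hz : z ∈ T
        · simp [hz]
        · simpa [hz] using mul_le_of_le_one_right' tsub_le_self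
    _ = δ + ∫⁻ b, F b ∂Measure.pi ν := by
        rw [lintegral_add_left measurable_const, lintegral_const, measure_univ, mul_one]
    _ ≤ _ := by
        rw [add_assoc]
        gcongr

end ExtractionBound

/-! ### Generating the sources from bin indices along the access structure. -/

section Seeds

variable {S I : Type*} [Fintype S] [Fintype I] [DecidableEq S] [DecidableEq I]
  (A : Finset (S × I))

lemma encodersOf_ssubset {s t : S} (h : t ∈ publicMessages A (encodersOf A s)) :
    encodersOf A s ⊂ encodersOf A t := by
  simp only [publicMessages, privateMessages, Finset.mem_filter, Finset.mem_univ, true_and,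
    Finset.mem_biUnion] at h
  obtain ⟨I'', ⟨-, h⟩, h'⟩ := h
  rwa [h']

lemma encodersOf_mem_accessFamily (s : S) : encodersOf A s ∈ accessFamily A := by
  simp only [accessFamily, Finset.mem_filter, Finset.mem_univ, true_and]
  exact ⟨s, by simp [privateMessages]⟩

lemma mem_privateMessages {s : S} {I' : Finset I} :
    s ∈ privateMessages A I' ↔ encodersOf A s = I' := by simp [privateMessages]

lemma mem_messagesAt_iff {s : S} {i : I} : s ∈ messagesAt A i ↔ i ∈ encodersOf A s := by
  simp [messagesAt, encodersOf]

/-- The arguments of the random functions that generate the sources from the bin indices. -/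
abbrev SeedIndex (Alph κ : S → Type*) : Type _ :=
  Σ I' : Finset I, (∀ s : publicMessages A I', Alph s) × (∀ s : privateMessages A I', κ s)

variable {A} {Alph κ : S → Type*}

/-- The source values generated, given the bin indices `k`, by the functions `ω`, proceeding
from the messages with the most encoders to those with the fewest. -/
def sourceOf (ω : SeedIndex A Alph κ → ∀ s, Alph s) (k : ∀ s, κ s) (s : S) : Alph s :=
  ω ⟨encodersOf A s, fun t => sourceOf ω k t, fun t => k t⟩ s
termination_by Fintype.card I - (encodersOf A s).card
decreasing_by
  have h1 := Finset.card_lt_card (encodersOf_ssubset A t.2)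
  have h2 := (encodersOf A (t : S)).card_le_univ
  omega

/-- The recursion for `s` consults only messages whose encoder sets contain that of `s`: its block
mates and its public messages. Starting at a message known to `i`, it never leaves `S(i)`, so
encoder `i` can carry it out. -/
lemma sourceOf_congr (ω : SeedIndex A Alph κ → ∀ s, Alph s) {k k' : ∀ s, κ s} {i : I}
    (h : ∀ t ∈ messagesAt A i, k t = k' t) (s : S) (hs : s ∈ messagesAt A i) :
    sourceOf ω k s = sourceOf ω k' s := by
  rw [sourceOf, sourceOf]
  have hi := (mem_messagesAt_iff A).1 hs
  have h1 : (fun t : publicMessages A (encodersOf A s) => sourceOf ω k t) =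
      fun t : publicMessages A (encodersOf A s) => sourceOf ω k' t := by
    funext t
    exact sourceOf_congr ω h t
      ((mem_messagesAt_iff A).2 ((encodersOf_ssubset A t.2).subset hi))
  have h2 : (fun t : privateMessages A (encodersOf A s) => k t) =
      fun t : privateMessages A (encodersOf A s) => k' t := by
    funext t
    exact h t ((mem_messagesAt_iff A).2 (((mem_privateMessages A).1 t.2).symm ▸ hi))
  rw [h1, h2]
termination_by Fintype.card I - (encodersOf A s).card
decreasing_by
  have h1 := Finset.card_lt_card (encodersOf_ssubset A t.2)
  have h2 := (encodersOf A (t : S)).card_le_univ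
  omega

lemma eq_sourceOf {ω : SeedIndex A Alph κ → ∀ s, Alph s} {k : ∀ s, κ s} {z : ∀ s, Alph s}
    (h : ∀ s, z s = ω ⟨encodersOf A s, (publicMessages A (encodersOf A s)).restrict z,
      (privateMessages A (encodersOf A s)).restrict k⟩ s) (s : S) :
    z s = sourceOf ω k s := by
  have h1 : (publicMessages A (encodersOf A s)).restrict z =
      fun t : publicMessages A (encodersOf A s) => sourceOf ω k t := by
    funext t
    exact eq_sourceOf h t
  rw [sourceOf, h, h1]
  rfl
termination_by Fintype.card I - (encodersOf A s).card
decreasing_by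
  have h1 := Finset.card_lt_card (encodersOf_ssubset A t.2)
  have h2 := (encodersOf A (t : S)).card_le_univ
  omega

/-- The argument at block `I'` that belongs to the source values `z` and the bin indices `k`. -/
def seedAt (A : Finset (S × I)) (z : ∀ s, Alph s) (k : ∀ s, κ s) (I' : Finset I) :
    SeedIndex A Alph κ :=
  ⟨I', (publicMessages A I').restrict z, (privateMessages A I').restrict k⟩

/-- Replaces the recursion by one condition per block, each on a single value of the random function
`ω`; these values are independent. -/
lemma sourceOf_eq_iff (ω : SeedIndex A Alph κ → ∀ s, Alph s) (k : ∀ s, κ s)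
    (z : ∀ s, Alph s) :
    sourceOf ω k = z ↔ ∀ I' ∈ accessFamily A,
      (privateMessages A I').restrict (ω (seedAt A z k I')) =
        (privateMessages A I').restrict z := by
  constructor
  · rintro rfl I' -
    funext ⟨s, hs⟩
    obtain rfl := (mem_privateMessages A).1 hs
    simp only [Finset.restrict]
    rw [sourceOf]
    rfl
  · intro h
    funext s
    refine (eq_sourceOf (fun s => ?_) s).symm
    have := congrFun (h (encodersOf A s) (encodersOf_mem_accessFamily A s))
      ⟨s, (mem_privateMessages A).2 rfl⟩
    exact this.symm

variable [∀ s, Fintype (κ s)] [∀ s, Nonempty (κ s)] [∀ s, DecidableEq (κ s)]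
  (p : PMF (∀ s, Alph s)) (Dem : Finset S) (b : ∀ s, Alph s → κ s)

open Classical in
/-- The unnormalized law of the sources given an argument of the random functions. -/
def blockWeight (i : SeedIndex A Alph κ) (z : ∀ s, Alph s) : ENNReal :=
  if i.2.1 = (publicMessages A i.1).restrict z then
    p z * ∏ s : privateMessages A i.1, binWeight Dem s (b s) (i.2.2 s) (z s) else 0

lemma tsum_blockWeight_ne_top (i : SeedIndex A Alph κ) :
    ∑' z, blockWeight p Dem b i z ≠ ⊤ := by
  have h : ∑' z, blockWeight p Dem b i z ≤
      ∑' z', p z' * ∏ s : privateMessages A i.1, (Fintype.card (κ s) : ENNReal) := by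
    refine ENNReal.tsum_le_tsum fun z' => ?_
    unfold blockWeight
    split_ifs
    · gcongr
      exact binWeight_le_card Dem _ _ _ _
    · exact zero_le
  rw [ENNReal.tsum_mul_right, p.tsum_coe, one_mul] at h
  exact ne_top_of_le_ne_top (ENNReal.prod_ne_top fun s _ => ENNReal.natCast_ne_top _) h

open Classical in
/-- The law of the sources given an argument of the random functions. -/
def blockLaw (i : SeedIndex A Alph κ) : PMF (∀ s, Alph s) :=
  -- In an empty bin any law will do.
  if h : ∑' z, blockWeight p Dem b i z = 0 then p
  else PMF.normalize (blockWeight p Dem b i) h (tsum_blockWeight_ne_top p Dem b i)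

lemma tsum_blockWeight_seedAt (z : ∀ s, Alph s) (k : ∀ s, κ s) (I' : Finset I) :
    ∑' z', blockWeight p Dem b (seedAt A z k I') z' =
      binMass p Dem b (privateMessages A I') (publicMessages A I')
        ((privateMessages A I').restrict k) z := rfl

variable [∀ s, Countable (Alph s)] [∀ s, MeasurableSpace (Alph s)]
  [∀ s, DiscreteMeasurableSpace (Alph s)]

/-- In a bin of positive mass this is the definition of the normalized law summed over the values
that agree with `z`. In an empty bin the left side is zero; the lower bound alone suffices for the
comparison of laws. -/
lemma le_blockLaw_apply (z : ∀ s, Alph s) (k : ∀ s, κ s) (I' : Finset I) :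
    marg p (privateMessages A I' ∪ publicMessages A I') z *
      (∏ s ∈ privateMessages A I', binWeight Dem s (b s) (k s) (z s)) /
      binMass p Dem b (privateMessages A I') (publicMessages A I')
        ((privateMessages A I').restrict k) z ≤
    (blockLaw p Dem b (seedAt A z k I')).toMeasure
      {z' | (privateMessages A I').restrict z' = (privateMessages A I').restrict z} := by
  classical
  set P := privateMessages A I' with hP
  set U := publicMessages A I' with hU
  rw [PMF.toMeasure_apply _ (Set.to_countable _).measurableSet]
  by_cases h0 : binMass p Dem b P U (P.restrict k) z = 0
  · have h1 := mul_prod_le_binMass p Dem b P U (P.restrict k)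
    have : marg p (P ∪ U) z * ∏ s ∈ P, binWeight Dem s (b s) (k s) (z s) = 0 := by
      rw [← tsum_ite_restrict, ← ENNReal.tsum_mul_right]
      refine ENNReal.tsum_eq_zero.2 fun z' => ?_
      by_cases hz : U.restrict z = U.restrict z'
      · by_cases hz' : P.restrict z = P.restrict z'
        · rw [if_pos hz, if_pos hz', mul_one]
          have h2 := (h1 z').trans_eq ((show binMass p Dem b P U (P.restrict k) z' =
            binMass p Dem b P U (P.restrict k) z by simp only [binMass, hz]).trans h0)
          rw [Finset.prod_congr rfl fun s hs => by
            rw [show z s = z' s from congrFun hz' ⟨s, hs⟩],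
            ← Finset.prod_coe_sort P (fun s => binWeight Dem s (b s) (k s) (z' s))]
          exact le_antisymm h2 zero_le
        · simp [hz']
      · simp [hz]
    rw [this, ENNReal.zero_div]
    exact zero_le
  · have h0' : ¬ ∑' z', blockWeight p Dem b (seedAt A z k I') z' = 0 := h0
    rw [blockLaw, dif_neg h0', ← tsum_ite_restrict, div_eq_mul_inv, mul_assoc,
      ← ENNReal.tsum_mul_right]
    refine ENNReal.tsum_le_tsum fun z' => ?_
    by_cases hz : U.restrict z = U.restrict z'
    · by_cases hz' : P.restrict z = P.restrict z'
      · rw [if_pos hz, if_pos hz', mul_one, Set.indicator_of_mem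
          (show z' ∈ {z' | P.restrict z' = P.restrict z} from hz'.symm), PMF.normalize_apply,
          tsum_blockWeight_seedAt, ← mul_assoc, blockWeight,
          if_pos (show (seedAt A z k I').2.1 = (publicMessages A (seedAt A z k I').1).restrict z'
            from hz),
          Finset.prod_congr rfl fun s hs => by
            rw [show z s = z' s from congrFun hz' ⟨s, hs⟩],
          ← Finset.prod_coe_sort P (fun s => binWeight Dem s (b s) (k s) (z' s))]
        rfl
      · simp [hz']
    · simp [hz]

/-- The law of the random functions that generate the sources from the bin indices. -/
def seedLaw : Measure (SeedIndex A Alph κ → ∀ s, Alph s) :=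
  Measure.infinitePi fun i => (blockLaw p Dem b i).toMeasure

instance : IsProbabilityMeasure (seedLaw (A := A) p Dem b) := by
  unfold seedLaw
  infer_instance

lemma setOf_sourceOf_eq (k : ∀ s, κ s) (z : ∀ s, Alph s) :
    open Classical in
    {ω : SeedIndex A Alph κ → ∀ s, Alph s | sourceOf ω k = z} =
      (((accessFamily A).image (seedAt A z k) : Finset (SeedIndex A Alph κ)) :
        Set (SeedIndex A Alph κ)).pi fun i =>
          {z' | (privateMessages A i.1).restrict z' = (privateMessages A i.1).restrict z} := by
  ext ω
  simp only [Set.mem_ofPred_eq, sourceOf_eq_iff, Set.mem_pi, Finset.mem_coe, Finset.mem_image]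
  constructor
  · rintro h _ ⟨I', hI', rfl⟩
    exact h I' hI'
  · exact fun h I' hI' => h _ ⟨I', hI', rfl⟩

/-- Different blocks query the random function at different arguments, because an argument records
its block. -/
lemma seedLaw_sourceOf_eq (k : ∀ s, κ s) (z : ∀ s, Alph s) :
    seedLaw (A := A) p Dem b {ω | sourceOf ω k = z} =
      ∏ I' ∈ accessFamily A, (blockLaw p Dem b (seedAt A z k I')).toMeasure
        {z' | (privateMessages A I').restrict z' = (privateMessages A I').restrict z} := by
  classical
  rw [setOf_sourceOf_eq, seedLaw, Measure.infinitePi_pi _ fun i _ => (Set.to_countable _).measurableSet,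
    Finset.prod_image]
  · rfl
  · intro I' _ I'' _ h
    exact congrArg Sigma.fst h

lemma measurable_sourceOf (k : ∀ s, κ s) :
    Measurable fun ω : SeedIndex A Alph κ → ∀ s, Alph s => sourceOf ω k := by
  classical
  refine measurable_to_countable' fun z => ?_
  change MeasurableSet {ω : SeedIndex A Alph κ → ∀ s, Alph s | sourceOf ω k = z}
  rw [setOf_sourceOf_eq]
  exact MeasurableSet.pi (Finset.countable_toSet _) fun i _ => (Set.to_countable _).measurableSet

/-- Here the factorization of the source law enters: block by block, the conditional probability
times the bin weight, divided by the normalized bin mass, is at most what the generator produces. -/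
lemma idealLaw_mul_prod_ratio_le
    (hfac : ∀ z, p z = ∏ I' ∈ accessFamily A,
      marg p (privateMessages A I' ∪ publicMessages A I') z / marg p (publicMessages A I') z)
    (k : ∀ s, κ s) (z : ∀ s, Alph s) :
    idealLaw p Dem b k z * ∏ I' ∈ accessFamily A,
      binRatio p Dem b (privateMessages A I') (publicMessages A I') k z ≤
    (∏ s, (Fintype.card (κ s) : ENNReal)⁻¹) *
      seedLaw (A := A) p Dem b {ω | sourceOf ω k = z} := by
  rw [idealLaw, Finset.prod_mul_distrib, seedLaw_sourceOf_eq, mul_left_comm, mul_assoc]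
  refine mul_le_mul le_rfl ?_ zero_le zero_le
  rw [← prod_accessFamily A (fun s => binWeight Dem s (b s) (k s) (z s)), hfac z,
    ← Finset.prod_mul_distrib, ← Finset.prod_mul_distrib]
  refine Finset.prod_le_prod' fun I' _ => le_trans ?_ (le_blockLaw_apply p Dem b z k I')
  set P := privateMessages A I' with hP
  set U := publicMessages A I' with hU
  calc _ ≤ marg p (P ∪ U) z / marg p U z * (∏ s ∈ P, binWeight Dem s (b s) (k s) (z s)) *
        (marg p U z / binMass p Dem b P U (P.restrict k) z) := by
        refine mul_le_mul le_rfl (min_le_right _ _) zero_le zero_le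
    _ = (marg p (P ∪ U) z / marg p U z * marg p U z) *
        (∏ s ∈ P, binWeight Dem s (b s) (k s) (z s)) /
          binMass p Dem b P U (P.restrict k) z := by
        simp only [div_eq_mul_inv]; ring
    _ ≤ _ := by
        gcongr
        exact ENNReal.mul_le_of_le_div le_rfl

lemma one_le_prod_add_sum {ι : Type*} (F : Finset ι) (t : ι → ENNReal) (ht : ∀ i, t i ≤ 1) :
    1 ≤ ∏ i ∈ F, t i + ∑ i ∈ F, (1 - t i) := by
  classical
  induction F using Finset.induction_on with
  | empty => simp
  | insert a F ha ih =>
    rw [Finset.prod_insert ha, Finset.sum_insert ha]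
    have h1 : ∏ i ∈ F, t i ≤ 1 := Finset.prod_le_one' fun i _ => ht i
    calc (1 : ENNReal) ≤ ∏ i ∈ F, t i + ∑ i ∈ F, (1 - t i) := ih
      _ = (t a + (1 - t a)) * ∏ i ∈ F, t i + ∑ i ∈ F, (1 - t i) := by
          rw [add_tsub_cancel_of_le (ht a), one_mul]
      _ ≤ t a * ∏ i ∈ F, t i + (1 - t a) + ∑ i ∈ F, (1 - t i) := by
          rw [add_mul]
          gcongr
          exact mul_le_of_le_one_right' h1
      _ = _ := by rw [add_assoc]

/-- Subtraction-free form of `q * e ≤ i * e + (q - r)`, for a common minorant `r` of `q` and `i`. -/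
lemma mul_add_le_add_mul {q r i e : ENNReal} (hrq : r ≤ q) (hri : r ≤ i) (he : e ≤ 1) :
    q * e + r ≤ q + i * e := by
  obtain ⟨d, rfl⟩ := exists_add_of_le hrq
  calc (r + d) * e + r = r + d * e + r * e := by ring
    _ ≤ r + d + i * e := by
        gcongr
        exact mul_le_of_le_one_right' he

/-- The ideal law times the truncated ratios is a common minorant of the ideal and the actual law.
Both have total mass one, so the error means differ by at most the mass it misses, and that is
bounded blockwise by `one_le_prod_add_sum`. -/
lemma lintegral_seedLaw_le
    (hfac : ∀ z, p z = ∏ I' ∈ accessFamily A,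
      marg p (privateMessages A I' ∪ publicMessages A I') z / marg p (publicMessages A I') z)
    (e : (∀ s, κ s) → (∀ s, Alph s) → ENNReal) (he : ∀ k z, e k z ≤ 1) :
    ∫⁻ ω, ∑ k, (∏ s, (Fintype.card (κ s) : ENNReal)⁻¹) * e k (sourceOf ω k)
      ∂seedLaw (A := A) p Dem b ≤
    ∑ k, ∑' z, idealLaw p Dem b k z * e k z +
      ∑ I' ∈ accessFamily A, ∑ k, ∑' z, idealLaw p Dem b k z *
        (1 - binRatio p Dem b (privateMessages A I') (publicMessages A I') k z) := by
  set c : ENNReal := ∏ s, (Fintype.card (κ s) : ENNReal)⁻¹ with hc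
  set Q : (∀ s, κ s) → (∀ s, Alph s) → ENNReal :=
    fun k z => seedLaw (A := A) p Dem b {ω | sourceOf ω k = z} with hQ
  set r : (∀ s, κ s) → (∀ s, Alph s) → ENNReal := fun k z =>
    idealLaw p Dem b k z * ∏ I' ∈ accessFamily A,
      binRatio p Dem b (privateMessages A I') (publicMessages A I') k z with hr
  have hratio : ∀ k z I',
      binRatio p Dem b (privateMessages A I') (publicMessages A I') k z ≤ 1 :=
    fun k z I' => min_le_left _ _
  have hint : ∀ (k : ∀ s, κ s) (f : (∀ s, Alph s) → ENNReal),
      ∫⁻ ω, f (sourceOf ω k) ∂seedLaw (A := A) p Dem b = ∑' z, Q k z * f z := by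
    intro k f
    rw [← lintegral_map (measurable_of_countable f) (measurable_sourceOf k), lintegral_countable']
    refine tsum_congr fun z => ?_
    rw [Measure.map_apply (measurable_sourceOf k) (measurableSet_singleton z), mul_comm]
    rfl
  have hX : ∫⁻ ω, ∑ k, c * e k (sourceOf ω k) ∂seedLaw (A := A) p Dem b =
      ∑ k, ∑' z, (c * Q k z) * e k z := by
    have hm : ∀ k, Measurable fun ω : SeedIndex A Alph κ → ∀ s, Alph s => e k (sourceOf ω k) :=
      fun k => (measurable_of_countable (e k)).comp (measurable_sourceOf k)
    rw [lintegral_finsetSum _ fun k _ => (hm k).const_mul c]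
    refine Finset.sum_congr rfl fun k _ => ?_
    rw [lintegral_const_mul _ (hm k), hint, ← ENNReal.tsum_mul_left]
    exact tsum_congr fun z => (mul_assoc _ _ _).symm
  have hQ1 : ∑ k, ∑' z, c * Q k z = 1 := by
    have h1 : ∀ k, ∑' z, Q k z = 1 := fun k => by
      have := hint k fun _ => 1
      simpa using this.symm
    simp only [ENNReal.tsum_mul_left, h1, mul_one]
    rw [hc, ← Fintype.prod_sum (fun s (_ : κ s) => (Fintype.card (κ s) : ENNReal)⁻¹)]
    exact Finset.prod_eq_one fun s _ => sum_card_inv s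
  have hideal : ∑ k, ∑' z, idealLaw p Dem b k z = 1 := by
    rw [← Summable.tsum_finsetSum fun _ _ => ENNReal.summable]
    simp only [sum_idealLaw, p.tsum_coe]
  have hrle : ∀ k z, r k z ≤ idealLaw p Dem b k z := fun k z =>
    mul_le_of_le_one_right' (Finset.prod_le_one' fun I' _ => hratio k z I')
  have h1 : ∑ k, ∑' z, (c * Q k z) * e k z + ∑ k, ∑' z, r k z ≤
      1 + ∑ k, ∑' z, idealLaw p Dem b k z * e k z := by
    rw [← hQ1]
    simp only [← Finset.sum_add_distrib, ← ENNReal.tsum_add]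
    exact Finset.sum_le_sum fun k _ => ENNReal.tsum_le_tsum fun z =>
      mul_add_le_add_mul (idealLaw_mul_prod_ratio_le p Dem b hfac k z) (hrle k z) (he k z)
  have h2 : 1 ≤ ∑ k, ∑' z, r k z + ∑ I' ∈ accessFamily A, ∑ k, ∑' z, idealLaw p Dem b k z *
      (1 - binRatio p Dem b (privateMessages A I') (publicMessages A I') k z) := by
    calc (1 : ENNReal) = ∑ k, ∑' z, idealLaw p Dem b k z := hideal.symm
      _ ≤ ∑ k, ∑' z, (r k z + ∑ I' ∈ accessFamily A, idealLaw p Dem b k z *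
          (1 - binRatio p Dem b (privateMessages A I') (publicMessages A I') k z)) := by
          refine Finset.sum_le_sum fun k _ => ENNReal.tsum_le_tsum fun z => ?_
          rw [hr, ← Finset.mul_sum, ← mul_add]
          exact le_mul_of_one_le_right zero_le (one_le_prod_add_sum _ _ fun I' => hratio k z I')
      _ = _ := by
          rw [Finset.sum_comm (s := accessFamily A), ← Finset.sum_add_distrib]
          refine Finset.sum_congr rfl fun k _ => ?_
          rw [ENNReal.tsum_add, Summable.tsum_finsetSum fun _ _ => ENNReal.summable]
  have hrtop : ∑ k, ∑' z, r k z ≠ ⊤ := by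
    refine ne_top_of_le_ne_top ENNReal.one_ne_top ?_
    rw [← hideal]
    exact Finset.sum_le_sum fun k _ => ENNReal.tsum_le_tsum fun z => hrle k z
  rw [hX]
  refine (ENNReal.add_le_add_iff_right hrtop).1 (h1.trans ?_)
  refine (add_le_add h2 le_rfl).trans (le_of_eq ?_)
  ring

end Seeds

/-! ### Collision probabilities of random functions. -/

section Hash

variable (α κ : Type*) [Fintype κ] [Nonempty κ] [MeasurableSpace κ] [MeasurableSingletonClass κ]

/-- The law of a random function with independent uniform values. -/
def hashLaw : Measure (α → κ) :=
  Measure.infinitePi fun _ => (PMF.uniformOfFintype κ).toMeasure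

instance : IsProbabilityMeasure (hashLaw α κ) := by
  unfold hashLaw
  infer_instance

variable {α κ}

lemma hashLaw_pair_le {a a' : α} (h : a ≠ a') (R : κ → κ → Prop) [∀ k k', Decidable (R k k')] :
    hashLaw α κ {b | R (b a) (b a')} ≤
      ∑ k, ∑ k', if R k k' then (Fintype.card κ : ENNReal)⁻¹ * (Fintype.card κ : ENNReal)⁻¹
        else 0 := by
  classical
  have hsub : {b : α → κ | R (b a) (b a')} ⊆
      ⋃ k, ⋃ k', {b : α → κ | b a = k ∧ b a' = k' ∧ R k k'} := by
    intro b hb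
    simp only [Set.mem_iUnion]
    exact ⟨b a, b a', rfl, rfl, hb⟩
  refine (measure_mono hsub).trans ((measure_iUnion_fintype_le _ _).trans
    (Finset.sum_le_sum fun k _ => (measure_iUnion_fintype_le _ _).trans
      (Finset.sum_le_sum fun k' _ => ?_)))
  by_cases hR : R k k'
  · rw [if_pos hR]
    have heq : {b : α → κ | b a = k ∧ b a' = k' ∧ R k k'} =
        (({a, a'} : Finset α) : Set α).pi fun x => if x = a then {k} else {k'} := by
      ext b
      simp [hR, h.symm]
    rw [heq, hashLaw, Measure.infinitePi_pi]
    · rw [Finset.prod_pair h, if_pos rfl, if_neg h.symm,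
        PMF.toMeasure_apply_singleton _ _ (measurableSet_singleton _),
        PMF.toMeasure_apply_singleton _ _ (measurableSet_singleton _),
        PMF.uniformOfFintype_apply, PMF.uniformOfFintype_apply]
    · intro x _
      split_ifs <;> exact measurableSet_singleton _
  · simp [hR]

lemma hashLaw_collision_le [DecidableEq κ] {a a' : α} (h : a ≠ a') :
    hashLaw α κ {b | b a = b a'} ≤ (Fintype.card κ : ENNReal)⁻¹ := by
  refine (hashLaw_pair_le h (· = ·)).trans_eq ?_
  have h1 : (Fintype.card κ : ENNReal) ≠ 0 := by exact_mod_cast Fintype.card_ne_zero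
  simp only [Finset.sum_ite_eq, Finset.mem_univ, if_true]
  rw [Finset.sum_const, Finset.card_univ, nsmul_eq_mul, ← mul_assoc,
    ENNReal.mul_inv_cancel h1 (ENNReal.natCast_ne_top _), one_mul]

lemma hashLaw_fst_collision_le {κ₁ κ₂ : Type*} [Fintype κ₁] [Fintype κ₂] [Nonempty κ₁]
    [Nonempty κ₂] [MeasurableSpace κ₁] [MeasurableSpace κ₂] [MeasurableSingletonClass κ₁]
    [MeasurableSingletonClass κ₂] [DecidableEq κ₁] {a a' : α} (h : a ≠ a') :
    hashLaw α (κ₁ × κ₂) {b | (b a).1 = (b a').1} ≤ (Fintype.card κ₁ : ENNReal)⁻¹ := by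
  refine (hashLaw_pair_le h fun k k' : κ₁ × κ₂ => k.1 = k'.1).trans_eq ?_
  have h1 : (Fintype.card κ₁ : ENNReal) ≠ 0 := by exact_mod_cast Fintype.card_ne_zero
  have h2 : (Fintype.card κ₂ : ENNReal) ≠ 0 := by exact_mod_cast Fintype.card_ne_zero
  have h1' := ENNReal.natCast_ne_top (Fintype.card κ₁)
  have h2' := ENNReal.natCast_ne_top (Fintype.card κ₂)
  simp only [Fintype.sum_prod_type, Fintype.card_prod, Nat.cast_mul]
  change (∑ x : κ₁, ∑ _ : κ₂, ∑ x' : κ₁, ∑ _ : κ₂, if x = x' then _ else _) = _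
  simp only [Finset.sum_const, Finset.card_univ, nsmul_eq_mul, mul_ite, mul_zero,
    Finset.sum_ite_eq, Finset.mem_univ, if_true]
  rw [ENNReal.mul_inv (.inl h1) (.inl h1')]
  calc (Fintype.card κ₁ : ENNReal) * (Fintype.card κ₂ * (Fintype.card κ₂ *
        ((Fintype.card κ₁ : ENNReal)⁻¹ * (Fintype.card κ₂ : ENNReal)⁻¹ *
        ((Fintype.card κ₁ : ENNReal)⁻¹ * (Fintype.card κ₂ : ENNReal)⁻¹))))
      = ((Fintype.card κ₁ : ENNReal) * (Fintype.card κ₁ : ENNReal)⁻¹) *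
        ((Fintype.card κ₂ : ENNReal) * (Fintype.card κ₂ : ENNReal)⁻¹) *
        ((Fintype.card κ₂ : ENNReal) * (Fintype.card κ₂ : ENNReal)⁻¹) *
          (Fintype.card κ₁ : ENNReal)⁻¹ := by ring
    _ = _ := by
      rw [ENNReal.mul_inv_cancel h1 h1', ENNReal.mul_inv_cancel h2 h2', one_mul, one_mul, one_mul]

end Hash

/-- Enumerate `Z` and take the first candidate that fits. -/
lemma exists_measurable_selection {Y Z : Type*} [MeasurableSpace Y] [Countable Z] [Nonempty Z]
    [MeasurableSpace Z] (B : Z → Set Y) (hB : ∀ z, MeasurableSet (B z)) :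
    ∃ ψ : Y → Z, Measurable ψ ∧ ∀ y, (∃ z, y ∈ B z) → y ∈ B (ψ y) := by
  classical
  obtain ⟨f, hf⟩ := exists_surjective_nat Z
  -- The second alternative makes the search stop at index `0` when there is no candidate.
  have hp : ∀ y, ∃ n, y ∈ B (f n) ∨ ∀ m, y ∉ B (f m) := by
    intro y
    by_cases h : ∃ n, y ∈ B (f n)
    · exact h.imp fun n hn => Or.inl hn
    · exact ⟨0, Or.inr (not_exists.1 h)⟩
  refine ⟨fun y => f (Nat.find (hp y)), ?_, ?_⟩
  · refine Measurable.find (f := fun n _ => f n) (p := fun n y => y ∈ B (f n) ∨ ∀ m, y ∉ B (f m))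
      (fun n => measurable_const) (fun n => ?_) hp
    have : {y | y ∈ B (f n) ∨ ∀ m, y ∉ B (f m)} = B (f n) ∪ ⋂ m, (B (f m))ᶜ := by
      ext y; simp
    rw [this]
    exact (hB _).union (MeasurableSet.iInter fun m => (hB _).compl)
  · rintro y ⟨z, hz⟩
    obtain ⟨n, rfl⟩ := hf z
    exact (Nat.find_spec (hp y)).resolve_right fun h => h n hz

/-! ### Decoding by posterior probability within the bins. -/

section Decoding

variable {S J : Type*} [Fintype S] [Fintype J] [DecidableEq S] {Alph : S → Type*}
  [∀ s, Countable (Alph s)] [∀ s, Nonempty (Alph s)] [∀ s, MeasurableSpace (Alph s)]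
  [∀ s, DiscreteMeasurableSpace (Alph s)]
  {Y : J → Type*} [∀ j, MeasurableSpace (Y j)] {D : J → Finset S}
  (q : ∀ j (D' : Finset S), Kernel (Y j × (∀ s : ↥(D j \ D'), Alph s)) (∀ s : D', Alph s))
  (τ : Finset S → ENNReal) (N : Finset S)

/-- The sources `z` are likely given the channel output `y` at decoder `j`, apart from the
conditional probabilities of components within `N`. -/
def IsLikely (j : J) (y : Y j) (z : ∀ s, Alph s) : Prop :=
  ∀ D' ⊆ D j, ¬ D' ⊆ N → τ D' ≤ q j D' (y, (D j \ D').restrict z) {D'.restrict z}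

lemma measurableSet_le_kernel (j : J) (D' : Finset S) (w : ∀ s : ↥(D j \ D'), Alph s)
    (a : ∀ s : D', Alph s) : MeasurableSet {y | τ D' ≤ q j D' (y, w) {a}} :=
  measurableSet_le measurable_const
    ((Kernel.measurable_coe _ (measurableSet_singleton a)).comp measurable_prodMk_right)

lemma measurableSet_isLikely (j : J) (z : ∀ s, Alph s) :
    MeasurableSet {y | IsLikely q τ N j y z} := by
  simp only [IsLikely, Set.ofPred_forall]
  exact MeasurableSet.iInter fun D' => MeasurableSet.iInter fun _ => MeasurableSet.iInter
    fun _ => measurableSet_le_kernel q τ j D' _ _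

variable {C L : S → ℕ}

/-- The decoder looks for likely sources with the bin indices `c`. -/
def IsDecoder (b : ∀ s, Alph s → Fin (C s) × Fin (L s)) (c : ∀ s, Fin (C s)) (j : J)
    (ψ : Y j → ∀ s, Alph s) : Prop :=
  Measurable ψ ∧ ∀ y, (∃ z, IsLikely q τ N j y z ∧ ∀ s ∈ D j, (b s (z s)).1 = c s) →
    IsLikely q τ N j y (ψ y) ∧ ∀ s ∈ D j, (b s (ψ y s)).1 = c s

lemma exists_isDecoder (b : ∀ s, Alph s → Fin (C s) × Fin (L s)) (c : ∀ s, Fin (C s)) (j : J) :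
    ∃ ψ : Y j → ∀ s, Alph s, IsDecoder q τ N b c j ψ := by
  obtain ⟨ψ, h1, h2⟩ := exists_measurable_selection
    (fun z => {y | IsLikely q τ N j y z ∧ ∀ s ∈ D j, (b s (z s)).1 = c s}) fun z =>
      (measurableSet_isLikely q τ N j z).inter (MeasurableSet.const _)
  exact ⟨ψ, h1, h2⟩

variable (out : (∀ s, Alph s) → Measure (∀ j, Y j))

open Classical in
/-- A bound for the probability that the sources `z` are decoded incorrectly. -/
def decodingBound (b : ∀ s, Alph s → Fin (C s) × Fin (L s)) (z : ∀ s, Alph s) : ENNReal :=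
  ∑ j, (out z {y | ¬ IsLikely q τ N j (y j) z} +
    ∑ D' ∈ (D j).powerset.filter (fun D' => ¬ D' ⊆ N), ∑' a : (∀ s : D', Alph s),
      if (∀ s : D', a s ≠ z s) ∧ ∀ s : D', (b s (a s)).1 = (b s (z s)).1 then
        out z {y | τ D' ≤ q j D' (y j, (D j \ D').restrict z) {a}} else 0)

/-- If the true `z` is likely, then the decoder returns some likely `z'` in the same bins. A wrong
message at `s` forces `z'` to differ from `z` there and, as messages in `N` are trivial, `s ∉ N`.
The exact set of disagreement is thus among the `D'` in the union bound; errors confined to `N` are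
harmless. -/
lemma measure_decodingError_le {Dem : Finset S} (hD : ∀ j, D j ⊆ Dem)
    (hN : ∀ s ∈ Dem, s ∈ N → L s = 1) (b : ∀ s, Alph s → Fin (C s) × Fin (L s))
    (k : ∀ s, Fin (C s) × Fin (L s)) (z : ∀ s, Alph s) (hk : ∀ s ∈ Dem, b s (z s) = k s)
    (ψ : ∀ j, Y j → ∀ s, Alph s) (hψ : ∀ j, IsDecoder q τ N b (fun s => (k s).1) j (ψ j)) :
    out z {y | ∃ j, ∃ s ∈ D j, (b s (ψ j (y j) s)).2 ≠ (k s).2} ≤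
      decodingBound q τ N out b z := by
  classical
  have hsub : {y : ∀ j, Y j | ∃ j, ∃ s ∈ D j, (b s (ψ j (y j) s)).2 ≠ (k s).2} ⊆
      ⋃ j, ({y | ¬ IsLikely q τ N j (y j) z} ∪
        ⋃ D' ∈ (D j).powerset.filter (fun D' => ¬ D' ⊆ N), ⋃ a : (∀ s : D', Alph s),
          {y | ((∀ s : D', a s ≠ z s) ∧ ∀ s : D', (b s (a s)).1 = (b s (z s)).1) ∧
            τ D' ≤ q j D' (y j, (D j \ D').restrict z) {a}}) := by
    rintro y ⟨j, s, hs, hne⟩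
    refine Set.mem_iUnion.2 ⟨j, ?_⟩
    by_cases hz : IsLikely q τ N j (y j) z
    swap
    · exact Or.inl hz
    right
    obtain ⟨hlik, hbin⟩ := (hψ j).2 (y j) ⟨z, hz, fun s hs => by rw [hk s (hD j hs)]⟩
    set z' := ψ j (y j) with hz'
    set D' := (D j).filter fun t => z' t ≠ z t with hD'
    have hsD' : s ∈ D' := by
      refine Finset.mem_filter.2 ⟨hs, fun h => hne ?_⟩
      rw [h, hk s (hD j hs)]
    have hsN : s ∉ N := by
      intro h
      have h1 := hN s (hD j hs) h
      have : Subsingleton (Fin (L s)) := by rw [h1]; infer_instance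
      exact hne (Subsingleton.elim _ _)
    have hD'N : ¬ D' ⊆ N := fun h => hsN (h hsD')
    have hres : (D j \ D').restrict z' = (D j \ D').restrict z := by
      funext t
      have ht := Finset.mem_sdiff.1 t.2
      by_contra h
      exact ht.2 (Finset.mem_filter.2 ⟨ht.1, h⟩)
    refine Set.mem_biUnion (show D' ∈ _ from Finset.mem_filter.2
      ⟨Finset.mem_powerset.2 (Finset.filter_subset _ _), hD'N⟩)
      (Set.mem_iUnion.2 ⟨D'.restrict z', ⟨fun t => (Finset.mem_filter.1 t.2).2, fun t => ?_⟩, ?_⟩)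
    · have ht := (Finset.mem_filter.1 t.2).1
      exact (hbin t ht).trans (congrArg Prod.fst (hk t (hD j ht))).symm
    · rw [← hres]
      exact hlik D' (Finset.filter_subset _ _) hD'N
  refine (measure_mono hsub).trans ((measure_iUnion_fintype_le _ _).trans
    (Finset.sum_le_sum fun j _ => (measure_union_le _ _).trans (add_le_add le_rfl
      ((measure_biUnion_finset_le _ _).trans (Finset.sum_le_sum fun D' _ =>
        (measure_iUnion_le _).trans (ENNReal.tsum_le_tsum fun a => ?_))))))
  split_ifs with h
  · exact measure_mono fun y hy => hy.2
  · refine le_of_eq ?_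
    rw [show {y : ∀ j, Y j | ((∀ s : D', a s ≠ z s) ∧
      ∀ s : D', (b s (a s)).1 = (b s (z s)).1) ∧
      τ D' ≤ q j D' (y j, (D j \ D').restrict z) {a}} = ∅ from
      Set.eq_empty_of_forall_notMem fun y hy => h hy.1, measure_empty]

variable [∀ j D', IsMarkovKernel (q j D')] [∀ z, IsProbabilityMeasure (out z)]

/-- Markov's inequality for each `a`, and posterior probabilities sum to one: on average at most `1
/ τ` candidates pass the threshold, whatever the law of the output. -/
lemma tsum_measure_le_inv (j : J) (D' : Finset S) (hτ : τ D' ≠ 0) (hτ' : τ D' ≠ ⊤)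
    (z : ∀ s, Alph s) :
    ∑' a, out z {y | τ D' ≤ q j D' (y j, (D j \ D').restrict z) {a}} ≤ (τ D')⁻¹ := by
  have hm : ∀ a : (∀ s : D', Alph s), Measurable fun y : (∀ j, Y j) =>
      q j D' (y j, (D j \ D').restrict z) {a} := fun a =>
    (Kernel.measurable_coe _ (measurableSet_singleton a)).comp
      (measurable_prodMk_right.comp (measurable_pi_apply j))
  calc ∑' a, out z {y | τ D' ≤ q j D' (y j, (D j \ D').restrict z) {a}}
      ≤ ∑' a, (∫⁻ y, q j D' (y j, (D j \ D').restrict z) {a} ∂out z) / τ D' :=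
        ENNReal.tsum_le_tsum fun a => meas_ge_le_lintegral_div (hm a).aemeasurable hτ hτ'
    _ = (∫⁻ y, ∑' a, q j D' (y j, (D j \ D').restrict z) {a} ∂out z) / τ D' := by
        rw [lintegral_tsum fun a => (hm a).aemeasurable]
        simp only [div_eq_mul_inv, ENNReal.tsum_mul_right]
    _ ≤ 1 / τ D' := by
        refine ENNReal.div_le_div_right ?_ _
        refine (lintegral_mono (g := fun _ => 1) fun y => ?_).trans (by simp)
        have := lintegral_countable' (μ := q j D' (y j, (D j \ D').restrict z)) fun _ => 1
        simp only [one_mul, lintegral_const, measure_univ] at this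
        exact this.symm.le
    _ = _ := one_div _

variable [∀ s, NeZero (C s)] [∀ s, NeZero (L s)]

lemma pi_hashLaw_match_le (D' : Finset S) (a : ∀ s : D', Alph s) (z : ∀ s, Alph s)
    (h : ∀ s : D', a s ≠ z s) :
    Measure.pi (fun s => hashLaw (Alph s) (Fin (C s) × Fin (L s)))
      {b | ∀ s : D', (b s (a s)).1 = (b s (z s)).1} ≤ ∏ s ∈ D', (C s : ENNReal)⁻¹ := by
  classical
  have heq : {b : ∀ s, Alph s → Fin (C s) × Fin (L s) | ∀ s : D', (b s (a s)).1 = (b s (z s)).1} =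
      Set.univ.pi fun s => {b | ∀ h : s ∈ D', (b (a ⟨s, h⟩)).1 = (b (z s)).1} := by
    ext b
    simp [Set.mem_pi, Subtype.forall]
  rw [heq, Measure.pi_pi]
  refine le_trans (Finset.prod_le_prod' (g := fun s => if s ∈ D' then (C s : ENNReal)⁻¹ else 1)
    fun s _ => ?_) (le_of_eq (by rw [Finset.prod_ite_mem, Finset.univ_inter]))
  by_cases hs : s ∈ D'
  · simp only [hs, forall_true_left, if_true]
    simpa using hashLaw_fst_collision_le (κ₁ := Fin (C s)) (κ₂ := Fin (L s)) (h ⟨s, hs⟩)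
  · simp only [hs, if_false]
    exact prob_le_one

lemma measurableSet_match (D' : Finset S) (a : ∀ s : D', Alph s) (z : ∀ s, Alph s) :
    MeasurableSet {b : ∀ s, Alph s → Fin (C s) × Fin (L s) |
      ∀ s : D', (b s (a s)).1 = (b s (z s)).1} := by
  rw [Set.ofPred_forall]
  refine MeasurableSet.iInter fun s => measurableSet_eq_fun ?_ ?_
  · exact measurable_fst.comp ((measurable_pi_apply _).comp (measurable_pi_apply (s : S)))
  · exact measurable_fst.comp ((measurable_pi_apply _).comp (measurable_pi_apply (s : S)))

lemma measurable_decodingBound_term (D' : Finset S) (a : ∀ s : D', Alph s) (z : ∀ s, Alph s)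
    (c : ENNReal) :
    open Classical in
    Measurable fun b : (∀ s, Alph s → Fin (C s) × Fin (L s)) =>
      if (∀ s : D', a s ≠ z s) ∧ ∀ s : D', (b s (a s)).1 = (b s (z s)).1 then c else 0 :=
  Measurable.ite ((MeasurableSet.const _).inter (measurableSet_match D' a z)) measurable_const
    measurable_const

lemma measurable_decodingBound (z : ∀ s, Alph s) :
    Measurable fun b : (∀ s, Alph s → Fin (C s) × Fin (L s)) => decodingBound q τ N out b z :=
  Finset.measurable_sum _ fun _ _ => measurable_const.add (Finset.measurable_sum _ fun D' _ =>
    Measurable.tsum fun a => measurable_decodingBound_term D' a z _)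

/-- Since `a` differs from `z` in every component of `D'`, the collisions are independent with
probability at most `1 / C s` each; this multiplies the expected number of candidates. -/
lemma lintegral_decodingBound_le (hτ : ∀ D', τ D' ≠ 0) (hτ' : ∀ D', τ D' ≠ ⊤)
    (z : ∀ s, Alph s) :
    open Classical in
    ∫⁻ b, decodingBound q τ N out b z
      ∂Measure.pi (fun s => hashLaw (Alph s) (Fin (C s) × Fin (L s))) ≤
    ∑ j, (out z {y | ¬ IsLikely q τ N j (y j) z} +
      ∑ D' ∈ (D j).powerset.filter (fun D' => ¬ D' ⊆ N),
        (∏ s ∈ D', (C s : ENNReal)⁻¹) * (τ D')⁻¹) := by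
  classical
  unfold decodingBound
  refine (lintegral_finsetSum Finset.univ fun _ _ => ?_).trans_le ?_
  · exact measurable_const.add (Finset.measurable_sum _ fun D' _ =>
      Measurable.tsum fun a => measurable_decodingBound_term D' a z _)
  refine Finset.sum_le_sum fun j _ => ?_
  rw [lintegral_add_left measurable_const, lintegral_const, measure_univ, mul_one]
  refine add_le_add le_rfl ((lintegral_finsetSum _ fun D' _ => ?_).trans_le
    (Finset.sum_le_sum fun D' _ => ?_))
  · exact Measurable.tsum fun a => measurable_decodingBound_term D' a z _
  rw [lintegral_tsum fun a => (measurable_decodingBound_term D' a z _).aemeasurable]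
  refine le_trans ?_ (mul_le_mul le_rfl (tsum_measure_le_inv q τ out j D' (hτ D') (hτ' D') z)
    zero_le zero_le)
  rw [← ENNReal.tsum_mul_left]
  refine ENNReal.tsum_le_tsum fun a => ?_
  by_cases h : ∀ s : D', a s ≠ z s
  · simp only [h, not_false_eq_true, true_and, ne_eq, implies_true]
    refine le_trans (le_of_eq ?_) (mul_le_mul (pi_hashLaw_match_le (L := L) D' a z h) le_rfl
      zero_le zero_le)
    rw [mul_comm, ← lintegral_indicator_const (measurableSet_match D' a z)]
    exact lintegral_congr fun b => by simp [Set.indicator]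
  · simp only [h, false_and, if_false, lintegral_zero]
    exact zero_le

end Decoding

/-! ### The coding theorem at a fixed block length. -/

section OneShot

variable {S I J : Type*} [Fintype S] [Fintype I] [Fintype J] [DecidableEq S] [DecidableEq I]
  {X : I → Type*} {Y : ℕ → J → Type*} [∀ i, Fintype (X i)] [∀ n j, MeasurableSpace (Y n j)]
  {A : Finset (S × I)} {D : J → Finset S} (Z : AuxSources A X) (W : Channel X Y) (n : ℕ)
  {C L : S → ℕ} [∀ s, NeZero (C s)] [∀ s, NeZero (L s)]

/-- The code that generates the sources from the messages and the fixed bin indices `c` by the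
functions `ω`, and whose decoders use `ψ`. -/
def binningCode (b : ∀ s, Z.Alph n s → Fin (C s) × Fin (L s)) (c : ∀ s, Fin (C s))
    (ω : SeedIndex A (Z.Alph n) (fun s => Fin (C s) × Fin (L s)) → ∀ s, Z.Alph n s)
    (ψ : ∀ j, Y n j → ∀ s, Z.Alph n s) (hψ : ∀ j, Measurable (ψ j)) : Code A D X Y n where
  size := L
  size_pos s := Nat.pos_of_ne_zero (NeZero.ne (L s))
  enc i m := Z.input n i ((messagesAt A i).restrict
    -- The value `0` for messages unknown to encoder `i` is immaterial: by `sourceOf_congr` the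
    -- components in `S(i)` do not depend on it.
    (sourceOf ω fun s => (c s, if h : s ∈ messagesAt A i then m ⟨s, h⟩ else 0)))
  dec j := Kernel.deterministic (fun y (s : D j) => (b s (ψ j y s)).2)
    ((measurable_of_countable fun (z : ∀ s, Z.Alph n s) (s : D j) => (b s (z s)).2).comp (hψ j))
  dec_markov _ := inferInstance

lemma pi_dirac_error {Y : Type*} (y : Y) (f : ∀ j (s : D j), Fin (L s)) (m : ∀ s, Fin (L s))
    (B : Set Y) (hB : ∀ j (s : S) (hs : s ∈ D j), f j ⟨s, hs⟩ ≠ m s → y ∈ B) :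
    (Measure.pi fun j => Measure.dirac (f j)) {mhat | ∃ j, ∃ s : D j, mhat j s ≠ m s} ≤
      B.indicator 1 y := by
  rw [← Measure.infinitePi_eq_pi, Measure.infinitePi_dirac,
    Measure.dirac_apply' _ (Set.toFinite _).measurableSet]
  by_cases h : ∃ j, ∃ s : D j, f j s ≠ m s
  · obtain ⟨j, s, hne⟩ := h
    rw [Set.indicator_of_mem (hB j s s.2 hne)]
    exact Set.indicator_le_self' (fun _ _ => zero_le) _
  · rw [Set.indicator_of_notMem (show f ∉ {mhat : ∀ j (s : D j), Fin (L s) |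
      ∃ j, ∃ s : D j, mhat j s ≠ m s} from h)]
    exact zero_le

lemma errorProb_binningCode_le (b : ∀ s, Z.Alph n s → Fin (C s) × Fin (L s))
    (c : ∀ s, Fin (C s))
    (ω : SeedIndex A (Z.Alph n) (fun s => Fin (C s) × Fin (L s)) → ∀ s, Z.Alph n s)
    (ψ : ∀ j, Y n j → ∀ s, Z.Alph n s) (hψ : ∀ j, Measurable (ψ j)) :
    (binningCode (D := D) Z n b c ω ψ hψ).errorProb W ≤
      ∑ m : (∀ s, Fin (L s)), (∏ s, (L s : ENNReal)⁻¹) *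
        Z.output W n (sourceOf ω fun s => (c s, m s))
          {y | ∃ j, ∃ s ∈ D j, (b s (ψ j (y j) s)).2 ≠ m s} := by
  refine Finset.sum_le_sum fun (m : ∀ s, Fin (L s)) _ => mul_le_mul le_rfl ?_ zero_le zero_le
  have henc : ∀ i, (binningCode (D := D) Z n b c ω ψ hψ).enc i ((messagesAt A i).restrict m) =
      Z.input n i ((messagesAt A i).restrict (sourceOf ω fun s => (c s, m s))) := by
    intro i
    refine congrArg (Z.input n i) (funext fun s => ?_)
    refine sourceOf_congr ω (i := i) (fun t ht => ?_) s s.2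
    exact congrArg (Prod.mk (c t)) (dif_pos ht)
  rw [AuxSources.output, Measure.finsetSum_apply]
  refine Finset.sum_le_sum fun x _ => ?_
  rw [Measure.smul_apply, smul_eq_mul]
  refine mul_le_mul (le_of_eq (Finset.prod_congr rfl fun i _ =>
    congrArg (fun f => f (x i)) (henc i))) ?_ zero_le zero_le
  refine (lintegral_mono fun y => ?_).trans (lintegral_indicator_one_le _)
  have hdec : (Measure.pi fun j => (binningCode (D := D) Z n b c ω ψ hψ).dec j (y j)) =
      Measure.pi fun j => Measure.dirac fun s : D j => (b s (ψ j (y j) s)).2 := by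
    congr 1
  refine (le_of_eq (congrArg (fun μ => μ {mhat : ∀ j (s : D j), Fin (L s) |
    ∃ j, ∃ s : D j, mhat j s ≠ m s}) hdec)).trans ?_
  exact pi_dirac_error y (fun j (s : D j) => (b s (ψ j (y j) s)).2) m
    {y | ∃ j, ∃ s ∈ D j, (b s (ψ j (y j) s)).2 ≠ m s} fun j s hs hne => ⟨j, s, hs, hne⟩

/-- A uniform bin index is a pair of independent uniform indices, and the best first index does no
worse than the average. -/
lemma exists_le_of_mean_le (F : (∀ s, Fin (C s)) → (∀ s, Fin (L s)) → ENNReal) (T : ENNReal)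
    (h : ∑ k : (∀ s, Fin (C s) × Fin (L s)),
      (∏ s, (Fintype.card (Fin (C s) × Fin (L s)) : ENNReal)⁻¹) *
        F (fun s => (k s).1) (fun s => (k s).2) ≤ T) :
    ∃ c, ∑ m, (∏ s, (L s : ENNReal)⁻¹) * F c m ≤ T := by
  obtain ⟨c, -, hc⟩ := Finset.exists_min_image Finset.univ
    (fun c => ∑ m, (∏ s, (L s : ENNReal)⁻¹) * F c m) Finset.univ_nonempty
  refine ⟨c, le_trans ?_ h⟩
  have h1 : ∑ _c : (∀ s, Fin (C s)), ∏ s, (C s : ENNReal)⁻¹ = 1 := by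
    rw [← Fintype.prod_sum (fun s (_ : Fin (C s)) => (C s : ENNReal)⁻¹)]
    exact Finset.prod_eq_one fun s _ => sum_uniform (C s) (Nat.pos_of_ne_zero (NeZero.ne _))
  calc ∑ m, (∏ s, (L s : ENNReal)⁻¹) * F c m
      = ∑ _c' : (∀ s, Fin (C s)), (∏ s, (C s : ENNReal)⁻¹) *
          ∑ m, (∏ s, (L s : ENNReal)⁻¹) * F c m := by rw [← Finset.sum_mul, h1, one_mul]
    _ ≤ ∑ c' : (∀ s, Fin (C s)), (∏ s, (C s : ENNReal)⁻¹) *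
          ∑ m, (∏ s, (L s : ENNReal)⁻¹) * F c' m := by
        exact Finset.sum_le_sum fun c' _ =>
          mul_le_mul le_rfl (hc c' (Finset.mem_univ _)) zero_le zero_le
    _ = _ := by
        rw [← (Equiv.arrowProdEquivProdArrow S (fun s => Fin (C s))
          (fun s => Fin (L s))).symm.sum_comp, Fintype.sum_prod_type]
        refine Finset.sum_congr rfl fun c' _ => ?_
        rw [Finset.mul_sum]
        refine Finset.sum_congr rfl fun m _ => ?_
        rw [← mul_assoc, ← Finset.prod_mul_distrib]
        congr 1
        refine Finset.prod_congr rfl fun s _ => ?_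
        rw [Fintype.card_prod, Fintype.card_fin, Fintype.card_fin, Nat.cast_mul,
          ENNReal.mul_inv (.inr (ENNReal.natCast_ne_top _)) (.inl (ENNReal.natCast_ne_top _))]

variable
  (q : ∀ j (D' : Finset S),
    Kernel (Y n j × (∀ s : ↥(D j \ D'), Z.Alph n s)) (∀ s : D', Z.Alph n s))
  [∀ j D', IsMarkovKernel (q j D')] (τ : Finset S → ENNReal) (N B Dem : Finset S)

lemma AuxSources.tsum_law_mul_not_isLikely (j : J) :
    ∑' z, Z.law n z * Z.output W n z {y | ¬ IsLikely q τ N j (y j) z} =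
      Z.joint W n {ω | ¬ IsLikely q τ N j (ω.2 j) ω.1} := by
  have hm : MeasurableSet {ω : (∀ s, Z.Alph n s) × (∀ j, Y n j) |
      ¬ IsLikely q τ N j (ω.2 j) ω.1} := by
    refine MeasurableSet.compl (measurableSet_setOfPred.2 ?_)
    refine measurable_from_prod_countable_right fun z => measurableSet_setOfPred.1 ?_
    exact (measurableSet_isLikely q τ N j z).preimage (measurable_pi_apply j)
  rw [Z.joint_apply W n hm]
  rfl

theorem exists_code (hD : ∀ j, D j ⊆ Dem) (hB : ∀ s ∈ Dem, s ∉ B → C s * L s = 1)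
    (hN : ∀ s ∈ Dem, s ∈ N → L s = 1) (hτ : ∀ D', τ D' ≠ 0) (hτ' : ∀ D', τ D' ≠ ⊤)
    (ε : ENNReal) {η : ℝ} (hη : 0 < η) :
    open Classical in
    ∃ E : Code A D X Y n, E.size = L ∧ E.errorProb W ≤
      ∑ j, (Z.joint W n {ω | ¬ IsLikely q τ N j (ω.2 j) ω.1} +
        ∑ D' ∈ (D j).powerset.filter (fun D' => ¬ D' ⊆ N),
          (∏ s ∈ D', (C s : ENNReal)⁻¹) * (τ D')⁻¹) +
      ∑ I' ∈ accessFamily A,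
        ((∑' z, {z | ¬ IsSpread (Z.law n) (fun s => Fin (C s) × Fin (L s)) (privateMessages A I')
            (publicMessages A I') B ε z}.indicator (Z.law n) z) + ENNReal.ofReal η +
          (2 ^ Fintype.card S * ε + ∑' z, {z | ¬ IsSpread (Z.law n)
            (fun s => Fin (C s) × Fin (L s)) (privateMessages A I') (publicMessages A I')
              B ε z}.indicator (Z.law n) z) / ENNReal.ofReal η) := by
  classical
  set p := Z.law n with hp
  set out := Z.output W n with hout
  set ν := fun s => hashLaw (Z.Alph n s) (Fin (C s) × Fin (L s)) with hν
  choose ψ hψ using fun (b : ∀ s, Z.Alph n s → Fin (C s) × Fin (L s)) (c : ∀ s, Fin (C s))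
    (j : J) => exists_isDecoder q τ N b c j
  set e : (∀ s, Z.Alph n s → Fin (C s) × Fin (L s)) → (∀ s, Fin (C s) × Fin (L s)) →
      (∀ s, Z.Alph n s) → ENNReal := fun b k z =>
    out z {y | ∃ j, ∃ s ∈ D j, (b s (ψ b (fun s => (k s).1) j (y j) s)).2 ≠ (k s).2} with he
  set G : (∀ s, Z.Alph n s → Fin (C s) × Fin (L s)) → ENNReal := fun b =>
    ∑' z, p z * decodingBound q τ N out b z with hG
  set F : Finset I → (∀ s, Z.Alph n s → Fin (C s) × Fin (L s)) → ENNReal := fun I' b =>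
    ∑ k, ∑' z, idealLaw p Dem b k z *
      (1 - binRatio p Dem b (privateMessages A I') (publicMessages A I') k z) with hF
  have hGm : Measurable G := Measurable.tsum fun z =>
    (measurable_decodingBound q τ N out z).const_mul _
  have hFm : ∀ I', Measurable (F I') := fun I' => Finset.measurable_sum _ fun k _ =>
    Measurable.tsum fun z => by fun_prop
  have hcard : ∀ s, Fintype.card (Fin (C s) × Fin (L s)) = C s * L s := fun s => by simp
  have hGint : ∫⁻ b, G b ∂Measure.pi ν ≤
      ∑ j, (Z.joint W n {ω | ¬ IsLikely q τ N j (ω.2 j) ω.1} +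
        ∑ D' ∈ (D j).powerset.filter (fun D' => ¬ D' ⊆ N),
          (∏ s ∈ D', (C s : ENNReal)⁻¹) * (τ D')⁻¹) := by
    rw [hG, lintegral_tsum fun z =>
      ((measurable_decodingBound q τ N out z).const_mul _).aemeasurable]
    calc ∑' z, ∫⁻ b, p z * decodingBound q τ N out b z ∂Measure.pi ν
        ≤ ∑' z, p z * ∑ j, (out z {y | ¬ IsLikely q τ N j (y j) z} +
            ∑ D' ∈ (D j).powerset.filter (fun D' => ¬ D' ⊆ N),
              (∏ s ∈ D', (C s : ENNReal)⁻¹) * (τ D')⁻¹) := by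
          refine ENNReal.tsum_le_tsum fun z => ?_
          rw [lintegral_const_mul _ (measurable_decodingBound q τ N out z)]
          refine mul_le_mul le_rfl ?_ zero_le zero_le
          exact lintegral_decodingBound_le q τ N out hτ hτ' z
      _ = _ := by
          simp only [Finset.mul_sum (s := Finset.univ), mul_add]
          rw [Summable.tsum_finsetSum fun _ _ => ENNReal.summable]
          refine Finset.sum_congr rfl fun j _ => ?_
          rw [ENNReal.tsum_add, Z.tsum_law_mul_not_isLikely W n q τ N j, ENNReal.tsum_mul_right,
            p.tsum_coe, one_mul]
  have hFint : ∀ I', ∫⁻ b, F I' b ∂Measure.pi ν ≤ _ := fun I' =>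
    lintegral_idealLaw_mul_one_sub_ratio_le p Dem ν (P := privateMessages A I')
      (U := publicMessages A I') (B := B) (ε := ε)
      (fun s h1 h2 => (hcard s).trans (hB s h1 h2))
      (fun s a a' h => hashLaw_collision_le h) hη
  -- The same hash functions must serve both decoding and generation, so they are chosen for the sum
  -- of the two bounds.
  obtain ⟨b, hb⟩ := exists_le_lintegral (μ := Measure.pi ν)
    (f := fun b => G b + ∑ I' ∈ accessFamily A, F I' b)
    (hGm.add (Finset.measurable_sum _ fun I' _ => hFm I')).aemeasurable
  rw [lintegral_add_left hGm, lintegral_finsetSum _ fun I' _ => hFm I'] at hb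
  replace hb := hb.trans (add_le_add hGint (Finset.sum_le_sum fun I' _ => hFint I'))
  -- Under the ideal law `k` holds the true bins of the demanded components, so the decoding bound
  -- applies; it does not involve `k`, which then sums out.
  have hideal : ∑ k, ∑' z, idealLaw p Dem b k z * e b k z ≤ G b := by
    calc ∑ k, ∑' z, idealLaw p Dem b k z * e b k z
        ≤ ∑ k, ∑' z, idealLaw p Dem b k z * decodingBound q τ N out b z := by
          refine Finset.sum_le_sum fun k _ => ENNReal.tsum_le_tsum fun z => ?_
          by_cases h0 : idealLaw p Dem b k z = 0
          · simp [h0]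
          refine mul_le_mul le_rfl ?_ zero_le zero_le
          refine measure_decodingError_le q τ N out hD hN b k z (fun s hs => ?_) _
            fun j => hψ b (fun s => (k s).1) j
          by_contra hne
          refine h0 (mul_eq_zero_of_right _ (Finset.prod_eq_zero (Finset.mem_univ s) ?_))
          simp [binWeight, hs, hne]
      _ = G b := by
          rw [← Summable.tsum_finsetSum fun _ _ => ENNReal.summable]
          simp only [← Finset.sum_mul, sum_idealLaw, hG]
  have hseed := lintegral_seedLaw_le (A := A) p Dem b (fun z => Z.factorizes n z) (e b)
    fun k z => prob_le_one
  have hem : ∀ k, Measurable fun ω : SeedIndex A (Z.Alph n) (fun s => Fin (C s) × Fin (L s)) →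
      ∀ s, Z.Alph n s => e b k (sourceOf ω k) := fun k =>
    (measurable_of_countable (e b k)).comp (measurable_sourceOf k)
  obtain ⟨ω, hω⟩ := exists_le_lintegral (μ := seedLaw (A := A) p Dem b)
    (f := fun ω => ∑ k, (∏ s, (Fintype.card (Fin (C s) × Fin (L s)) : ENNReal)⁻¹) *
      e b k (sourceOf ω k))
    (Finset.measurable_sum _ fun k _ => (hem k).const_mul _).aemeasurable
  obtain ⟨c, hc⟩ := exists_le_of_mean_le (fun c m =>
    out (sourceOf ω fun s => (c s, m s))
      {y | ∃ j, ∃ s ∈ D j, (b s (ψ b c j (y j) s)).2 ≠ m s}) _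
    (hω.trans (hseed.trans ((add_le_add hideal le_rfl).trans hb)))
  exact ⟨binningCode Z n b c ω (ψ b c) fun j => (hψ b c j).1, rfl,
    (errorProb_binningCode_le Z W n b c ω (ψ b c) _).trans hc⟩

end OneShot

/-! ### Choice of the numbers of bins. -/

section BinSizes

lemma ceil_two_rpow_ne_zero (x : ℝ) : ⌈(2 : ℝ) ^ x⌉₊ ≠ 0 :=
  (Nat.ceil_pos.2 (by positivity)).ne'

lemma ceil_two_rpow_le {x : ℝ} (hx : 0 ≤ x) : (⌈(2 : ℝ) ^ x⌉₊ : ℝ) ≤ 2 * 2 ^ x := by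
  have h1 := Real.one_le_rpow one_le_two hx
  linarith [Nat.ceil_lt_add_one (show (0 : ℝ) ≤ 2 ^ x by positivity)]

lemma ceil_two_rpow_eq_one {x : ℝ} (hx : x ≤ 0) : ⌈(2 : ℝ) ^ x⌉₊ = 1 :=
  le_antisymm (Nat.ceil_le.2 (by simpa using Real.rpow_le_one_of_one_le_of_nonpos one_le_two hx))
    (Nat.one_le_iff_ne_zero.2 (ceil_two_rpow_ne_zero x))

lemma le_logb_ceil_div {n : ℕ} (hn : n ≠ 0) (x : ℝ) :
    x ≤ Real.logb 2 (⌈(2 : ℝ) ^ (n * x)⌉₊ : ℝ) / n := by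
  have hn' : (0 : ℝ) < n := by positivity
  rw [le_div_iff₀ hn', Real.le_logb_iff_rpow_le one_lt_two
    (by exact_mod_cast Nat.pos_of_ne_zero (ceil_two_rpow_ne_zero _)), mul_comm]
  exact Nat.le_ceil _

variable {S : Type*} [Fintype S] [DecidableEq S]

lemma exists_pos_le_of_pos (R : S → ℝ) {ε : ℝ} (hε : 0 < ε) :
    ∃ δ > 0, δ ≤ ε ∧ ∀ s, 0 < R s → δ ≤ R s := by
  have h : ∀ᶠ δ in 𝓝[>] (0 : ℝ), 0 < δ ∧ δ ≤ ε ∧ ∀ s, 0 < R s → δ ≤ R s := by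
    refine eventually_mem_nhdsWithin.and ((eventually_nhdsWithin_of_eventually_nhds
      (eventually_le_nhds hε)).and (eventually_all.2 fun s => ?_))
    by_cases hs : 0 < R s
    · filter_upwards [eventually_nhdsWithin_of_eventually_nhds (eventually_le_nhds hs)] with δ hδ _
      exact hδ
    · exact Eventually.of_forall fun _ h => absurd h hs
  obtain ⟨δ, h1, h2, h3⟩ := h.exists
  exact ⟨δ, h1, h2, h3⟩

/-- Numbers of bins `C n s * L n s`, of which `L n s` is the number of messages. The messages
in `N` are trivial, and only the bins of the messages in `B` are nontrivial. -/
lemma exists_bin_sizes (Dem : Finset S) {R r : S → ℝ} (hR : ∀ s, 0 ≤ R s)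
    (hr : ∀ s ∈ Dem, 0 ≤ r s) {ε : ℝ} (hε : 0 < ε) :
    ∃ g > 0, ∃ (N B : Finset S) (C L : ℕ → S → ℕ),
      (∀ n s, C n s ≠ 0) ∧ (∀ n s, L n s ≠ 0) ∧
      (∀ n : ℕ, ∀ s ∈ Dem, s ∉ B → C n s * L n s = 1) ∧ (∀ n : ℕ, ∀ s ∈ Dem, s ∈ N → L n s = 1) ∧
      (∀ n : ℕ, ∀ s ∈ B, (C n s * L n s : ℝ) ≤ 4 * 2 ^ (n * (R s + r s - 2 * g))) ∧
      (∀ n : ℕ, ∀ D' ⊆ Dem, ¬ D' ⊆ N →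
        (2 : ℝ) ^ (n * (∑ s ∈ D', r s + 2 * g)) ≤ ∏ s ∈ D', (C n s : ℝ)) ∧
      (∀ n : ℕ, n ≠ 0 → ∀ s, R s - ε ≤ Real.logb 2 (L n s) / n) := by
  obtain ⟨δ, hδ, hδε, hδR⟩ := exists_pos_le_of_pos R hε
  set c : ℝ := (Fintype.card S : ℝ) with hc
  have hc0 : 0 ≤ c := by positivity
  -- Each nontrivial message gives up rate `δ = (2 * c + 2) * g + 2 * g`: the first part enlarges
  -- its first bin index, the second is the slack below the inf-entropies.
  set g := δ / (2 * c + 4) with hg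
  have hgδ : (2 * c + 4) * g = δ := by rw [hg]; field_simp
  have hg0 : 0 < g := by positivity
  set N : Finset S := Finset.univ.filter fun s => R s = 0 with hN
  have hRN : ∀ s, s ∉ N → δ ≤ R s := fun s hs =>
    hδR s (lt_of_le_of_ne (hR s) fun h => hs (by simp [hN, ← h]))
  -- A message of rate zero has no rate to give up, so its slack comes out of the first index; the
  -- surplus of any nontrivial message covers up to `c` such losses and still leaves `2 * g`.
  set ρ : S → ℝ := fun s => if s ∈ N then r s - 2 * g else r s + (2 * c + 2) * g with hρ
  -- If the reduced exponent of a zero-rate message is not positive, rounding up gives a single bin.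
  -- The upper bound on the number of bins may then fail, and such a message is left out of `B`.
  set B : Finset S := Dem.filter fun s => s ∈ N → 0 < ρ s with hB
  set l : S → ℝ := fun s => if s ∈ N then 0 else R s - δ with hl
  refine ⟨g, hg0, N, B, fun n s => ⌈(2 : ℝ) ^ (n * ρ s)⌉₊, fun n s => ⌈(2 : ℝ) ^ (n * l s)⌉₊,
    fun n s => ceil_two_rpow_ne_zero _, fun n s => ceil_two_rpow_ne_zero _, ?_, ?_, ?_, ?_, ?_⟩
  · intro n s hs hsB
    have h : s ∈ N ∧ ρ s ≤ 0 := by simpa [hB, hs] using hsB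
    dsimp only
    rw [ceil_two_rpow_eq_one (mul_nonpos_of_nonneg_of_nonpos (by positivity) h.2),
      ceil_two_rpow_eq_one (by simp [hl, h.1])]
  · intro n s _ hs
    exact ceil_two_rpow_eq_one (by simp [hl, hs])
  · intro n s hs
    obtain ⟨hsD, hs⟩ := Finset.mem_filter.1 hs
    have h0 : 0 ≤ ρ s ∧ 0 ≤ l s ∧ ρ s + l s = R s + r s - 2 * g := by
      by_cases h : s ∈ N
      · have hRs : R s = 0 := by simpa [hN] using h
        refine ⟨(hs h).le, by simp [hl, h], ?_⟩
        simp only [hρ, hl, h, if_true, hRs]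
        ring
      · have := hr s hsD
        have := hRN s h
        simp only [hρ, hl, h, if_false]
        refine ⟨by positivity, by linarith, by linarith⟩
    rw [← h0.2.2, mul_add, Real.rpow_add two_pos]
    calc _ ≤ (2 * 2 ^ (n * ρ s)) * (2 * (2 : ℝ) ^ (n * l s)) :=
          mul_le_mul (ceil_two_rpow_le (mul_nonneg (by positivity) h0.1))
            (ceil_two_rpow_le (mul_nonneg (by positivity) h0.2.1)) (by positivity) (by positivity)
      _ = _ := by ring
  · intro n D' hD' hD'N
    -- The nontrivial message whose surplus pays for the rest of `D'`.
    obtain ⟨u, hu, huN⟩ := Finset.not_subset.1 hD'N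
    have h1 : ∀ s ∈ D', -(2 * g) ≤ ρ s - r s := fun s _ => by
      by_cases h : s ∈ N
      · simp only [hρ, h, if_true]; linarith
      · simp only [hρ, h, if_false]
        have : 0 ≤ (2 * c + 2) * g := by positivity
        linarith
    have h2 : ∑ s ∈ D', r s + 2 * g ≤ ∑ s ∈ D', ρ s := by
      have h3 : -(c * (2 * g)) ≤ ∑ s ∈ D'.erase u, (ρ s - r s) := by
        have h4 := Finset.card_nsmul_le_sum (D'.erase u) (fun s => ρ s - r s) (-(2 * g))
          fun s hs => h1 s (Finset.mem_of_mem_erase hs)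
        have h5 : ((D'.erase u).card : ℝ) ≤ c := by
          rw [hc]; exact_mod_cast Finset.card_le_univ _
        rw [nsmul_eq_mul] at h4
        nlinarith
      have h6 := Finset.sum_erase_add D' (fun s => ρ s - r s) hu
      have h8 := Finset.sum_sub_distrib (s := D') ρ r
      have h7 : ρ u - r u = (2 * c + 2) * g := by simp [hρ, huN]
      linarith
    calc (2 : ℝ) ^ (n * (∑ s ∈ D', r s + 2 * g)) ≤ 2 ^ (n * ∑ s ∈ D', ρ s) :=
          Real.rpow_le_rpow_of_exponent_le one_le_two (by gcongr)
      _ = ∏ s ∈ D', (2 : ℝ) ^ (n * ρ s) := by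
          rw [Finset.mul_sum, Real.rpow_sum_of_pos two_pos]
      _ ≤ _ := Finset.prod_le_prod (fun _ _ => by positivity) fun s _ => Nat.le_ceil _
  · intro n hn s
    refine le_trans ?_ (le_logb_ceil_div hn (l s))
    by_cases h : s ∈ N
    · have hRs : R s = 0 := by simpa [hN] using h
      simp only [hl, h, if_true]; linarith
    · simp only [hl, h, if_false]; linarith

end BinSizes

/-! ### Achievability: asymptotics of the one-shot bound. -/

section Achievability

variable {S I J : Type*} [Fintype S] [Fintype I] [Fintype J] [DecidableEq S] [DecidableEq I]
  {X : I → Type*} {Y : ℕ → J → Type*} [∀ i, Fintype (X i)] [∀ n j, MeasurableSpace (Y n j)]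
  {A : Finset (S × I)} {D : J → Finset S} (Z : AuxSources A X) (W : Channel X Y)

/-- The conditional law of the sources `D'` given the output at decoder `j` and the remaining
sources demanded there. -/
def AuxSources.posterior (D : J → Finset S) (n : ℕ) (j : J) (D' : Finset S) :
    Kernel (Y n j × (∀ s : ↥(D j \ D'), Z.Alph n s)) (∀ s : D', Z.Alph n s) :=
  condDistrib (fun ω : (∀ s, Z.Alph n s) × (∀ j, Y n j) => D'.restrict ω.1)
    (fun ω => (ω.2 j, (D j \ D').restrict ω.1)) (Z.joint W n)

instance (n : ℕ) (j : J) (D' : Finset S) : IsMarkovKernel (Z.posterior W D n j D') := by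
  unfold AuxSources.posterior
  infer_instance

lemma AuxSources.tendsto_not_isLikely {r : S → ℝ} {j : J} (h : ∀ D' ⊆ D j, D'.Nonempty →
      supEntropy (Z.joint W) (fun _ ω => D'.restrict ω.1)
          (fun _ ω => (ω.2 j, (D j \ D').restrict ω.1)) ≤ ((∑ s ∈ D', r s : ℝ) : EReal))
    {g : ℝ} (hg : 0 < g) (N : Finset S) :
    Tendsto (fun n : ℕ => Z.joint W n {ω | ¬ IsLikely (Z.posterior W D n)
      (fun D' => ENNReal.ofReal (2 ^ (-(n * (∑ s ∈ D', r s + g))))) N j (ω.2 j) ω.1})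
      atTop (𝓝 0) := by
  classical
  have hlim : Tendsto (fun n : ℕ => ∑ D' ∈ (D j).powerset.filter (·.Nonempty),
      Z.joint W n {ω | ∑ s ∈ D', r s + g < condInfo (Z.joint W) (fun _ ω => D'.restrict ω.1)
          (fun _ ω => (ω.2 j, (D j \ D').restrict ω.1)) n ω}) atTop (𝓝 0) := by
    rw [← Finset.sum_const_zero]
    refine tendsto_finsetSum _ fun D' hD' => ?_
    obtain ⟨h1, h2⟩ := Finset.mem_filter.1 hD'
    exact tendsto_of_supEntropy_lt _ _ _ (h D' (Finset.mem_powerset.1 h1) h2) (by linarith)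
  refine tendsto_of_tendsto_of_tendsto_of_le_of_le' tendsto_const_nhds hlim
    (Eventually.of_forall fun _ => zero_le) ?_
  filter_upwards [eventually_ne_atTop 0] with n hn
  calc _ ≤ Z.joint W n (⋃ D' ∈ (D j).powerset.filter (·.Nonempty),
          {ω | Z.posterior W D n j D' (ω.2 j, (D j \ D').restrict ω.1) {D'.restrict ω.1} <
            ENNReal.ofReal (2 ^ (-(n * (∑ s ∈ D', r s + g))))}) := by
        refine measure_mono fun ω (hω : ¬ IsLikely _ _ N j (ω.2 j) ω.1) => ?_
        simp only [IsLikely, not_forall, not_le] at hω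
        obtain ⟨D', h1, h2, h3⟩ := hω
        obtain ⟨u, hu, -⟩ := Finset.not_subset.1 h2
        exact Set.mem_biUnion (Finset.mem_coe.2 (Finset.mem_filter.2
          ⟨Finset.mem_powerset.2 h1, u, hu⟩)) h3
    _ ≤ _ := measure_biUnion_finset_le _ _
    _ ≤ _ := Finset.sum_le_sum fun D' _ => ?_
  -- A vanishing posterior fails the threshold without giving large self-information, so this null
  -- event is removed.
  have h0 := measure_condDistrib_eq_zero (μ := Z.joint W n)
    (U := fun ω : (∀ s, Z.Alph n s) × (∀ j, Y n j) => D'.restrict ω.1)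
    (V := fun ω => (ω.2 j, (D j \ D').restrict ω.1)) (by fun_prop) (by fun_prop)
  refine (measure_mono fun ω hω => ?_).trans ((measure_union_le _ _).trans
    ((add_le_add h0.le le_rfl).trans (zero_add _).le))
  by_cases hz : condDistrib (fun ω : (∀ s, Z.Alph n s) × (∀ j, Y n j) => D'.restrict ω.1)
    (fun ω => (ω.2 j, (D j \ D').restrict ω.1)) (Z.joint W n)
      (ω.2 j, (D j \ D').restrict ω.1) {D'.restrict ω.1} = 0
  · exact .inl hz
  · exact .inr (lt_condInfo_of_measure_lt (Z.joint W) (fun _ ω => D'.restrict ω.1)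
      (fun _ ω => (ω.2 j, (D j \ D').restrict ω.1)) hn hz hω)

/-- Recording `Z.law n ω.1 ≠ 0` costs no mass and makes the marginals that appear as denominators
nonzero. -/
lemma AuxSources.tsum_indicator_law (n : ℕ) (E : Set (∀ s, Z.Alph n s)) :
    ∑' z, E.indicator (Z.law n) z = Z.joint W n {ω | Z.law n ω.1 ≠ 0 ∧ ω.1 ∈ E} := by
  have hm : MeasurableSet {z | Z.law n z ≠ 0 ∧ z ∈ E} := .of_discrete
  rw [show {ω : (∀ s, Z.Alph n s) × (∀ j, Y n j) | Z.law n ω.1 ≠ 0 ∧ ω.1 ∈ E} =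
      Prod.fst ⁻¹' {z | Z.law n z ≠ 0 ∧ z ∈ E} from rfl,
    ← Measure.map_apply measurable_fst hm, Z.map_fst_joint, PMF.toMeasure_apply _ hm]
  refine tsum_congr fun z => ?_
  by_cases h : Z.law n z = 0 <;> by_cases h' : z ∈ E <;> simp [Set.indicator, h, h']

/-- With the threshold at `g` below the sum of `R + r`, conditional probabilities are at most `2 ^
(-(n * (∑ - g)))` up to a vanishing event. Against at most `4 ^ Fintype.card S * 2 ^ (n * (∑ - 2 *
g))` bins a factor `2 ^ (-(n * g))` remains; the powers of `4` come from rounding. -/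
lemma AuxSources.tendsto_not_isSpread {R r : S → ℝ} {I' : Finset I}
    (h : ∀ S' ⊆ privateMessages A I', S'.Nonempty →
      ((∑ s ∈ S', (R s + r s) : ℝ) : EReal) ≤
        infEntropy (Z.joint W) (fun _ ω => S'.restrict ω.1)
          (fun _ ω => (publicMessages A I').restrict ω.1))
    {g : ℝ} (hg : 0 < g) {B : Finset S} {C L : ℕ → S → ℕ}
    (hCL : ∀ n : ℕ, ∀ s ∈ B, (C n s * L n s : ℝ) ≤ 4 * 2 ^ (n * (R s + r s - 2 * g))) :
    Tendsto (fun n : ℕ => ∑' z, {z | ¬ IsSpread (Z.law n) (fun s => Fin (C n s) × Fin (L n s))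
        (privateMessages A I') (publicMessages A I') B
          (ENNReal.ofReal (4 ^ Fintype.card S * 2 ^ (-(n * g)))) z}.indicator (Z.law n) z)
      atTop (𝓝 0) := by
  classical
  have hlim : Tendsto (fun n : ℕ => ∑ S' ∈ (privateMessages A I').powerset.filter (·.Nonempty),
      Z.joint W n {ω | condInfo (Z.joint W) (fun _ ω => S'.restrict ω.1)
          (fun _ ω => (publicMessages A I').restrict ω.1) n ω <
            ∑ s ∈ S', (R s + r s) - g}) atTop (𝓝 0) := by
    rw [← Finset.sum_const_zero]
    refine tendsto_finsetSum _ fun D' hD' => ?_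
    obtain ⟨h1, h2⟩ := Finset.mem_filter.1 hD'
    exact tendsto_of_lt_infEntropy _ _ _ (h D' (Finset.mem_powerset.1 h1) h2) (by linarith)
  refine tendsto_of_tendsto_of_tendsto_of_le_of_le' tendsto_const_nhds hlim
    (Eventually.of_forall fun _ => zero_le) ?_
  filter_upwards [eventually_ne_atTop 0] with n hn
  rw [Z.tsum_indicator_law W]
  refine le_trans (measure_mono fun ω hω => ?_) (measure_biUnion_finset_le _ _)
  obtain ⟨h0, hω⟩ := hω
  simp only [Set.mem_ofPred_eq, IsSpread, not_forall, not_le] at hω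
  obtain ⟨S', h1, h2, h3⟩ := hω
  refine Set.mem_biUnion (Finset.mem_coe.2 (Finset.mem_filter.2
    ⟨Finset.mem_powerset.2 (h1.trans Finset.inter_subset_left), h2⟩)) ?_
  refine condInfo_lt_of_lt_measure (Z.joint W) (fun _ ω => S'.restrict ω.1)
    (fun _ ω => (publicMessages A I').restrict ω.1) hn ?_
  have hmarg : marg (Z.law n) (publicMessages A I') ω.1 ≠ 0 := fun h' =>
    h0 (le_antisymm ((apply_le_marg _ _ _).trans h'.le) zero_le)
  rw [Z.condDistrib_restrict W n S' _ ω.1 hmarg]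
  by_contra! hle
  refine absurd h3 (not_lt.2 ?_)
  have hprod : ∏ s ∈ S', (Fintype.card (Fin (C n s) × Fin (L n s)) : ENNReal) ≤
      ENNReal.ofReal (4 ^ Fintype.card S * 2 ^ (n * (∑ s ∈ S', (R s + r s) - 2 * g))) := by
    have h4 : ∏ s ∈ S', (Fintype.card (Fin (C n s) × Fin (L n s)) : ENNReal) =
        ENNReal.ofReal (∏ s ∈ S', (C n s * L n s : ℝ)) := by
      rw [ENNReal.ofReal_prod_of_nonneg fun _ _ => by positivity]
      refine Finset.prod_congr rfl fun s _ => ?_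
      rw [Fintype.card_prod, Fintype.card_fin, Fintype.card_fin, ← Nat.cast_mul,
        ENNReal.ofReal_natCast]
    rw [h4]
    refine ENNReal.ofReal_le_ofReal ?_
    calc ∏ s ∈ S', (C n s * L n s : ℝ)
        ≤ ∏ s ∈ S', (4 * (2 : ℝ) ^ (n * (R s + r s - 2 * g))) :=
          Finset.prod_le_prod (fun _ _ => by positivity) fun s hs =>
            hCL n s (Finset.mem_of_mem_inter_right (h1 hs))
      _ = 4 ^ S'.card * 2 ^ (n * (∑ s ∈ S', (R s + r s) - S'.card * (2 * g))) := by
          rw [Finset.prod_mul_distrib, Finset.prod_const, ← Real.rpow_sum_of_pos two_pos,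
            ← Finset.mul_sum, Finset.sum_sub_distrib, Finset.sum_const, nsmul_eq_mul]
      _ ≤ _ := by
          have h5 : (1 : ℝ) ≤ S'.card := by exact_mod_cast h2.card_pos
          -- One share of the slack is enough, and a nonempty `S'` has at least one.
          have h6 : 2 * g ≤ S'.card * (2 * g) := le_mul_of_one_le_left (by positivity) h5
          refine mul_le_mul (pow_le_pow_right₀ (by norm_num) (Finset.card_le_univ _))
            (Real.rpow_le_rpow_of_exponent_le one_le_two ?_) (by positivity) (by positivity)
          exact mul_le_mul_of_nonneg_left (by linarith) (by positivity)
  calc _ ≤ ENNReal.ofReal (2 ^ (-(n * (∑ s ∈ S', (R s + r s) - g)))) *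
        ENNReal.ofReal (4 ^ Fintype.card S * 2 ^ (n * (∑ s ∈ S', (R s + r s) - 2 * g))) :=
        mul_le_mul hle hprod zero_le zero_le
    _ = _ := by
        rw [← ENNReal.ofReal_mul (by positivity), mul_left_comm, ← Real.rpow_add two_pos]
        congr 3
        ring

/-- About `2 ^ (n * (∑ r + g))` candidates against at least `2 ^ (n * (∑ r + 2 * g))` bins. -/
lemma prod_inv_mul_inv_le {C : S → ℕ} {r : S → ℝ} {g : ℝ} {n : ℕ} {D' : Finset S}
    (h : (2 : ℝ) ^ (n * (∑ s ∈ D', r s + 2 * g)) ≤ ∏ s ∈ D', (C s : ℝ)) :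
    (∏ s ∈ D', (C s : ENNReal)⁻¹) * (ENNReal.ofReal (2 ^ (-(n * (∑ s ∈ D', r s + g)))))⁻¹ ≤
      ENNReal.ofReal (2 ^ (-(n * g))) := by
  have hpos : 0 < ∏ s ∈ D', (C s : ℝ) := lt_of_lt_of_le (by positivity) h
  have h1 : ∏ s ∈ D', (C s : ENNReal)⁻¹ = ENNReal.ofReal (∏ s ∈ D', (C s : ℝ))⁻¹ := by
    rw [← Finset.prod_inv_distrib, ENNReal.ofReal_prod_of_nonneg fun _ _ => by positivity]
    refine Finset.prod_congr rfl fun s hs => ?_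
    have hs0 : (C s : ℝ) ≠ 0 := fun h0 => hpos.ne' (Finset.prod_eq_zero hs h0)
    rw [ENNReal.ofReal_inv_of_pos (lt_of_le_of_ne (by positivity) hs0.symm),
      ENNReal.ofReal_natCast]
  rw [h1, ← ENNReal.ofReal_inv_of_pos (by positivity), ← ENNReal.ofReal_mul (by positivity)]
  refine ENNReal.ofReal_le_ofReal ?_
  calc (∏ s ∈ D', (C s : ℝ))⁻¹ * (2 ^ (-(n * (∑ s ∈ D', r s + g))))⁻¹
      ≤ (2 ^ (n * (∑ s ∈ D', r s + 2 * g)))⁻¹ * (2 ^ (-(n * (∑ s ∈ D', r s + g))))⁻¹ := by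
        gcongr
    _ = _ := by
        rw [← Real.rpow_neg two_pos.le, ← Real.rpow_neg two_pos.le, ← Real.rpow_add two_pos]
        congr 1
        ring

theorem isAchievable_of_mem_RIT {R : S → ℝ} (hR : R ∈ RIT A D W) : IsAchievable A D W R := by
  classical
  obtain ⟨hR0, Z, r, h1, h2⟩ := hR
  refine isAchievable_of_hasGoodCode hR0 fun ε hε => ?_
  -- Only messages demanded somewhere are binned; for the others `r s` has no lower bound and
  -- nothing has to be decoded.
  set Dem : Finset S := Finset.univ.biUnion D
  have hD : ∀ j, D j ⊆ Dem := fun j => Finset.subset_biUnion_of_mem D (Finset.mem_univ j)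
  have hr : ∀ s ∈ Dem, 0 ≤ r s := fun s hs => by
    obtain ⟨j, -, hj⟩ := Finset.mem_biUnion.1 hs
    have h3 := (supEntropy_nonneg _ _ _).trans
      (h2 j {s} (Finset.singleton_subset_iff.2 hj) (Finset.singleton_nonempty s))
    rw [Finset.sum_singleton] at h3
    exact_mod_cast h3
  obtain ⟨g, hg, N, B, C, L, hC, hL, hB, hN, hCL, hprod, hrate⟩ := exists_bin_sizes Dem hR0 hr hε
  have : ∀ n s, NeZero (C n s) := fun n s => ⟨hC n s⟩
  have : ∀ n s, NeZero (L n s) := fun n s => ⟨hL n s⟩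
  -- This parameter stays fixed as `n` grows: each block contributes `η` in the limit, in total less
  -- than `ε`.
  set η : ℝ := ε / (2 * ((accessFamily A).card + 1)) with hη
  have hη0 : 0 < η := by positivity
  set lik : ℕ → J → ENNReal := fun n j => Z.joint W n {ω | ¬ IsLikely (Z.posterior W D n)
      (fun D' => ENNReal.ofReal (2 ^ (-(n * (∑ s ∈ D', r s + g))))) N j (ω.2 j) ω.1} with hlik
  set spr : ℕ → Finset I → ENNReal := fun n I' =>
    ∑' z, {z | ¬ IsSpread (Z.law n) (fun s => Fin (C n s) × Fin (L n s))
        (privateMessages A I') (publicMessages A I') B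
          (ENNReal.ofReal (4 ^ Fintype.card S * 2 ^ (-(n * g)))) z}.indicator (Z.law n) z with hspr
  have hlik0 : ∀ j, Tendsto (fun n => lik n j) atTop (𝓝 0) := fun j =>
    Z.tendsto_not_isLikely W (h2 j) hg N
  have hspr0 : ∀ I' ∈ accessFamily A, Tendsto (fun n => spr n I') atTop (𝓝 0) := fun I' hI' =>
    Z.tendsto_not_isSpread W (h1 I' hI') hg hCL
  have hexp := tendsto_ofReal_two_rpow_neg hg
  have hε0 : Tendsto (fun n : ℕ => ENNReal.ofReal (4 ^ Fintype.card S * 2 ^ (-(n * g))))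
      atTop (𝓝 0) := by
    have := ENNReal.Tendsto.const_mul (a := ENNReal.ofReal (4 ^ Fintype.card S)) hexp
      (.inr ENNReal.ofReal_ne_top)
    rw [mul_zero] at this
    refine this.congr fun n => (ENNReal.ofReal_mul (by positivity)).symm
  have hlim : Tendsto (fun n : ℕ => ∑ j, (lik n j +
        ∑ D' ∈ (D j).powerset.filter (fun D' => ¬ D' ⊆ N), ENNReal.ofReal (2 ^ (-(n * g)))) +
      ∑ I' ∈ accessFamily A, (spr n I' + ENNReal.ofReal η +
        (2 ^ Fintype.card S * ENNReal.ofReal (4 ^ Fintype.card S * 2 ^ (-(n * g))) + spr n I') /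
          ENNReal.ofReal η)) atTop
      (𝓝 (∑ _j : J, (0 + ∑ _D' ∈ (D _j).powerset.filter (fun D' => ¬ D' ⊆ N), 0) +
        ∑ _I' ∈ accessFamily A, (0 + ENNReal.ofReal η + (2 ^ Fintype.card S * 0 + 0) /
          ENNReal.ofReal η))) := by
    refine (tendsto_finsetSum _ fun j _ => (hlik0 j).add
      (tendsto_finsetSum _ fun _ _ => hexp)).add (tendsto_finsetSum _ fun I' hI' =>
        ((hspr0 I' hI').add_const _).add (ENNReal.Tendsto.div_const
          ((ENNReal.Tendsto.const_mul hε0 (.inr (by finiteness))).add (hspr0 I' hI')) (.inr ?_)))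
    simpa using hη0
  have hlt : (∑ _j : J, (0 + ∑ _D' ∈ (D _j).powerset.filter (fun D' => ¬ D' ⊆ N), 0) +
        ∑ _I' ∈ accessFamily A, (0 + ENNReal.ofReal η + (2 ^ Fintype.card S * 0 + 0) /
          ENNReal.ofReal η)) < ENNReal.ofReal ε := by
    simp only [mul_zero, add_zero, zero_add, ENNReal.zero_div, Finset.sum_const_zero,
      Finset.sum_const, nsmul_eq_mul]
    rw [← ENNReal.ofReal_natCast, ← ENNReal.ofReal_mul (by positivity)]
    refine (ENNReal.ofReal_lt_ofReal_iff hε).2 ?_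
    rw [hη, mul_div_assoc', div_lt_iff₀ (by positivity)]
    nlinarith
  filter_upwards [hlim.eventually_lt_const hlt, eventually_ne_atTop 0] with n hn hn0
  obtain ⟨E, hE, herr⟩ := exists_code Z W n (C := C n) (L := L n) (Z.posterior W D n)
    (fun D' => ENNReal.ofReal (2 ^ (-(n * (∑ s ∈ D', r s + g))))) N B Dem hD (hB n) (hN n)
    (fun D' => (ENNReal.ofReal_pos.2 (by positivity)).ne') (fun D' => ENNReal.ofReal_ne_top)
    (ENNReal.ofReal (4 ^ Fintype.card S * 2 ^ (-(n * g)))) hη0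
  refine ⟨E, fun s => by rw [hE]; exact hrate n hn0 s, herr.trans (le_trans ?_ hn.le)⟩
  refine add_le_add (Finset.sum_le_sum fun j _ => add_le_add le_rfl
    (Finset.sum_le_sum fun D' hD' => ?_)) le_rfl
  obtain ⟨h3, h4⟩ := Finset.mem_filter.1 hD'
  exact prod_inv_mul_inv_le (hprod n D' ((Finset.mem_powerset.1 h3).trans (hD j)) h4)

end Achievability

end MultiChannel

end

theorem theorem1 {S I J : Type*} [Fintype S] [Fintype I] [Fintype J]
    [DecidableEq S] [DecidableEq I]
    {X : I → Type*} [∀ i, Fintype (X i)]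
    {Y : ℕ → J → Type*} [∀ n j, MeasurableSpace (Y n j)]
    (A : Finset (S × I)) (D : J → Finset S) (W : MultiChannel.Channel X Y) :
    MultiChannel.ROP A D W = MultiChannel.RIT A D W := by
  exact Set.Subset.antisymm
    (fun R hR => MultiChannel.mem_RIT_of_isAchievable (MultiChannel.isAchievable_of_mem_ROP hR))
    (fun R hR => subset_closure (MultiChannel.isAchievable_of_mem_RIT W hR))
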